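/- **Conventions.** Manifolds are smooth Banach manifolds (Hausdorff, without boundary, modelled on real Banach spaces). A *weak Riemannian metric* on $M$ is a smooth family $g$ of continuous, symmetric, positive definite bilinear forms on the tangent spaces (the topology induced by $g$ on $T_mM$ may be weaker than the given one); $|v|=\sqrt{g(v,v)}$. A *weak hyperkähler Banach manifold* $(M,g,I_1,I_2,I_3)$ consists of a weak Riemannian metric $g$ that has a smooth Levi-Civita connection $\nabla$, and smooth anti-commuting almost complex structures $I_1,I_2,I_3$ which are fibrewise isometries, satisfy $I_1I_2I_3=-1$ and commute with $\nabla$. The sectional curvature of the plane spanned by $u,v$ is $K(u,v)=\dfrac{g(R(u,v)v,u)}{|u|^2|v|^2-g(u,v)^2}$, where $R(X,Y)Z=\nabla_X\nabla_YZ-\nabla_Y\nabla_XZ-\nabla_{[X,Y]}Z$. Let a Banach Lie group $G$ with Lie algebra $\mathfrak g$ act smoothly on a weak hyperkähler Banach manifold $(M,g,I_1,I_2,I_3)$. For $\rho\in\mathfrak g$ let $\check\rho$ be its fundamental vector field, and let $\check{\mathfrak g}_m=\{\check\rho_m:\rho\in\mathfrak g\}\subset T_mM$. Suppose the action is *tri-Hamiltonian*: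 there are smooth $G$-equivariant maps $\mu_1,\mu_2,\mu_3:M\to\mathfrak g^*$ with $\langle d\mu_i(v),\rho\rangle=g(v,I_i\check\rho)$ for all tangent vectors $v$ and all $\rho\in\mathfrak g$. Let $c=(c_1,c_2,c_3)\in(\mathfrak g^*)^3$ be fixed by the coadjoint action, and let $M_c=\{m:\mu_i(m)=c_i,\ i=1,2,3\}$. Assume that * $M_c$ is a (split, embedded) submanifold of $M$ with $T_mM_c=\bigcap_i\ker (d\mu_i)_m$ for all $m\in M_c$; * the action of $G$ on $M_c$ is free, proper (the map $(h,m)\mapsto(hm,m)$ is proper) and isometric (for the metric induced by $g$), and it is *elliptic* at every $m\in M_c$, i.e. $\Lambda_m(T_mM)=\Lambda_m(\check{\mathfrak g}_m)$, where $\Lambda_m(v)\in\mathfrak g^*$ is given by $\Lambda_m(v)(\rho)=g(v,\check\rho_m)$. Let $Q=M_c/G$ be the hyperkähler quotient: the orbit space, with the smooth structure for which the projection $M_c\to Q$ is a submersion, the weak Riemannian metric for which $d(\text{projection})$ preserves scalar products of vectors of $T_mM_c$ orthogonal to $\check{\mathfrak g}_m$, and the smooth Levi-Civita connection of this metric. For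 $m\in M_c$ let $H_m\subset T_mM$ be the $g$-orthogonal complement of $\check{\mathfrak g}_m+I_1\check{\mathfrak g}_m+I_2\check{\mathfrak g}_m+I_3\check{\mathfrak g}_m$. For $X,Y\in H_m$ let $A(X,Y)\in\check{\mathfrak g}_m$ be the $\check{\mathfrak g}_m$-part of $(\nabla_X\tilde Y)_m$ (that is, $(\nabla_X\tilde Y)_m-A(X,Y)\perp\check{\mathfrak g}_m$), where $\tilde Y$ is any smooth vector field near $m$ extending $Y$ with $\tilde Y_x\perp\check{\mathfrak g}_x$ for all $x\in M_c$ near $m$; this does not depend on $\tilde Y$. Put $$V(m)=\sup\Big\{\tfrac{|A(X,Y)|}{|X||Y|}\;:\;X,Y\in H_m\setminus\{0\}\Big\}\in[0,+\infty].$$ **Proposition.** For every $p\in Q$, every $m\in M_c$ projecting to $p$ and every plane $\pi\subset T_pQ$ with horizontal lift $\tilde\pi\subset T_mM_c$ (the plane orthogonal to $\check{\mathfrak g}_m$ which projects onto $\pi$), $$|K_Q(\pi)-K_M(\tilde\pi)|\le 9\,V(m)^2 .$$ -/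

import Mathlib

open Bundle Set Filter
open scoped Manifold ContDiff Topology ENNReal

namespace HKQuot

noncomputable section

/-! ## Weak Riemannian Banach manifolds

All manifolds are smooth manifolds without boundary, modelled on a real Banach space through
`𝓘(ℝ, E)`. -/

section Riemannian

variable {E : Type*} [NormedAddCommGroup E] [NormedSpace ℝ E]
  {M : Type*} [TopologicalSpace M] [ChartedSpace E M] [IsManifold 𝓘(ℝ, E) ∞ M]

variable (E M) in
/-- Families of continuous bilinear forms on the tangent spaces of `M`. -/
abbrev BilinField : Type _ :=
  (x : M) → TangentSpace 𝓘(ℝ, E) x →L[ℝ] TangentSpace 𝓘(ℝ, E) x →L[ℝ] ℝ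

variable (E M) in
/-- Families of continuous endomorphisms of the tangent spaces of `M`. -/
abbrev EndoField : Type _ :=
  (x : M) → TangentSpace 𝓘(ℝ, E) x →L[ℝ] TangentSpace 𝓘(ℝ, E) x

variable (E M) in
/-- Covariant derivatives on the tangent bundle of `M`; `D Y x v` is `(∇_v Y)(x)`. -/
abbrev Connection : Type _ :=
  CovariantDerivative 𝓘(ℝ, E) E (fun x : M ↦ TangentSpace 𝓘(ℝ, E) x)

/-- The vector field `Y` is differentiable at `x`. -/
def DiffFieldAt (Y : (x : M) → TangentSpace 𝓘(ℝ, E) x) (x : M) : Prop :=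
  MDifferentiableAt 𝓘(ℝ, E) 𝓘(ℝ, E).tangent
    (fun y ↦ (⟨y, Y y⟩ : TangentBundle 𝓘(ℝ, E) M)) x

/-- The vector field `Y` is smooth at `x`. -/
def SmoothFieldAt
    (Y : (x : M) → TangentSpace 𝓘(ℝ, E) x) (x : M) : Prop :=
  ContMDiffAt 𝓘(ℝ, E) 𝓘(ℝ, E).tangent ∞
    (fun y ↦ (⟨y, Y y⟩ : TangentBundle 𝓘(ℝ, E) M)) x

/-- A weak Riemannian metric: a smooth family of continuous symmetric positive definite bilinear
forms on the tangent spaces. The topology it induces on a tangent space may be weaker than the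
given one. -/
structure IsWeakMetric (g : BilinField E M) : Prop where
  symm : ∀ (x : M) (v w : TangentSpace 𝓘(ℝ, E) x), g x v w = g x w v
  pos : ∀ (x : M) (v : TangentSpace 𝓘(ℝ, E) x), v ≠ 0 → 0 < g x v v
  smooth : ContMDiff 𝓘(ℝ, E) (𝓘(ℝ, E).prod 𝓘(ℝ, E →L[ℝ] E →L[ℝ] ℝ)) ∞
    (fun x : M ↦ TotalSpace.mk' (E →L[ℝ] E →L[ℝ] ℝ)
      (E := fun x : M ↦ TangentSpace 𝓘(ℝ, E) x →L[ℝ] TangentSpace 𝓘(ℝ, E) x →L[ℝ] ℝ) x (g x))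

/-- The length of a tangent vector. -/
def len (g : BilinField E M) {x : M} (v : TangentSpace 𝓘(ℝ, E) x) : ℝ := √(g x v v)

/-- `D` is a smooth Levi-Civita connection of `g`. Smoothness is required on every open set, since
there may be few globally smooth vector fields. -/
structure IsLeviCivita (g : BilinField E M) (D : Connection E M) :
    Prop where
  metric : ∀ (x : M) (Y Z : (x : M) → TangentSpace 𝓘(ℝ, E) x) (v : TangentSpace 𝓘(ℝ, E) x),
    DiffFieldAt Y x → DiffFieldAt Z x →
      mvfderiv 𝓘(ℝ, E) (fun y ↦ g y (Y y) (Z y)) x v =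
        g x (D Y x v) (Z x) + g x (Y x) (D Z x v)
  torsionFree : ∀ (x : M) (X Y : (x : M) → TangentSpace 𝓘(ℝ, E) x),
    DiffFieldAt X x → DiffFieldAt Y x →
      D Y x (X x) - D X x (Y x) = VectorField.mlieBracket 𝓘(ℝ, E) X Y x
  smooth : ∀ U : Set M, IsOpen U → ContMDiffCovariantDerivativeOn E ∞ D.toFun U

/-- The curvature expression `∇_X ∇_Y Z - ∇_Y ∇_X Z - ∇_{[X,Y]} Z`. -/
def curvatureField (D : Connection E M) (X Y Z : (x : M) → TangentSpace 𝓘(ℝ, E) x) (x : M) :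
    TangentSpace 𝓘(ℝ, E) x :=
  D (fun y ↦ D Z y (Y y)) x (X x) - D (fun y ↦ D Z y (X y)) x (Y x)
    - D Z x (VectorField.mlieBracket 𝓘(ℝ, E) X Y x)

/-- The curvature `R(u, v) w` at a point, computed with the extensions of `u`, `v`, `w` that are
constant in the preferred chart at the point. -/
def curvature (D : Connection E M) {x : M}
    (u v w : TangentSpace 𝓘(ℝ, E) x) : TangentSpace 𝓘(ℝ, E) x :=
  curvatureField D (FiberBundle.extend E u) (FiberBundle.extend E v) (FiberBundle.extend E w) x

/-- The sectional curvature of the plane spanned by two linearly independent vectors `u`, `v`. -/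
def sectionalCurvature (g : BilinField E M) (D : Connection E M) {x : M}
    (u v : TangentSpace 𝓘(ℝ, E) x) : ℝ :=
  g x (curvature D u v v) u / (g x u u * g x v v - g x u v ^ 2)

/-- `(g, D, J)` is a weak hyperkähler structure: `g` is a weak Riemannian metric with smooth
Levi-Civita connection `D`, and `J 0, J 1, J 2` are smooth anti-commuting almost complex
structures that are fibrewise isometries, satisfy `J 0 ∘ J 1 ∘ J 2 = -1` and commute
with `D`. -/
structure IsWeakHyperkahler (g : BilinField E M) (D : Connection E M)
    (J : Fin 3 → EndoField E M) : Prop where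
  isWeakMetric : IsWeakMetric g
  isLeviCivita : IsLeviCivita g D
  smooth : ∀ i, ContMDiff 𝓘(ℝ, E) (𝓘(ℝ, E).prod 𝓘(ℝ, E →L[ℝ] E)) ∞
    (fun x : M ↦ TotalSpace.mk' (E →L[ℝ] E)
      (E := fun x : M ↦ TangentSpace 𝓘(ℝ, E) x →L[ℝ] TangentSpace 𝓘(ℝ, E) x) x (J i x))
  square : ∀ i (x : M) (v : TangentSpace 𝓘(ℝ, E) x), J i x (J i x v) = -v
  anticomm : ∀ i j, i ≠ j → ∀ (x : M) (v : TangentSpace 𝓘(ℝ, E) x),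
    J i x (J j x v) = -J j x (J i x v)
  triple : ∀ (x : M) (v : TangentSpace 𝓘(ℝ, E) x), J 0 x (J 1 x (J 2 x v)) = -v
  isometry : ∀ i (x : M) (v w : TangentSpace 𝓘(ℝ, E) x), g x (J i x v) (J i x w) = g x v w
  parallel : ∀ i (x : M) (Y : (x : M) → TangentSpace 𝓘(ℝ, E) x) (v : TangentSpace 𝓘(ℝ, E) x),
    DiffFieldAt Y x → D (fun y ↦ J i y (Y y)) x v = J i x (D Y x v)

end Riemannian

/-! ## Actions of Banach Lie groups

`G` is a Banach Lie group modelled on `L`; its Lie algebra `T_1 G` is, by definition of the tangent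
space, the Banach space `L`, and the dual of the Lie algebra is `L →L[ℝ] ℝ`. -/

section Action

variable {L : Type*} [NormedAddCommGroup L] [NormedSpace ℝ L]
  {G : Type*} [TopologicalSpace G] [ChartedSpace L G] [Group G]
  {E : Type*} [NormedAddCommGroup E] [NormedSpace ℝ E]
  {M : Type*} [TopologicalSpace M] [ChartedSpace E M] [MulAction G M]

variable (L G E) in
/-- The map `ρ ↦ ρ̌ₘ`, the value at `m` of the fundamental vector field of `ρ`: the derivative at
`1` of the orbit map `h ↦ h • m`. -/
def fund (m : M) : L →L[ℝ] TangentSpace 𝓘(ℝ, E) m :=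
  mfderiv 𝓘(ℝ, L) 𝓘(ℝ, E) (fun h : G ↦ h • m) 1

variable (L) in
/-- The adjoint action: the derivative at `1` of `x ↦ h * x * h⁻¹`. -/
def Ad (h : G) : L →L[ℝ] L :=
  mfderiv 𝓘(ℝ, L) 𝓘(ℝ, L) (fun x : G ↦ h * x * h⁻¹) 1

/-- The coadjoint action. -/
def coAd (h : G) (ℓ : L →L[ℝ] ℝ) : L →L[ℝ] ℝ := ℓ.comp (Ad L h⁻¹)

variable (L G) in
/-- The dual-valued form `Λ(v)(ρ) = g(v, ρ̌)`. -/
def Lam (g : BilinField E M) (m : M) (v : TangentSpace 𝓘(ℝ, E) m) : L →L[ℝ] ℝ :=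
  (g m v).comp (fund L G E m)

variable (L G) in
/-- The action is elliptic at `m`: `Λ(T_m M)` equals the image under `Λ` of the tangent directions
of the orbit. -/
def IsEllipticAt (g : BilinField E M) (m : M) : Prop :=
  Set.range (Lam L G g m) = Lam L G g m '' Set.range (fund L G E m)

variable (G) in
/-- `μ 0, μ 1, μ 2` are moment maps for the action with respect to `(g, J)`: they are smooth,
equivariant, and `⟨dμᵢ(v), ρ⟩ = g(v, Jᵢ ρ̌)`. -/
structure IsHyperkahlerMomentMap (g : BilinField E M) (J : Fin 3 → EndoField E M)
    (μ : Fin 3 → M → (L →L[ℝ] ℝ)) : Prop where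
  smooth : ∀ i, ContMDiff 𝓘(ℝ, E) 𝓘(ℝ, L →L[ℝ] ℝ) ∞ (μ i)
  equivariant : ∀ i (h : G) (m : M), μ i (h • m) = coAd h (μ i m)
  deriv_eq : ∀ i (m : M) (v : TangentSpace 𝓘(ℝ, E) m) (ρ : L),
    mvfderiv 𝓘(ℝ, E) (μ i) m v ρ = g m v (J i m (fund L G E m ρ))

/-- The level set `M_c = μ⁻¹(c)`. -/
def levelSet (μ : Fin 3 → M → (L →L[ℝ] ℝ)) (c : Fin 3 → (L →L[ℝ] ℝ)) : Set M :=
  {m | ∀ i, μ i m = c i}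

/-- The action of `G` on `M_c` is free, proper, isometric (for the metric induced on `M_c`, whose
tangent spaces are the joint kernels of the `dμᵢ`) and elliptic at the points of `M_c`.
Properness is that of `(h, m) ↦ (h • m, m)` on `G × M_c`; its target is taken to be `M × M`
since `M_c` is closed in `M`. -/
structure IsGoodOnLevel (G : Type*) [TopologicalSpace G] [ChartedSpace L G] [Group G]
    [MulAction G M] (g : BilinField E M) (μ : Fin 3 → M → (L →L[ℝ] ℝ))
    (c : Fin 3 → (L →L[ℝ] ℝ)) : Prop where
  free : ∀ (h : G), ∀ m ∈ levelSet μ c, h • m = m → h = 1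
  proper : IsProperMap (fun p : G × levelSet μ c ↦ ((p.1 • (p.2 : M), (p.2 : M)) : M × M))
  isometric : ∀ (h : G), ∀ m ∈ levelSet μ c, ∀ v w : TangentSpace 𝓘(ℝ, E) m,
    (∀ i, mvfderiv 𝓘(ℝ, E) (μ i) m v = 0) → (∀ i, mvfderiv 𝓘(ℝ, E) (μ i) m w = 0) →
      g (h • m) (mfderiv 𝓘(ℝ, E) 𝓘(ℝ, E) (fun y : M ↦ h • y) m v)
        (mfderiv 𝓘(ℝ, E) 𝓘(ℝ, E) (fun y : M ↦ h • y) m w) = g m v w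
  elliptic : ∀ m ∈ levelSet μ c, IsEllipticAt L G g m

/-- With its given manifold structure, `M_c` is a (split) embedded submanifold of `M`
with `T_m M_c = ker dμ_m` at each of its points `m`. -/
structure IsLevelSubmanifold {Ec : Type*} [NormedAddCommGroup Ec] [NormedSpace ℝ Ec]
    (μ : Fin 3 → M → (L →L[ℝ] ℝ)) (c : Fin 3 → (L →L[ℝ] ℝ))
    [ChartedSpace Ec (levelSet μ c)] : Prop where
  embedding : Manifold.IsSmoothEmbedding 𝓘(ℝ, Ec) 𝓘(ℝ, E) ∞ (Subtype.val : levelSet μ c → M)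
  tangent : ∀ (x : levelSet μ c) (v : TangentSpace 𝓘(ℝ, E) (x : M)),
    (∃ u : TangentSpace 𝓘(ℝ, Ec) x,
      mfderiv 𝓘(ℝ, Ec) 𝓘(ℝ, E) (Subtype.val : levelSet μ c → M) x u = v) ↔
    ∀ i, mvfderiv 𝓘(ℝ, E) (μ i) (x : M) v = 0

/-! ## The quotient -/

variable (G) in
/-- The space of orbits `μ⁻¹(c) / G` (with the quotient topology). -/
abbrev Quo (μ : Fin 3 → M → (L →L[ℝ] ℝ)) (c : Fin 3 → (L →L[ℝ] ℝ)) : Type _ :=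
  Quotient ((MulAction.orbitRel G M).comap (Subtype.val : levelSet μ c → M))

variable (G) in
/-- The projection `μ⁻¹(c) → μ⁻¹(c) / G`. -/
def proj (μ : Fin 3 → M → (L →L[ℝ] ℝ)) (c : Fin 3 → (L →L[ℝ] ℝ)) (x : levelSet μ c) :
    Quo G μ c :=
  Quotient.mk _ x

variable (L G) in
/-- `v` is orthogonal to the directions `ρ̌ₘ`. -/
def IsHorizontal (g : BilinField E M) {m : M} (v : TangentSpace 𝓘(ℝ, E) m) : Prop :=
  ∀ ρ : L, g m v (fund L G E m ρ) = 0

variable (L G) in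
/-- `v` is orthogonal to the quaternionic span of the directions `ρ̌ₘ`. -/
def IsQuatHorizontal (g : BilinField E M) (J : Fin 3 → EndoField E M) {m : M}
    (v : TangentSpace 𝓘(ℝ, E) m) : Prop :=
  (∀ ρ : L, g m v (fund L G E m ρ) = 0) ∧
    ∀ (i : Fin 3) (ρ : L), g m v (J i m (fund L G E m ρ)) = 0

/-- The manifold structure and the metric `gQ` of the quotient `Q = μ⁻¹(c) / G` are the quotient
ones: the projection `μ⁻¹(c) → Q` is a smooth submersion and a Riemannian submersion, i.e. its
derivative preserves scalar products of vectors of `T_m M_c` that are orthogonal to the orbit. -/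
structure IsQuotientStructure {Ec : Type*} [NormedAddCommGroup Ec] [NormedSpace ℝ Ec]
    {EQ : Type*} [NormedAddCommGroup EQ] [NormedSpace ℝ EQ]
    (G : Type*) [TopologicalSpace G] [ChartedSpace L G] [Group G] [MulAction G M]
    (g : BilinField E M) (μ : Fin 3 → M → (L →L[ℝ] ℝ)) (c : Fin 3 → (L →L[ℝ] ℝ))
    [ChartedSpace Ec (levelSet μ c)] [ChartedSpace EQ (Quo G μ c)]
    [IsManifold 𝓘(ℝ, EQ) ∞ (Quo G μ c)]
    (gQ : BilinField EQ (Quo G μ c)) : Prop where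
  submersion : Manifold.IsSubmersion 𝓘(ℝ, Ec) 𝓘(ℝ, EQ) ∞ (proj G μ c)
  isWeakMetric : IsWeakMetric gQ
  riemannian : ∀ (x : levelSet μ c) (u v : TangentSpace 𝓘(ℝ, Ec) x),
    IsHorizontal L G g (mfderiv 𝓘(ℝ, Ec) 𝓘(ℝ, E) (Subtype.val : levelSet μ c → M) x u) →
    IsHorizontal L G g (mfderiv 𝓘(ℝ, Ec) 𝓘(ℝ, E) (Subtype.val : levelSet μ c → M) x v) →
      gQ (proj G μ c x) (mfderiv 𝓘(ℝ, Ec) 𝓘(ℝ, EQ) (proj G μ c) x u)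
          (mfderiv 𝓘(ℝ, Ec) 𝓘(ℝ, EQ) (proj G μ c) x v) =
        g x (mfderiv 𝓘(ℝ, Ec) 𝓘(ℝ, E) (Subtype.val : levelSet μ c → M) x u)
          (mfderiv 𝓘(ℝ, Ec) 𝓘(ℝ, E) (Subtype.val : levelSet μ c → M) x v)

/-! ## The O'Neill tensor -/

variable (L G) in
/-- `A(X, Y) = Z` at `m ∈ S`, where `S` is the level set: `Z` is the part of `∇_X Ỹ` tangent to the
orbit, for a local extension `Ỹ` of `Y` that is horizontal along `S`. -/
def IsONeill [IsManifold 𝓘(ℝ, E) ∞ M] (g : BilinField E M) (D : Connection E M) (S : Set M) (m : M)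
    (X Y Z : TangentSpace 𝓘(ℝ, E) m) : Prop :=
  ∃ Yt : (x : M) → TangentSpace 𝓘(ℝ, E) x,
    SmoothFieldAt Yt m ∧ Yt m = Y ∧ (∀ᶠ x in 𝓝[S] m, IsHorizontal L G g (Yt x)) ∧
    Z ∈ Set.range (fund L G E m) ∧ IsHorizontal L G g (D Yt m X - Z)

variable (L G) in
/-- `V(m)`: the (possibly infinite) norm of the tensor `A` on the orthogonal complement of the
quaternionic span of the orbit directions. -/
def oneillNorm [IsManifold 𝓘(ℝ, E) ∞ M] (g : BilinField E M) (D : Connection E M)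
    (J : Fin 3 → EndoField E M) (S : Set M) (m : M) : ℝ≥0∞ :=
  ⨆ (X : TangentSpace 𝓘(ℝ, E) m) (Y : TangentSpace 𝓘(ℝ, E) m) (Z : TangentSpace 𝓘(ℝ, E) m)
    (_ : IsQuatHorizontal L G g J X ∧ X ≠ 0) (_ : IsQuatHorizontal L G g J Y ∧ Y ≠ 0)
    (_ : IsONeill L G g D S m X Y Z), ENNReal.ofReal (len g Z / (len g X * len g Y))

end Action

end

end HKQuot

/-! The proof combines the Gauss equation for `M_c ⊂ M` with O'Neill's equation for `M_c → Q`; the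
quaternionic structure makes both error terms values of the same tensor `A`.

Let `X`, `Y` be horizontal lifts of constant fields of a chart of `Q`. Along `M_c`, `∇_X Y` splits
orthogonally into the horizontal lift of the covariant derivative on `Q` (Koszul's formula), an
orbit part `A(X, Y)`, which is skew in `X`, `Y` and equals half the bracket, and a part normal to
`M_c`. Each `μ i` is constant on orbits in `M_c`, so the orbit directions `V` are orthogonal to
every `J i V`. The quaternion relations then make the `J i V` mutually orthogonal, and `T M_c` is
the orthogonal complement of their sum. The normal part is therefore `-∑ J i (y i)`, with `y i` the
orbit part of `J i (∇_X Y)`. Because `J i` is parallel and preserves the complement of the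
quaternionic span of `V`, `y i = A(X, J i Y)`. Differentiating once more gives `R_Q - R_M = 3
|A(X,Y)|² + ∑ i, (g(A(Y, J i Y), A(X, J i X)) - |A(X, J i Y)|²)` for the numerators of the sectional
curvatures. For an orthogonal basis of the plane each scalar product is at most `V(m)² |X|² |Y|²`,
and there are `3 + 3 + 3` of them.

The metric is weak, so functionals cannot be represented by vectors. Curvature is therefore
expressed by Christoffel symbols of the first kind (`chr`, `curvLow`), and second-kind symbols enter
only at a single point. Orthogonal projections to the orbit directions come from ellipticity.
Smoothness of horizontal lifts (`exists_lift`) comes from the bounded isomorphism `T M_c ⊕ ⨁ J i V ≅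
T M`, in which `J 0` exposes the orbit component of a tangent vector.

The main steps are `curvLow_along` (curvature along a map), `IsLocalQuotient.curvLow_lift` (the
curvature formula), `IsLocalQuotient.abs_curvLow_sub_le` (the estimate), `IsLeviCivita.curvature_eq`
(passage to charts) and `IsHyperkahlerQuotient.isONeill_lift` (identification with `A`). -/

namespace HKQuot

/-! ## Local Riemannian calculus in normed spaces -/

namespace MultilinearInstances

/-! Shortcut instances for spaces of multilinear maps, which are expensive to synthesize. -/

variable {E : Type*} [NormedAddCommGroup E] [NormedSpace ℝ E]

noncomputable scoped instance : NormedAddCommGroup (E →L[ℝ] ℝ) := inferInstance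
noncomputable scoped instance : NormedSpace ℝ (E →L[ℝ] ℝ) := inferInstance
noncomputable scoped instance : NormedAddCommGroup (E →L[ℝ] E →L[ℝ] ℝ) := inferInstance
noncomputable scoped instance : NormedSpace ℝ (E →L[ℝ] E →L[ℝ] ℝ) := inferInstance
noncomputable scoped instance : NormedAddCommGroup (E →L[ℝ] E →L[ℝ] E →L[ℝ] ℝ) := inferInstance
noncomputable scoped instance : NormedSpace ℝ (E →L[ℝ] E →L[ℝ] E →L[ℝ] ℝ) := inferInstance

end MultilinearInstances

/-! ### Christoffel symbols of the first kind and curvature along a map -/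

section LocalCalculus

open scoped MultilinearInstances

variable {E : Type*} [NormedAddCommGroup E] [NormedSpace ℝ E]
  {W : Type*} [NormedAddCommGroup W] [NormedSpace ℝ W]

/-- The Christoffel symbol of the first kind: `g (Γ v w) z`. -/
noncomputable def chr (g : E → E →L[ℝ] E →L[ℝ] ℝ) (y v w z : E) : ℝ :=
  (fderiv ℝ g y v w z + fderiv ℝ g y w v z - fderiv ℝ g y z v w) / 2

/-- The expression of the curvature tensor in terms of Christoffel symbols. -/
noncomputable def curvLow (g : E → E →L[ℝ] E →L[ℝ] ℝ) (y : E) (Γ : E → E → E) (a b c d : E) : ℝ :=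
  fderiv ℝ (fun y ↦ chr g y b c d) y a - fderiv ℝ (fun y ↦ chr g y a c d) y b
    - g y (Γ b c) (Γ a d) + g y (Γ a c) (Γ b d)

theorem fderiv_bilin_apply {g : E → E →L[ℝ] E →L[ℝ] ℝ} {f α β : W → E} {x : W}
    (hg : DifferentiableAt ℝ g (f x)) (hf : DifferentiableAt ℝ f x)
    (hα : DifferentiableAt ℝ α x) (hβ : DifferentiableAt ℝ β x) :
    HasFDerivAt (fun y ↦ g (f y) (α y) (β y))
      (fderiv ℝ (fun y ↦ g (f y) (α y) (β y)) x) x ∧ ∀ a : W,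
    fderiv ℝ (fun y ↦ g (f y) (α y) (β y)) x a =
      fderiv ℝ g (f x) (fderiv ℝ f x a) (α x) (β x) + g (f x) (fderiv ℝ α x a) (β x)
        + g (f x) (α x) (fderiv ℝ β x a) := by
  have h : HasFDerivAt (fun y ↦ g (f y) (α y) (β y)) _ x :=
    ((hg.hasFDerivAt.comp x hf.hasFDerivAt).clm_apply hα.hasFDerivAt).clm_apply hβ.hasFDerivAt
  refine ⟨h.differentiableAt.hasFDerivAt, fun a ↦ ?_⟩
  rw [HasFDerivAt.fderiv h]
  simp only [Function.comp_apply, add_apply, ContinuousLinearMap.comp_apply,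
    ContinuousLinearMap.flip_apply]
  ring

theorem fderiv_trilin_apply {T : E → E →L[ℝ] E →L[ℝ] E →L[ℝ] ℝ} {f α β γ : W → E} {x : W}
    (hT : DifferentiableAt ℝ T (f x)) (hf : DifferentiableAt ℝ f x)
    (hα : DifferentiableAt ℝ α x) (hβ : DifferentiableAt ℝ β x) (hγ : DifferentiableAt ℝ γ x) :
    HasFDerivAt (fun y ↦ T (f y) (α y) (β y) (γ y))
      (fderiv ℝ (fun y ↦ T (f y) (α y) (β y) (γ y)) x) x ∧ ∀ a : W,
    fderiv ℝ (fun y ↦ T (f y) (α y) (β y) (γ y)) x a =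
      fderiv ℝ T (f x) (fderiv ℝ f x a) (α x) (β x) (γ x) + T (f x) (fderiv ℝ α x a) (β x) (γ x)
        + T (f x) (α x) (fderiv ℝ β x a) (γ x) + T (f x) (α x) (β x) (fderiv ℝ γ x a) := by
  have h : HasFDerivAt (fun y ↦ T (f y) (α y) (β y) (γ y)) _ x :=
    (((hT.hasFDerivAt.comp x hf.hasFDerivAt).clm_apply hα.hasFDerivAt).clm_apply
      hβ.hasFDerivAt).clm_apply hγ.hasFDerivAt
  refine ⟨h.differentiableAt.hasFDerivAt, fun a ↦ ?_⟩
  rw [HasFDerivAt.fderiv h]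
  simp only [Function.comp_apply, add_apply, ContinuousLinearMap.comp_apply,
    ContinuousLinearMap.flip_apply]
  ring

/-- The derivative of a Christoffel symbol evaluated on functions. -/
theorem fderiv_chr {g : E → E →L[ℝ] E →L[ℝ] ℝ} {f α β γ : W → E} {x : W}
    (hg : ContDiffAt ℝ 2 g (f x)) (hf : DifferentiableAt ℝ f x)
    (hα : DifferentiableAt ℝ α x) (hβ : DifferentiableAt ℝ β x) (hγ : DifferentiableAt ℝ γ x) :
    DifferentiableAt ℝ (fun y ↦ chr g (f y) (α y) (β y) (γ y)) x ∧ ∀ a : W,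
    fderiv ℝ (fun y ↦ chr g (f y) (α y) (β y) (γ y)) x a =
      (fderiv ℝ (fderiv ℝ g) (f x) (fderiv ℝ f x a) (α x) (β x) (γ x)
        + fderiv ℝ (fderiv ℝ g) (f x) (fderiv ℝ f x a) (β x) (α x) (γ x)
        - fderiv ℝ (fderiv ℝ g) (f x) (fderiv ℝ f x a) (γ x) (α x) (β x)) / 2
      + chr g (f x) (fderiv ℝ α x a) (β x) (γ x) + chr g (f x) (α x) (fderiv ℝ β x a) (γ x)
      + chr g (f x) (α x) (β x) (fderiv ℝ γ x a) := by
  have hT : DifferentiableAt ℝ (fderiv ℝ g) (f x) :=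
    (hg.fderiv_right (m := 1) (by norm_num)).differentiableAt (by norm_num)
  obtain ⟨h1, e1⟩ := fderiv_trilin_apply hT hf hα hβ hγ
  obtain ⟨h2, e2⟩ := fderiv_trilin_apply hT hf hβ hα hγ
  obtain ⟨h3, e3⟩ := fderiv_trilin_apply hT hf hγ hα hβ
  have h := ((h1.add h2).sub h3).mul_const (1 / 2 : ℝ)
  have h' : HasFDerivAt (fun y ↦ chr g (f y) (α y) (β y) (γ y)) _ x :=
    h.congr_of_eventuallyEq (Eventually.of_forall fun y ↦ by simp [chr]; ring)
  refine ⟨h'.differentiableAt, fun a ↦ ?_⟩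
  rw [h'.fderiv]
  simp only [smul_apply, add_apply,
    sub_apply, e1, e2, e3, smul_eq_mul, chr]
  ring

theorem fderiv_chr_const {g : E → E →L[ℝ] E →L[ℝ] ℝ} {y : E} (hg : ContDiffAt ℝ 2 g y)
    (a b c d : E) :
    fderiv ℝ (fun y ↦ chr g y b c d) y a =
      (fderiv ℝ (fderiv ℝ g) y a b c d + fderiv ℝ (fderiv ℝ g) y a c b d
        - fderiv ℝ (fderiv ℝ g) y a d b c) / 2 := by
  have := (fderiv_chr (f := fun y : E ↦ y) (α := fun _ ↦ b) (β := fun _ ↦ c) (γ := fun _ ↦ d)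
    (x := y) hg differentiableAt_fun_id (differentiableAt_const _) (differentiableAt_const _)
    (differentiableAt_const _)).2 a
  simpa [chr] using this

theorem fderiv_symm_of_eventually {g : E → E →L[ℝ] E →L[ℝ] ℝ} {y : E}
    (hg : DifferentiableAt ℝ g y) (hs : ∀ᶠ z in 𝓝 y, ∀ v w, g z v w = g z w v) (a v w : E) :
    fderiv ℝ g y a v w = fderiv ℝ g y a w v := by
  have h1 := (fderiv_bilin_apply (f := fun y : E ↦ y) (α := fun _ ↦ v) (β := fun _ ↦ w) (x := y)
    hg differentiableAt_fun_id (differentiableAt_const _) (differentiableAt_const _)).2 a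
  have h2 := (fderiv_bilin_apply (f := fun y : E ↦ y) (α := fun _ ↦ w) (β := fun _ ↦ v) (x := y)
    hg differentiableAt_fun_id (differentiableAt_const _) (differentiableAt_const _)).2 a
  have h3 : fderiv ℝ (fun y ↦ g y v w) y = fderiv ℝ (fun y ↦ g y w v) y :=
    Filter.EventuallyEq.fderiv_eq (hs.mono fun z hz ↦ hz v w)
  rw [h3] at h1
  simp only [fderiv_fun_const, fderiv_fun_id, Pi.zero_apply, zero_apply, map_zero,
    add_zero, ContinuousLinearMap.id_apply] at h1 h2
  rw [← h1, ← h2]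

theorem chr_comm {g : E → E →L[ℝ] E →L[ℝ] ℝ} {y : E}
    (hs : ∀ a v w, fderiv ℝ g y a v w = fderiv ℝ g y a w v) (v w z : E) :
    chr g y v w z = chr g y w v z := by
  simp only [chr, hs z v w]; ring

theorem chr_add_chr {g : E → E →L[ℝ] E →L[ℝ] ℝ} {y : E}
    (hs : ∀ a v w, fderiv ℝ g y a v w = fderiv ℝ g y a w v) (v w z : E) :
    chr g y v w z + chr g y v z w = fderiv ℝ g y v w z := by
  simp only [chr, hs w v z, hs z v w, hs v z w]; ring

theorem chr_add_left (g : E → E →L[ℝ] E →L[ℝ] ℝ) (y v v' w z : E) :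
    chr g y (v + v') w z = chr g y v w z + chr g y v' w z := by
  simp only [chr, map_add, add_apply]; ring

theorem chr_sub_left (g : E → E →L[ℝ] E →L[ℝ] ℝ) (y v v' w z : E) :
    chr g y (v - v') w z = chr g y v w z - chr g y v' w z := by
  simp only [chr, map_sub, sub_apply]; ring

theorem chr_sub_middle (g : E → E →L[ℝ] E →L[ℝ] ℝ) (y v w w' z : E) :
    chr g y v (w - w') z = chr g y v w z - chr g y v w' z := by
  simp only [chr, map_sub, sub_apply]; ring

theorem chr_smul_left (g : E → E →L[ℝ] E →L[ℝ] ℝ) (y v w z : E) (t : ℝ) :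
    chr g y (t • v) w z = t * chr g y v w z := by
  simp only [chr, map_smul, smul_apply, smul_eq_mul]; ring

theorem chr_smul_middle (g : E → E →L[ℝ] E →L[ℝ] ℝ) (y v w z : E) (t : ℝ) :
    chr g y v (t • w) z = t * chr g y v w z := by
  simp only [chr, map_smul, smul_apply, smul_eq_mul]; ring

/-- The function differentiated is `g(∇_b σ, τ)`, with `∇` taken along `f`. The second derivatives
of `σ` and `f` are kept as separate terms because they cancel after antisymmetrization. -/
theorem fderiv_covariant_pairing {g : E → E →L[ℝ] E →L[ℝ] ℝ} {f σ τ : W → E} {b : W → W} {x : W}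
    (hg : ContDiffAt ℝ 2 g (f x)) (hf : ContDiffAt ℝ 2 f x) (hσ : ContDiffAt ℝ 2 σ x)
    (hτ : DifferentiableAt ℝ τ x) (hb : DifferentiableAt ℝ b x) (c : W) :
    fderiv ℝ (fun y ↦ g (f y) (fderiv ℝ σ y (b y)) (τ y)
        + chr g (f y) (fderiv ℝ f y (b y)) (σ y) (τ y)) x c =
      fderiv ℝ g (f x) (fderiv ℝ f x c) (fderiv ℝ σ x (b x)) (τ x)
      + (g (f x) (fderiv ℝ σ x (fderiv ℝ b x c)) (τ x)
        + g (f x) (fderiv ℝ (fderiv ℝ σ) x c (b x)) (τ x))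
      + g (f x) (fderiv ℝ σ x (b x)) (fderiv ℝ τ x c)
      + (fderiv ℝ (fun y ↦ chr g y (fderiv ℝ f x (b x)) (σ x) (τ x)) (f x) (fderiv ℝ f x c)
      + (chr g (f x) (fderiv ℝ f x (fderiv ℝ b x c)) (σ x) (τ x)
        + chr g (f x) (fderiv ℝ (fderiv ℝ f) x c (b x)) (σ x) (τ x))
      + chr g (f x) (fderiv ℝ f x (b x)) (fderiv ℝ σ x c) (τ x)
      + chr g (f x) (fderiv ℝ f x (b x)) (σ x) (fderiv ℝ τ x c)) := by
  have hgd : DifferentiableAt ℝ g (f x) := hg.differentiableAt (by norm_num)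
  have hfd : DifferentiableAt ℝ f x := hf.differentiableAt (by norm_num)
  have hσd : DifferentiableAt ℝ σ x := hσ.differentiableAt (by norm_num)
  have hf' : DifferentiableAt ℝ (fderiv ℝ f) x :=
    (hf.fderiv_right (m := 1) (by norm_num)).differentiableAt (by norm_num)
  have hσ' : DifferentiableAt ℝ (fderiv ℝ σ) x :=
    (hσ.fderiv_right (m := 1) (by norm_num)).differentiableAt (by norm_num)
  have k1 := hσ'.hasFDerivAt.clm_apply hb.hasFDerivAt
  have k2 := hf'.hasFDerivAt.clm_apply hb.hasFDerivAt
  obtain ⟨d1, e1⟩ := fderiv_bilin_apply hgd hfd k1.differentiableAt hτ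
  obtain ⟨d2, e2⟩ := fderiv_chr hg hfd k2.differentiableAt hσd hτ
  rw [fderiv_fun_add d1.differentiableAt d2, add_apply, e1, e2,
    fderiv_chr_const hg, k1.fderiv, k2.fderiv]
  simp only [add_apply, ContinuousLinearMap.comp_apply, ContinuousLinearMap.flip_apply,
    map_add, chr_add_left]

/-- The structure equation for covariant derivatives along a map. -/
theorem curvLow_along {g : E → E →L[ℝ] E →L[ℝ] ℝ} {f σ τ : W → E} {a b : W → W} {x : W}
    {Γ : E → E → E}
    (hg : ContDiffAt ℝ 2 g (f x)) (hs : ∀ᶠ y in 𝓝 (f x), ∀ v w, g y v w = g y w v)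
    (hΓ : ∀ v w z, g (f x) (Γ v w) z = chr g (f x) v w z)
    (hf : ContDiffAt ℝ 2 f x) (hσ : ContDiffAt ℝ 2 σ x) (hτ : DifferentiableAt ℝ τ x)
    (ha : DifferentiableAt ℝ a x) (hb : DifferentiableAt ℝ b x) :
    fderiv ℝ (fun y ↦ g (f y) (fderiv ℝ σ y (b y)) (τ y)
        + chr g (f y) (fderiv ℝ f y (b y)) (σ y) (τ y)) x (a x)
      - fderiv ℝ (fun y ↦ g (f y) (fderiv ℝ σ y (a y)) (τ y)
        + chr g (f y) (fderiv ℝ f y (a y)) (σ y) (τ y)) x (b x)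
      - g (f x) (fderiv ℝ σ x (b x) + Γ (fderiv ℝ f x (b x)) (σ x))
          (fderiv ℝ τ x (a x) + Γ (fderiv ℝ f x (a x)) (τ x))
      + g (f x) (fderiv ℝ σ x (a x) + Γ (fderiv ℝ f x (a x)) (σ x))
          (fderiv ℝ τ x (b x) + Γ (fderiv ℝ f x (b x)) (τ x))
      - (g (f x) (fderiv ℝ σ x (fderiv ℝ b x (a x) - fderiv ℝ a x (b x))) (τ x)
        + chr g (f x) (fderiv ℝ f x (fderiv ℝ b x (a x) - fderiv ℝ a x (b x))) (σ x) (τ x))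
      = curvLow g (f x) Γ (fderiv ℝ f x (a x)) (fderiv ℝ f x (b x)) (σ x) (τ x) := by
  -- Second derivatives of `f` and `σ` are symmetric, so they drop out of the antisymmetrized
  -- expression.
  have sf := (hf.isSymmSndFDerivAt (by simp)) (a x) (b x)
  have sσ := (hσ.isSymmSndFDerivAt (by simp)) (a x) (b x)
  have hD := fderiv_symm_of_eventually (hg.differentiableAt (by norm_num)) hs
  have hs0 := hs.self_of_nhds
  rw [fderiv_covariant_pairing hg hf hσ hτ hb, fderiv_covariant_pairing hg hf hσ hτ ha, sf, sσ,
    curvLow]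
  simp only [map_sub, map_add, sub_apply, add_apply, chr_sub_left]
  -- What remains is linear in finitely many numbers, related by torsion-freeness (`chr_comm`),
  -- metric compatibility (`chr_add_chr`), symmetry of `g` and the defining property of `Γ`.
  generalize fderiv ℝ (fderiv ℝ σ) x (b x) (a x) = s2
  generalize fderiv ℝ (fderiv ℝ f) x (b x) (a x) = f2
  generalize fderiv ℝ (fun y ↦ chr g y (fderiv ℝ f x (b x)) (σ x) (τ x)) (f x)
    (fderiv ℝ f x (a x)) = r1
  generalize fderiv ℝ (fun y ↦ chr g y (fderiv ℝ f x (a x)) (σ x) (τ x)) (f x)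
    (fderiv ℝ f x (b x)) = r2
  generalize fderiv ℝ f x (a x) = fa
  generalize fderiv ℝ f x (b x) = fb
  generalize fderiv ℝ σ x (a x) = sa
  generalize fderiv ℝ σ x (b x) = sb
  generalize fderiv ℝ τ x (a x) = ta
  generalize fderiv ℝ τ x (b x) = tb
  have c1 := chr_comm hD fa sb (τ x)
  have c2 := chr_comm hD fb sa (τ x)
  have d1 := chr_add_chr hD fa sb (τ x)
  have d2 := chr_add_chr hD fb sa (τ x)
  have e1 := hs0 (Γ fa (τ x)) sb
  have e2 := hs0 (Γ fb (τ x)) sa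
  have e3 := hΓ fa (τ x) sb
  have e4 := hΓ fb (τ x) sa
  have e5 := hΓ fa (σ x) tb
  have e6 := hΓ fb (σ x) ta
  linarith

theorem curvLow_self_left (g : E → E →L[ℝ] E →L[ℝ] ℝ) (y : E) (Γ : E → E → E) (a c d : E) :
    curvLow g y Γ a a c d = 0 := by
  simp [curvLow]

end LocalCalculus

/-! ### Horizontal lifts for a submanifold that submerses onto a base -/

section LocalQuotient

open scoped MultilinearInstances

variable {E : Type*} [NormedAddCommGroup E] [NormedSpace ℝ E]
  {W : Type*} [NormedAddCommGroup W] [NormedSpace ℝ W]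
  {B : Type*} [NormedAddCommGroup B] [NormedSpace ℝ B]

/-- Near `x`, the map `f : W → E` is a submanifold of the space `(E, g)`, `p : W → B` is a
Riemannian submersion onto `(B, q)`, and `h` is its horizontal lift. -/
structure IsLocalQuotient (g : E → E →L[ℝ] E →L[ℝ] ℝ) (q : B → B →L[ℝ] B →L[ℝ] ℝ)
    (f : W → E) (p : W → B) (h : W → B →L[ℝ] W) (x : W) : Prop where
  contDiff_metric : ContDiffAt ℝ 3 g (f x)
  contDiff_base : ContDiffAt ℝ 3 q (p x)
  contDiff_map : ContDiffAt ℝ 3 f x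
  contDiff_proj : ContDiffAt ℝ 3 p x
  contDiff_lift : ContDiffAt ℝ 3 h x
  symm_metric : ∀ᶠ y in 𝓝 (f x), ∀ v w, g y v w = g y w v
  symm_base : ∀ᶠ y in 𝓝 (p x), ∀ v w, q y v w = q y w v
  proj_lift : ∀ᶠ y in 𝓝 x, ∀ X, fderiv ℝ p y (h y X) = X
  metric_lift : ∀ᶠ y in 𝓝 x, ∀ X w,
    g (f y) (fderiv ℝ f y (h y X)) (fderiv ℝ f y w) = q (p y) X (fderiv ℝ p y w)

/-- The horizontal lift of a constant vector field. -/
noncomputable def lift (f : W → E) (h : W → B →L[ℝ] W) (X : B) (y : W) : E :=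
  fderiv ℝ f y (h y X)

/-- The covariant derivative of a horizontal lift in the direction of a horizontal lift. -/
noncomputable def nab (f : W → E) (h : W → B →L[ℝ] W) (Γ : E → E → E) (x : W) (X Y : B) : E :=
  fderiv ℝ (lift f h Y) x (h x X) + Γ (lift f h X x) (lift f h Y x)

namespace IsLocalQuotient

variable {g : E → E →L[ℝ] E →L[ℝ] ℝ} {q : B → B →L[ℝ] B →L[ℝ] ℝ}
  {f : W → E} {p : W → B} {h : W → B →L[ℝ] W} {x : W}

/-- All the conditions are open, so identities derived from them at a point hold nearby and can be
differentiated. -/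
protected theorem eventually (H : IsLocalQuotient g q f p h x) :
    ∀ᶠ y in 𝓝 x, IsLocalQuotient g q f p h y := by
  have cf := H.contDiff_map.continuousAt
  have cp := H.contDiff_proj.continuousAt
  filter_upwards [cf.eventually (H.contDiff_metric.eventually (by simp)),
    cp.eventually (H.contDiff_base.eventually (by simp)), H.contDiff_map.eventually (by simp),
    H.contDiff_proj.eventually (by simp), H.contDiff_lift.eventually (by simp),
    cf.eventually H.symm_metric.eventually_nhds, cp.eventually H.symm_base.eventually_nhds,
    H.proj_lift.eventually_nhds, H.metric_lift.eventually_nhds] with y h1 h2 h3 h4 h5 h6 h7 h8 h9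
  exact ⟨h1, h2, h3, h4, h5, h6, h7, h8, h9⟩

theorem contDiffAt_lift_apply (H : IsLocalQuotient g q f p h x) (X : B) :
    ContDiffAt ℝ 3 (fun y ↦ h y X) x :=
  H.contDiff_lift.clm_apply contDiffAt_const

theorem contDiffAt_lift (H : IsLocalQuotient g q f p h x) (X : B) :
    ContDiffAt ℝ 2 (lift f h X) x :=
  (H.contDiff_map.fderiv_right (m := 2) (by norm_num)).clm_apply
    ((H.contDiffAt_lift_apply X).of_le (by norm_num))

theorem fderiv_lift (H : IsLocalQuotient g q f p h x) (X : B) (a : W) :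
    fderiv ℝ (lift f h X) x a = fderiv ℝ (fderiv ℝ f) x a (h x X)
      + fderiv ℝ f x (fderiv ℝ (fun y ↦ h y X) x a) := by
  have k := (H.contDiff_map.fderiv_right (m := 2) (by norm_num)).differentiableAt (by norm_num)
  have k' := (H.contDiffAt_lift_apply X).differentiableAt (by norm_num)
  have := k.hasFDerivAt.clm_apply k'.hasFDerivAt
  rw [show lift f h X = fun y ↦ fderiv ℝ f y (h y X) from rfl, this.fderiv]
  simp only [add_apply, ContinuousLinearMap.comp_apply, ContinuousLinearMap.flip_apply, add_comm]

/-- This is the derivative of `dp (h X) = X`. -/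
theorem fderiv_proj_fderiv_lift (H : IsLocalQuotient g q f p h x) (X : B) (a : W) :
    fderiv ℝ p x (fderiv ℝ (fun y ↦ h y X) x a) = - fderiv ℝ (fderiv ℝ p) x a (h x X) := by
  have k := (H.contDiff_proj.fderiv_right (m := 2) (by norm_num)).differentiableAt (by norm_num)
  have k' := (H.contDiffAt_lift_apply X).differentiableAt (by norm_num)
  have h1 := k.hasFDerivAt.clm_apply k'.hasFDerivAt
  have h2 : fderiv ℝ (fun y ↦ fderiv ℝ p y (h y X)) x = 0 := by
    rw [Filter.EventuallyEq.fderiv_eq (f₁ := fun y ↦ fderiv ℝ p y (h y X)) (f := fun _ ↦ X)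
      (H.proj_lift.mono fun y hy ↦ hy X)]
    simp
  have h3 := DFunLike.congr_fun (h1.fderiv.symm.trans h2) a
  simp only [add_apply, ContinuousLinearMap.comp_apply, ContinuousLinearMap.flip_apply,
    zero_apply] at h3
  exact eq_neg_of_add_eq_zero_left h3

/-- The bracket of two horizontal lifts is vertical. -/
theorem fderiv_proj_bracket (H : IsLocalQuotient g q f p h x) (X Y : B) :
    fderiv ℝ p x (fderiv ℝ (fun y ↦ h y Y) x (h x X) - fderiv ℝ (fun y ↦ h y X) x (h x Y)) = 0 := by
  rw [map_sub, H.fderiv_proj_fderiv_lift, H.fderiv_proj_fderiv_lift,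
    (H.contDiff_proj.isSymmSndFDerivAt (by simp; norm_num)) (h x X) (h x Y), sub_self]

/-- Torsion-freeness along `f`: the second derivatives of `f` cancel and the push-forward of the
bracket remains. -/
theorem fderiv_lift_sub (H : IsLocalQuotient g q f p h x) (X Y : B) :
    fderiv ℝ (lift f h Y) x (h x X) - fderiv ℝ (lift f h X) x (h x Y) =
      fderiv ℝ f x (fderiv ℝ (fun y ↦ h y Y) x (h x X) - fderiv ℝ (fun y ↦ h y X) x (h x Y)) := by
  rw [map_sub, H.fderiv_lift, H.fderiv_lift,
    (H.contDiff_map.isSymmSndFDerivAt (by simp; norm_num)) (h x X) (h x Y)]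
  abel

theorem metric_lift_lift (H : IsLocalQuotient g q f p h x) (X Y : B) :
    g (f x) (lift f h X x) (lift f h Y x) = q (p x) X Y := by
  rw [lift, lift, H.metric_lift.self_of_nhds, H.proj_lift.self_of_nhds]

theorem metric_lift_vertical (H : IsLocalQuotient g q f p h x) (X : B) {k : W}
    (hk : fderiv ℝ p x k = 0) : g (f x) (lift f h X x) (fderiv ℝ f x k) = 0 := by
  rw [lift, H.metric_lift.self_of_nhds, hk, map_zero]

theorem fderiv_metric_symm (H : IsLocalQuotient g q f p h x) (a v w : E) :
    fderiv ℝ g (f x) a v w = fderiv ℝ g (f x) a w v :=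
  fderiv_symm_of_eventually (H.contDiff_metric.differentiableAt (by norm_num)) H.symm_metric a v w

/-- Koszul's formula: the horizontal part of the covariant derivative of horizontal lifts. -/
theorem koszul (H : IsLocalQuotient g q f p h x) (X Y Z : B) :
    g (f x) (fderiv ℝ (lift f h Y) x (h x X)) (lift f h Z x)
      + chr g (f x) (lift f h X x) (lift f h Y x) (lift f h Z x) = chr q (p x) X Y Z := by
  have hgd := H.contDiff_metric.differentiableAt (n := 3) (by norm_num)
  have hqd := H.contDiff_base.differentiableAt (n := 3) (by norm_num)
  have hfd := H.contDiff_map.differentiableAt (n := 3) (by norm_num)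
  have hpd := H.contDiff_proj.differentiableAt (n := 3) (by norm_num)
  have hld := fun X ↦ (H.contDiffAt_lift X).differentiableAt (n := 2) (by norm_num)
  have hs0 := H.symm_metric.self_of_nhds
  -- The scalar product of two lifts is pulled back from the base, so its derivative along `h X` is
  -- a derivative of `q` along `X`.
  have compat : ∀ X Y Z : B,
      fderiv ℝ g (f x) (lift f h X x) (lift f h Y x) (lift f h Z x)
        + g (f x) (fderiv ℝ (lift f h Y) x (h x X)) (lift f h Z x)
        + g (f x) (lift f h Y x) (fderiv ℝ (lift f h Z) x (h x X))
      = fderiv ℝ q (p x) X Y Z := by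
    intro X Y Z
    have e1 := (fderiv_bilin_apply hgd hfd (hld Y) (hld Z)).2 (h x X)
    have e2 := (fderiv_bilin_apply (α := fun _ ↦ Y) (β := fun _ ↦ Z) hqd hpd
      (differentiableAt_const _) (differentiableAt_const _)).2 (h x X)
    rw [Filter.EventuallyEq.fderiv_eq (f := fun y ↦ q (p y) Y Z)
      (H.eventually.mono fun y hy ↦ hy.metric_lift_lift Y Z), e2] at e1
    simp only [fderiv_fun_const, Pi.zero_apply, zero_apply, map_zero, add_zero,
      H.proj_lift.self_of_nhds X] at e1
    exact e1.symm
  -- The bracket of two lifts is vertical, hence orthogonal to every lift.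
  have tors : ∀ X Y Z : B, g (f x) (fderiv ℝ (lift f h Y) x (h x X)) (lift f h Z x)
      = g (f x) (fderiv ℝ (lift f h X) x (h x Y)) (lift f h Z x) := by
    intro X Y Z
    rw [← sub_eq_zero, ← sub_apply, ← map_sub, H.fderiv_lift_sub, hs0,
      H.metric_lift_vertical Z (H.fderiv_proj_bracket X Y)]
  have a1 := compat X Y Z
  have a2 := compat Y X Z
  have a3 := compat Z X Y
  have b1 := tors X Y Z
  have b2 := tors X Z Y
  have b3 := tors Y Z X
  rw [hs0 (lift f h Y x)] at a1
  rw [hs0 (lift f h X x)] at a2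
  rw [hs0 (lift f h X x)] at a3
  simp only [chr]
  linarith

/-- In covariant notation, `g(∇_Y X, k) + g(∇_k Y, X) = 0`. It follows by differentiating `g(lift X,
f_* k) = q(X, p_* k)` along `h Y` with `k` a constant field: the second derivatives of `f` and `p`
that appear are those in the derivative of `lift Y` along `k`. -/
theorem pairing_vertical (H : IsLocalQuotient g q f p h x) (X Y : B) {k : W}
    (hk : fderiv ℝ p x k = 0) :
    (g (f x) (fderiv ℝ (lift f h X) x (h x Y)) (fderiv ℝ f x k)
        + chr g (f x) (lift f h Y x) (lift f h X x) (fderiv ℝ f x k))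
      + (g (f x) (fderiv ℝ (lift f h Y) x k) (lift f h X x)
        + chr g (f x) (fderiv ℝ f x k) (lift f h Y x) (lift f h X x)) = 0 := by
  have hgd := H.contDiff_metric.differentiableAt (n := 3) (by norm_num)
  have hqd := H.contDiff_base.differentiableAt (n := 3) (by norm_num)
  have hfd := H.contDiff_map.differentiableAt (n := 3) (by norm_num)
  have hpd := H.contDiff_proj.differentiableAt (n := 3) (by norm_num)
  have hld := fun X ↦ (H.contDiffAt_lift X).differentiableAt (n := 2) (by norm_num)
  have hs0 := H.symm_metric.self_of_nhds
  have hf' := (H.contDiff_map.fderiv_right (m := 2) (by norm_num)).differentiableAt (by norm_num)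
  have hp' := (H.contDiff_proj.fderiv_right (m := 2) (by norm_num)).differentiableAt (by norm_num)
  have kf := hf'.hasFDerivAt.clm_apply (hasFDerivAt_const k x)
  have kp := hp'.hasFDerivAt.clm_apply (hasFDerivAt_const k x)
  have e1 := (fderiv_bilin_apply hgd hfd (hld X) kf.differentiableAt).2 (h x Y)
  have e2 := (fderiv_bilin_apply (α := fun _ ↦ X) hqd hpd
      (differentiableAt_const _) kp.differentiableAt).2 (h x Y)
  rw [Filter.EventuallyEq.fderiv_eq (f₁ := fun y ↦ g (f y) (lift f h X y) (fderiv ℝ f y k))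
      (f := fun y ↦ q (p y) X (fderiv ℝ p y k))
      (H.metric_lift.mono fun y hy ↦ hy X k), e2, kf.fderiv, kp.fderiv] at e1
  simp only [fderiv_fun_const, Pi.zero_apply, zero_apply, map_zero, add_zero, zero_add, hk,
    add_apply, ContinuousLinearMap.comp_apply, ContinuousLinearMap.flip_apply] at e1
  have e3 : fderiv ℝ f x (h x Y) = lift f h Y x := rfl
  have e4 : g (f x) (fderiv ℝ (lift f h Y) x k) (lift f h X x) =
      g (f x) (lift f h X x) (fderiv ℝ (fderiv ℝ f) x (h x Y) k)
        - q (p x) X (fderiv ℝ (fderiv ℝ p) x (h x Y) k) := by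
    rw [hs0, H.fderiv_lift, map_add, lift, H.metric_lift.self_of_nhds,
      H.fderiv_proj_fderiv_lift,
      (H.contDiff_map.isSymmSndFDerivAt (by simp; norm_num)) (h x Y) k,
      (H.contDiff_proj.isSymmSndFDerivAt (by simp; norm_num)) (h x Y) k, map_neg]
    rfl
  have e5 := chr_add_chr H.fderiv_metric_symm (lift f h Y x) (lift f h X x) (fderiv ℝ f x k)
  have e6 := chr_comm H.fderiv_metric_symm (lift f h Y x) (fderiv ℝ f x k) (lift f h X x)
  rw [e3] at e1
  linarith

variable {Γ : E → E → E}

theorem nab_pairing (hΓ : ∀ v w z, g (f x) (Γ v w) z = chr g (f x) v w z) (X Y : B) (z : E) :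
    g (f x) (nab f h Γ x X Y) z =
      g (f x) (fderiv ℝ (lift f h Y) x (h x X)) z
        + chr g (f x) (lift f h X x) (lift f h Y x) z := by
  rw [nab, map_add, add_apply, hΓ]

theorem metric_nab_lift (H : IsLocalQuotient g q f p h x)
    (hΓ : ∀ v w z, g (f x) (Γ v w) z = chr g (f x) v w z) (X Y Z : B) :
    g (f x) (nab f h Γ x X Y) (lift f h Z x) = chr q (p x) X Y Z := by
  rw [nab_pairing hΓ, H.koszul]

/-- The values of `Γ` are symmetric because `chr` is and `g` is positive definite; the rest is
`fderiv_lift_sub`. -/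
theorem nab_sub (H : IsLocalQuotient g q f p h x)
    (hΓ : ∀ v w z, g (f x) (Γ v w) z = chr g (f x) v w z)
    (hpos : ∀ v, v ≠ 0 → 0 < g (f x) v v) (X Y : B) :
    nab f h Γ x X Y - nab f h Γ x Y X =
      fderiv ℝ f x (fderiv ℝ (fun y ↦ h y Y) x (h x X) - fderiv ℝ (fun y ↦ h y X) x (h x Y)) := by
  have hcomm : Γ (lift f h X x) (lift f h Y x) = Γ (lift f h Y x) (lift f h X x) := by
    by_contra hne
    have := hpos _ (sub_ne_zero.2 hne)
    simp only [map_sub, sub_apply, hΓ] at this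
    have c := chr_comm H.fderiv_metric_symm (lift f h X x) (lift f h Y x)
    simp [c] at this
  rw [← H.fderiv_lift_sub, nab, nab, hcomm]
  abel

/-- Skewness of the O'Neill tensor. Adding the two instances of `pairing_vertical`, the terms with
`∇_k` form the derivative along `k` of `g(lift X, lift Y)`, a function pulled back from the base. -/
theorem nab_symm_vertical (H : IsLocalQuotient g q f p h x)
    (hΓ : ∀ v w z, g (f x) (Γ v w) z = chr g (f x) v w z) (X Y : B) {k : W}
    (hk : fderiv ℝ p x k = 0) :
    g (f x) (nab f h Γ x X Y) (fderiv ℝ f x k) + g (f x) (nab f h Γ x Y X) (fderiv ℝ f x k) = 0 := by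
  have e1 := H.pairing_vertical X Y hk
  have e2 := H.pairing_vertical Y X hk
  have hs0 := H.symm_metric.self_of_nhds
  have hgd := H.contDiff_metric.differentiableAt (n := 3) (by norm_num)
  have hqd := H.contDiff_base.differentiableAt (n := 3) (by norm_num)
  have hfd := H.contDiff_map.differentiableAt (n := 3) (by norm_num)
  have hpd := H.contDiff_proj.differentiableAt (n := 3) (by norm_num)
  have hld := fun X ↦ (H.contDiffAt_lift X).differentiableAt (n := 2) (by norm_num)
  have a1 := (fderiv_bilin_apply hgd hfd (hld X) (hld Y)).2 k
  have a2 := (fderiv_bilin_apply (α := fun _ ↦ X) (β := fun _ ↦ Y) hqd hpd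
      (differentiableAt_const _) (differentiableAt_const _)).2 k
  rw [Filter.EventuallyEq.fderiv_eq (f := fun y ↦ q (p y) X Y)
      (H.eventually.mono fun y hy ↦ hy.metric_lift_lift X Y), a2] at a1
  simp only [fderiv_fun_const, Pi.zero_apply, zero_apply, map_zero, add_zero, hk] at a1
  have e5 := chr_add_chr H.fderiv_metric_symm (fderiv ℝ f x k) (lift f h X x) (lift f h Y x)
  rw [nab_pairing hΓ, nab_pairing hΓ]
  rw [hs0 (lift f h X x)] at a1
  linarith

/-- The curvature of the ambient space on horizontal vectors in terms of the curvature of the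
base. -/
theorem curvLow_lift (H : IsLocalQuotient g q f p h x)
    (hΓ : ∀ v w z, g (f x) (Γ v w) z = chr g (f x) v w z)
    (hpos : ∀ v, v ≠ 0 → 0 < g (f x) v v) {ΓB : B → B → B} (X Y : B) :
    curvLow g (f x) Γ (lift f h X x) (lift f h Y x) (lift f h Y x) (lift f h X x) =
      curvLow q (p x) ΓB X Y Y X + q (p x) (ΓB Y Y) (ΓB X X) - q (p x) (ΓB X Y) (ΓB Y X)
        - g (f x) (nab f h Γ x Y Y) (nab f h Γ x X X)
        + g (f x) (nab f h Γ x X Y) (nab f h Γ x Y X)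
        + g (f x) (nab f h Γ x X Y - nab f h Γ x Y X) (nab f h Γ x Y X) := by
  have hs0 := H.symm_metric.self_of_nhds
  -- The structure equation for `R(X, Y)Y` paired with `X`, all fields being lifts.
  have main := curvLow_along (a := fun y ↦ h y X) (b := fun y ↦ h y Y)
    (H.contDiff_metric.of_le (by norm_num)) H.symm_metric hΓ
    (H.contDiff_map.of_le (by norm_num)) (H.contDiffAt_lift Y)
    ((H.contDiffAt_lift X).differentiableAt (by norm_num))
    ((H.contDiffAt_lift_apply X).differentiableAt (by norm_num))
    ((H.contDiffAt_lift_apply Y).differentiableAt (by norm_num))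
  have hp := H.contDiff_proj.differentiableAt (n := 3) (by norm_num)
  have hq2 : ContDiffAt ℝ 2 q (p x) := H.contDiff_base.of_le (by norm_num)
  -- By Koszul's formula the differentiated pairing is a Christoffel symbol of the base composed
  -- with `p`.
  have d : ∀ X' Y' Z' a : B,
      fderiv ℝ (fun y ↦ g (f y) (fderiv ℝ (lift f h Y') y (h y X')) (lift f h Z' y)
        + chr g (f y) (fderiv ℝ f y (h y X')) (lift f h Y' y) (lift f h Z' y)) x (h x a)
      = fderiv ℝ (fun y ↦ chr q y X' Y' Z') (p x) a := by
    intro X' Y' Z' a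
    have e : (fun y ↦ g (f y) (fderiv ℝ (lift f h Y') y (h y X')) (lift f h Z' y)
        + chr g (f y) (fderiv ℝ f y (h y X')) (lift f h Y' y) (lift f h Z' y))
        =ᶠ[𝓝 x] fun y ↦ chr q (p y) X' Y' Z' :=
      H.eventually.mono fun y hy ↦ hy.koszul X' Y' Z'
    have e2 := (fderiv_chr (α := fun _ ↦ X') (β := fun _ ↦ Y') (γ := fun _ ↦ Z') hq2 hp
      (differentiableAt_const _) (differentiableAt_const _) (differentiableAt_const _)).2 (h x a)
    rw [e.fderiv_eq, e2, fderiv_chr_const hq2]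
    simp [H.proj_lift.self_of_nhds, chr]
  -- This handles `∇_{[X, Y]}`: the bracket is vertical, so the term is traded for a pairing of `∇_Y
  -- X` with the bracket.
  have v1 := H.pairing_vertical X Y (H.fderiv_proj_bracket X Y)
  rw [← nab_pairing hΓ, ← H.nab_sub hΓ hpos, hs0 (nab f h Γ x Y X)] at v1
  rw [d, d, ← H.nab_sub hΓ hpos] at main
  have hc : curvLow q (p x) ΓB X Y Y X = fderiv ℝ (fun y ↦ chr q y Y Y X) (p x) X
      - fderiv ℝ (fun y ↦ chr q y X Y X) (p x) Y
      - q (p x) (ΓB Y Y) (ΓB X X) + q (p x) (ΓB X Y) (ΓB Y X) := rfl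
  change _ - _ - g (f x) (nab f h Γ x Y Y) (nab f h Γ x X X)
      + g (f x) (nab f h Γ x X Y) (nab f h Γ x Y X) - (_ + chr g (f x) _ (lift f h Y x) _) =
      curvLow g (f x) Γ (lift f h X x) (lift f h Y x) (lift f h Y x) (lift f h X x) at main
  linarith

end IsLocalQuotient

end LocalQuotient

/-! ### Change of basis of a plane, and Cauchy–Schwarz -/

section CurvatureAlgebra

open scoped MultilinearInstances

variable {E : Type*} [NormedAddCommGroup E] [NormedSpace ℝ E]

/-- `curvLow` vanishes on `a, a, c, d` and on `a, b, a, a`, so the numerator of the sectional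
curvature is unchanged when `b` is made orthogonal to `a`. -/
theorem curvLow_sub_smul {g : E → E →L[ℝ] E →L[ℝ] ℝ} {y : E} {Γ : E → E → E}
    (hg : ContDiffAt ℝ 2 g y) (hs : ∀ v w, g y v w = g y w v)
    (hΓ : ∀ v w z, g y (Γ v w) z = chr g y v w z) (a b : E) (t : ℝ) :
    curvLow g y Γ a (b - t • a) (b - t • a) a = curvLow g y Γ a b b a := by
  have hsym := (hg.isSymmSndFDerivAt (by simp)) a b
  -- `Γ` is not assumed linear, so the quadratic terms are rewritten through `chr`: `i1` is visibly
  -- linear in the second argument, `i2` in the third.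
  have i1 : ∀ b c d, curvLow g y Γ a b c d =
      fderiv ℝ (fun y ↦ chr g y b c d) y a - fderiv ℝ (fun y ↦ chr g y a c d) y b
        - chr g y b c (Γ a d) + chr g y b d (Γ a c) := by
    intro b c d
    rw [curvLow, hΓ, hs (Γ a c), hΓ]
  have i2 : ∀ c d, curvLow g y Γ a b c d =
      fderiv ℝ (fun y ↦ chr g y b c d) y a - fderiv ℝ (fun y ↦ chr g y a c d) y b
        - chr g y b c (Γ a d) + chr g y a c (Γ b d) := by
    intro c d
    rw [curvLow, hΓ, hΓ]
  have step1 : ∀ c d, curvLow g y Γ a (b - t • a) c d = curvLow g y Γ a b c d := by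
    intro c d
    have z := curvLow_self_left g y Γ a c d
    rw [i1] at z
    simp only [i1, fderiv_chr_const hg] at z ⊢
    simp only [chr_sub_left, chr_smul_left, map_sub, map_smul, sub_apply,
      smul_apply, smul_eq_mul] at z ⊢
    linear_combination -t * z
  have step2 : curvLow g y Γ a b (b - t • a) a =
      curvLow g y Γ a b b a - t * curvLow g y Γ a b a a := by
    rw [i2, i2, i2]
    simp only [fderiv_chr_const hg]
    simp only [chr_sub_middle, chr_smul_middle, map_sub, map_smul, sub_apply,
      smul_apply, smul_eq_mul]
    ring
  have step3 : curvLow g y Γ a b a a = 0 := by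
    rw [curvLow, fderiv_chr_const hg, fderiv_chr_const hg, hsym, hs (Γ a a)]
    ring
  rw [step1, step2, step3]
  ring

theorem sq_bilin_le {G : E →L[ℝ] E →L[ℝ] ℝ} (hs : ∀ v w, G v w = G w v)
    (hpos : ∀ v, v ≠ 0 → 0 < G v v) (a b : E) : G a b ^ 2 ≤ G a a * G b b := by
  rcases eq_or_ne b 0 with rfl | hb
  · simp
  have h := hpos b hb
  have h2 : 0 ≤ G (G b b • a - G a b • b) (G b b • a - G a b • b) := by
    rcases eq_or_ne (G b b • a - G a b • b) 0 with h0 | h0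
    · simp [h0]
    · exact (hpos _ h0).le
  simp only [map_sub, map_smul, sub_apply, smul_apply, smul_eq_mul, hs b a] at h2
  have h3 : 0 ≤ G b b * (G a a * G b b - G a b ^ 2) := by nlinarith
  have := nonneg_of_mul_nonneg_right h3 h
  linarith

/-- In the application `s` and `t` are the squared lengths of two base vectors and `r` is the
squared bound for the tensor. -/
theorem abs_bilin_le {G : E →L[ℝ] E →L[ℝ] ℝ} (hs : ∀ v w, G v w = G w v)
    (hpos : ∀ v, v ≠ 0 → 0 < G v v) {a b : E} {r s t : ℝ} (hr : 0 ≤ r)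
    (ha : G a a ≤ r * s ^ 2) (hb : G b b ≤ r * t ^ 2) (hs0 : 0 ≤ s) (ht0 : 0 ≤ t) :
    |G a b| ≤ r * (s * t) := by
  have hnn : ∀ v, 0 ≤ G v v := fun v ↦ by
    rcases eq_or_ne v 0 with rfl | h
    · simp
    · exact (hpos v h).le
  apply abs_le_of_sq_le_sq
  · calc G a b ^ 2 ≤ G a a * G b b := sq_bilin_le hs hpos a b
      _ ≤ (r * s ^ 2) * (r * t ^ 2) := by gcongr; exact hnn b
      _ = (r * (s * t)) ^ 2 := by ring
  · positivity

end CurvatureAlgebra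

/-! ## Orthogonal decomposition with respect to a quaternionic structure -/

section Quaternionic

open scoped MultilinearInstances

variable {E : Type*} [NormedAddCommGroup E] [NormedSpace ℝ E]

/-- The relation `J 0 J 1 J 2 = -1` yields the whole quaternion table. Neither `k` nor the sign
matters later: orthogonality to every `J k V` is all that is used. -/
theorem exists_mul_eq_smul {V : Type*} [AddCommGroup V] [Module ℝ V] {J : Fin 3 → V → V}
    (neg : ∀ i v, J i (-v) = -J i v) (square : ∀ i v, J i (J i v) = -v)
    (anticomm : ∀ i j, i ≠ j → ∀ v, J i (J j v) = -J j (J i v))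
    (triple : ∀ v, J 0 (J 1 (J 2 v)) = -v) {i j : Fin 3} (hij : i ≠ j) :
    ∃ k, ∃ ε : ℝ, ∀ v, J i (J j v) = ε • J k v := by
  have h01 : ∀ v, J 0 (J 1 v) = J 2 v := fun v ↦ by
    have := triple (J 2 v)
    rw [square, neg, neg] at this
    exact neg_injective this
  have h12 : ∀ v, J 1 (J 2 v) = J 0 v := fun v ↦ by
    have := congrArg (J 0) (triple v)
    rw [square, neg] at this
    exact neg_injective this
  have h20 : ∀ v, J 2 (J 0 v) = J 1 v := fun v ↦ by
    rw [← h01, anticomm 1 0 (by decide), neg, square, neg_neg]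
  fin_cases i <;> fin_cases j
  · exact absurd rfl hij
  · exact ⟨2, 1, fun v ↦ by simpa using h01 v⟩
  · exact ⟨1, -1, fun v ↦ by simpa [h20] using anticomm 0 2 (by decide) v⟩
  · exact ⟨2, -1, fun v ↦ by simpa [h01] using anticomm 1 0 (by decide) v⟩
  · exact absurd rfl hij
  · exact ⟨0, 1, fun v ↦ by simpa using h12 v⟩
  · exact ⟨1, 1, fun v ↦ by simpa using h20 v⟩
  · exact ⟨0, -1, fun v ↦ by simpa [h12] using anticomm 2 1 (by decide) v⟩
  · exact absurd rfl hij

/-- `J 0, J 1, J 2` are isometries of `G` satisfying the quaternion relations, and `V` is a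
subspace which has an orthogonal complement and is orthogonal to its images `J i V`. -/
structure IsQuatSplit (G : E →L[ℝ] E →L[ℝ] ℝ) (J : Fin 3 → E →L[ℝ] E) (V : Submodule ℝ E) :
    Prop where
  symm : ∀ v w, G v w = G w v
  pos : ∀ v, v ≠ 0 → 0 < G v v
  square : ∀ i v, J i (J i v) = -v
  anticomm : ∀ i j, i ≠ j → ∀ v, J i (J j v) = -J j (J i v)
  triple : ∀ v, J 0 (J 1 (J 2 v)) = -v
  isometry : ∀ i v w, G (J i v) (J i w) = G v w
  orthogonal : ∀ i, ∀ v ∈ V, ∀ w ∈ V, G v (J i w) = 0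
  split : ∀ v, ∃ z ∈ V, ∀ w ∈ V, G (v - z) w = 0

namespace IsQuatSplit

variable {G : E →L[ℝ] E →L[ℝ] ℝ} {J : Fin 3 → E →L[ℝ] E} {V : Submodule ℝ E}

theorem skew (H : IsQuatSplit G J V) (i : Fin 3) (v w : E) : G (J i v) w = -G v (J i w) := by
  rw [← H.isometry i v (J i w), H.square, map_neg, neg_neg]

theorem exists_mul (H : IsQuatSplit G J V) {i j : Fin 3} (hij : i ≠ j) :
    ∃ k, ∃ ε : ℝ, ∀ v, J i (J j v) = ε • J k v :=
  exists_mul_eq_smul (J := fun i ↦ J i) (fun i v ↦ map_neg (J i) v) H.square H.anticomm H.triple hij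

/-- `J i` is skew, so the pairing is `-G(v, J i J j w)`, and `J i J j` is a multiple of some `J k`.
-/
theorem orthogonal_of_ne (H : IsQuatSplit G J V) {i j : Fin 3} (hij : i ≠ j) {v w : E}
    (hv : v ∈ V) (hw : w ∈ V) : G (J i v) (J j w) = 0 := by
  obtain ⟨k, ε, hk⟩ := H.exists_mul hij
  rw [H.skew, hk, map_smul, H.orthogonal k v hv w hw, smul_zero, neg_zero]

theorem orthogonal' (H : IsQuatSplit G J V) (i : Fin 3) {v w : E}
    (hv : v ∈ V) (hw : w ∈ V) : G (J i v) w = 0 := by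
  rw [H.symm, H.orthogonal i w hw v hv]

theorem eq_zero_of_mem (H : IsQuatSplit G J V) {v : E} (hv : v ∈ V) (h : ∀ w ∈ V, G v w = 0) :
    v = 0 := by
  by_contra hne
  exact (H.pos v hne).ne' (h v hv)

theorem vertical_unique (H : IsQuatSplit G J V) {n z z' : E} (hz : z ∈ V) (hz' : z' ∈ V)
    (h : ∀ w ∈ V, G (n - z) w = 0) (h' : ∀ w ∈ V, G (n - z') w = 0) : z = z' := by
  have := H.eq_zero_of_mem (V.sub_mem hz hz') fun w hw ↦ by
    have e := h w hw
    have e' := h' w hw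
    simp only [map_sub, sub_apply] at e e' ⊢
    linarith
  exact sub_eq_zero.1 this

/-- Subtracting the components in `V` and in the `J i V` gives a vector orthogonal to all of
them. -/
theorem orthogonal_remainder (H : IsQuatSplit G J V) {n z : E} {y : Fin 3 → E}
    (hzV : z ∈ V) (hyV : ∀ i, y i ∈ V) (hz : ∀ w ∈ V, G (n - z) w = 0)
    (hy : ∀ i, ∀ w ∈ V, G (J i n - y i) w = 0) :
    (∀ w ∈ V, G (n - z + ∑ i, J i (y i)) w = 0) ∧
      ∀ j, ∀ w ∈ V, G (n - z + ∑ i, J i (y i)) (J j w) = 0 := by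
  refine ⟨fun w hw ↦ ?_, fun j w hw ↦ ?_⟩
  · rw [map_add, add_apply, hz w hw, map_sum, sum_apply,
      Finset.sum_eq_zero fun i _ ↦ H.orthogonal' i (hyV i) hw, add_zero]
  -- Skewness gives `G(n, J j w) = -G(J j n, w) = -G(y j, w)`, which cancels the only surviving
  -- summand `G(J j (y j), J j w)`.
  · have e := hy j w hw
    rw [map_add, add_apply, map_sum, sum_apply,
      Finset.sum_eq_single j (fun i _ hij ↦ H.orthogonal_of_ne hij (hyV i) hw) (by simp),
      H.isometry, map_sub, sub_apply, H.orthogonal j z hzV w hw]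
    rw [map_sub, sub_apply, H.skew] at e
    linarith

theorem inner_decomposition (H : IsQuatSplit G J V) {r r' z z' : E} {y y' : Fin 3 → E}
    (hr : ∀ w ∈ V, G r w = 0) (hrJ : ∀ j, ∀ w ∈ V, G r (J j w) = 0)
    (hr' : ∀ w ∈ V, G r' w = 0) (hrJ' : ∀ j, ∀ w ∈ V, G r' (J j w) = 0)
    (hz : z ∈ V) (hz' : z' ∈ V) (hy : ∀ i, y i ∈ V) (hy' : ∀ i, y' i ∈ V) :
    G (r + z - ∑ i, J i (y i)) (r' + z' - ∑ i, J i (y' i)) =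
      G r r' + G z z' + ∑ i, G (y i) (y' i) := by
  have e1 : G r (∑ i, J i (y' i)) = 0 := by
    rw [map_sum, Finset.sum_eq_zero fun i _ ↦ hrJ i _ (hy' i)]
  have e2 : G z (∑ i, J i (y' i)) = 0 := by
    rw [map_sum, Finset.sum_eq_zero fun i _ ↦ H.orthogonal i _ hz _ (hy' i)]
  have e3 : G (∑ i, J i (y i)) r' = 0 := by
    rw [H.symm, map_sum, Finset.sum_eq_zero fun i _ ↦ hrJ' i _ (hy i)]
  have e4 : G (∑ i, J i (y i)) z' = 0 := by
    rw [H.symm, map_sum, Finset.sum_eq_zero fun i _ ↦ H.orthogonal i _ hz' _ (hy i)]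
  have e5 : G (∑ i, J i (y i)) (∑ i, J i (y' i)) = ∑ i, G (y i) (y' i) := by
    rw [map_sum G, sum_apply]
    refine Finset.sum_congr rfl fun i _ ↦ ?_
    rw [map_sum, Finset.sum_eq_single i
      (fun j _ hji ↦ H.orthogonal_of_ne hji.symm (hy i) (hy' j)) (by simp), H.isometry]
  have e6 : G z r' = 0 := by rw [H.symm, hr' z hz]
  simp only [map_add, map_sub, add_apply, sub_apply, hr z' hz', e1, e2, e3, e4, e5, e6]
  ring

end IsQuatSplit

end Quaternionic

/-! ### The combined Gauss–O'Neill equation and its estimate -/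

section CurvatureEstimate

open scoped MultilinearInstances

variable {E : Type*} [NormedAddCommGroup E] [NormedSpace ℝ E]
  {W : Type*} [NormedAddCommGroup W] [NormedSpace ℝ W]
  {B : Type*} [NormedAddCommGroup B] [NormedSpace ℝ B]
  {g : E → E →L[ℝ] E →L[ℝ] ℝ} {q : B → B →L[ℝ] B →L[ℝ] ℝ}
  {f : W → E} {p : W → B} {h : W → B →L[ℝ] W} {x : W} {Γ : E → E → E} {ΓB : B → B → B}
  {J : Fin 3 → E →L[ℝ] E} {V : Submodule ℝ E}

/-- The parts are the covariant derivative of the base, the O'Neill tensor and the second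
fundamental form. After removing the components in `V` and `J i V`, the remainder is tangent to the
submanifold and orthogonal to `V`, hence a lift; Koszul's formula identifies it. -/
theorem IsLocalQuotient.exists_decomposition (H : IsLocalQuotient g q f p h x)
    (hΓ : ∀ v w z, g (f x) (Γ v w) z = chr g (f x) v w z)
    (hΓB : ∀ v w z, q (p x) (ΓB v w) z = chr q (p x) v w z)
    (hqpos : ∀ v, v ≠ 0 → 0 < q (p x) v v) (HV : IsQuatSplit (g (f x)) J V)
    (hV : ∀ v, v ∈ V ↔ ∃ k, fderiv ℝ p x k = 0 ∧ fderiv ℝ f x k = v)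
    (htan : ∀ v, (∀ i, ∀ w ∈ V, g (f x) v (J i w) = 0) ↔ ∃ w, fderiv ℝ f x w = v) (X Y : B) :
    ∃ z ∈ V, ∃ y : Fin 3 → E, (∀ i, y i ∈ V) ∧ (∀ w ∈ V, g (f x) (nab f h Γ x X Y - z) w = 0) ∧
      (∀ i, ∀ w ∈ V, g (f x) (J i (nab f h Γ x X Y) - y i) w = 0) ∧
      nab f h Γ x X Y = lift f h (ΓB X Y) x + z - ∑ i, J i (y i) := by
  set n := nab f h Γ x X Y with hn
  obtain ⟨z, hzV, hz⟩ := HV.split n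
  choose y hyV hy using fun i ↦ HV.split (J i n)
  refine ⟨z, hzV, y, hyV, hz, hy, ?_⟩
  obtain ⟨o1, o2⟩ := HV.orthogonal_remainder hzV hyV hz hy
  set r := n - z + ∑ i, J i (y i) with hr
  obtain ⟨w, hw⟩ := (htan r).1 o2
  -- The difference of the two sides is vertical and also orthogonal to all vertical vectors.
  have hpw : r = lift f h (fderiv ℝ p x w) x := by
    have hk : fderiv ℝ p x (w - h x (fderiv ℝ p x w)) = 0 := by
      rw [map_sub, H.proj_lift.self_of_nhds, sub_self]
    have hmem : r - lift f h (fderiv ℝ p x w) x ∈ V :=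
      (hV _).2 ⟨_, hk, by rw [map_sub, hw, lift]⟩
    refine sub_eq_zero.1 (HV.eq_zero_of_mem hmem fun v hv ↦ ?_)
    obtain ⟨k, hk, rfl⟩ := (hV v).1 hv
    rw [map_sub, sub_apply, o1 _ hv, H.metric_lift_vertical _ hk, sub_zero]
  -- If the difference `Z` were nonzero, pairing it with itself would contradict Koszul's formula
  -- tested on the lift of `Z`.
  have hG : fderiv ℝ p x w = ΓB X Y := by
    by_contra hne
    set Z := fderiv ℝ p x w - ΓB X Y with hZ
    have hz' := hqpos Z (sub_ne_zero.2 hne)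
    have e1 : q (p x) (fderiv ℝ p x w) Z = g (f x) n (lift f h Z x) := by
      rw [← H.metric_lift_lift, ← hpw, hr]
      have a1 : g (f x) z (lift f h Z x) = 0 := by
        obtain ⟨k, hk, rfl⟩ := (hV z).1 hzV
        rw [HV.symm, H.metric_lift_vertical _ hk]
      have a2 : g (f x) (∑ i, J i (y i)) (lift f h Z x) = 0 := by
        rw [HV.symm, map_sum]
        exact Finset.sum_eq_zero fun i _ ↦ (htan _).2 ⟨_, rfl⟩ i _ (hyV i)
      rw [map_add, map_sub, add_apply, sub_apply, a1, a2, sub_zero, add_zero]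
    have e2 : q (p x) Z Z = q (p x) (fderiv ℝ p x w) Z - q (p x) (ΓB X Y) Z := by
      rw [← sub_apply, ← map_sub]
    rw [e2, e1, hn, H.metric_nab_lift hΓ, hΓB, sub_self] at hz'
    exact lt_irrefl _ hz'
  rw [hpw, hG] at hr
  rw [hr]
  abel

/-- The curvature estimate for Riemannian submersions in terms of bounds for the vertical parts of
`∇_X Y` and `J i ∇_X Y`. -/
theorem IsLocalQuotient.abs_curvLow_sub_le (H : IsLocalQuotient g q f p h x)
    (hΓ : ∀ v w z, g (f x) (Γ v w) z = chr g (f x) v w z)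
    (hΓB : ∀ v w z, q (p x) (ΓB v w) z = chr q (p x) v w z)
    (hqpos : ∀ v, v ≠ 0 → 0 < q (p x) v v) (HV : IsQuatSplit (g (f x)) J V)
    (hV : ∀ v, v ∈ V ↔ ∃ k, fderiv ℝ p x k = 0 ∧ fderiv ℝ f x k = v)
    (htan : ∀ v, (∀ i, ∀ w ∈ V, g (f x) v (J i w) = 0) ↔ ∃ w, fderiv ℝ f x w = v)
    {C : ℝ} (hC : 0 ≤ C)
    (hb : ∀ X Y : B, X ≠ 0 → Y ≠ 0 → ∀ z ∈ V,
      (∀ w ∈ V, g (f x) (nab f h Γ x X Y - z) w = 0) →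
        g (f x) z z ≤ C * (q (p x) X X * q (p x) Y Y))
    (hbJ : ∀ i, ∀ X Y : B, X ≠ 0 → Y ≠ 0 → ∀ z ∈ V,
      (∀ w ∈ V, g (f x) (J i (nab f h Γ x X Y) - z) w = 0) →
        g (f x) z z ≤ C * (q (p x) X X * q (p x) Y Y))
    {X Y : B} (hX : X ≠ 0) (hY : Y ≠ 0) :
    |curvLow q (p x) ΓB X Y Y X -
      curvLow g (f x) Γ (lift f h X x) (lift f h Y x) (lift f h Y x) (lift f h X x)| ≤
      9 * (C * (q (p x) X X * q (p x) Y Y)) := by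
  have hnn : ∀ v, 0 ≤ g (f x) v v := fun v ↦ by
    rcases eq_or_ne v 0 with rfl | h
    · simp
    · exact (HV.pos v h).le
  have dec := H.exists_decomposition hΓ hΓB hqpos HV hV htan
  obtain ⟨zXX, zXXV, yXX, yXXV, pXX, pXXJ, dXX⟩ := dec X X
  obtain ⟨zYY, zYYV, yYY, yYYV, pYY, pYYJ, dYY⟩ := dec Y Y
  obtain ⟨zXY, zXYV, yXY, yXYV, pXY, pXYJ, dXY⟩ := dec X Y
  obtain ⟨zYX, zYXV, yYX, yYXV, pYX, pYXJ, dYX⟩ := dec Y X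
  have lV : ∀ Z, ∀ w ∈ V, g (f x) (lift f h Z x) w = 0 := fun Z w hw ↦ by
    obtain ⟨k, hk, rfl⟩ := (hV w).1 hw
    exact H.metric_lift_vertical _ hk
  have lJ : ∀ Z, ∀ j, ∀ w ∈ V, g (f x) (lift f h Z x) (J j w) = 0 := fun Z ↦
    (htan _).2 ⟨_, rfl⟩
  have skew : ∀ X Y z z', z ∈ V → z' ∈ V → (∀ w ∈ V, g (f x) (nab f h Γ x X Y - z) w = 0) →
      (∀ w ∈ V, g (f x) (nab f h Γ x Y X - z') w = 0) → z + z' = 0 := by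
    intro X Y z z' hz hz' e e'
    refine HV.eq_zero_of_mem (V.add_mem hz hz') fun w hw ↦ ?_
    have a := e w hw
    have a' := e' w hw
    obtain ⟨k, hk, rfl⟩ := (hV w).1 hw
    have s := H.nab_symm_vertical hΓ X Y hk
    simp only [map_sub, sub_apply, map_add, add_apply] at a a' ⊢
    linarith
  have hzXX : zXX = 0 := by
    have := skew X X _ _ zXXV zXXV pXX pXX
    rw [← two_smul ℝ] at this
    simpa using this
  have hzYX : zYX = -zXY := eq_neg_of_add_eq_zero_right (skew X Y _ _ zXYV zYXV pXY pYX)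
  have dmem : nab f h Γ x X Y - nab f h Γ x Y X ∈ V :=
    (hV _).2 ⟨_, H.fderiv_proj_bracket X Y, (H.nab_sub hΓ HV.pos X Y).symm⟩
  -- The difference is the bracket, which is vertical; by skewness it is twice the O'Neill tensor.
  have hd : nab f h Γ x X Y - nab f h Γ x Y X = (2 : ℝ) • zXY := by
    refine HV.vertical_unique (n := nab f h Γ x X Y - nab f h Γ x Y X) dmem
      (V.smul_mem _ zXYV) (by simp) fun w hw ↦ ?_
    have a := pXY w hw
    have a' := pYX w hw
    rw [hzYX] at a'
    simp only [map_sub, sub_apply, map_neg, neg_apply, map_smul, smul_apply, smul_eq_mul] at a a' ⊢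
    linarith
  -- Symmetry of the second fundamental form: `J i` of the vertical bracket has no component in `V`.
  have hy : ∀ i, yYX i = yXY i := fun i ↦ by
    refine HV.vertical_unique (yYXV i) (yXYV i) (pYXJ i) fun w hw ↦ ?_
    have a := pXYJ i w hw
    have a' := HV.orthogonal' i dmem hw
    simp only [map_sub, sub_apply] at a a' ⊢
    linarith
  have i1 : g (f x) (nab f h Γ x Y Y) (nab f h Γ x X X) =
      q (p x) (ΓB Y Y) (ΓB X X) + ∑ i, g (f x) (yYY i) (yXX i) := by
    rw [dYY, dXX, HV.inner_decomposition (lV _) (lJ _) (lV _) (lJ _) zYYV zXXV yYYV yXXV, hzXX,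
      map_zero, H.metric_lift_lift, add_zero]
  have i2 : g (f x) (nab f h Γ x X Y) (nab f h Γ x Y X) =
      q (p x) (ΓB X Y) (ΓB Y X) - g (f x) zXY zXY + ∑ i, g (f x) (yXY i) (yXY i) := by
    rw [dXY, dYX, HV.inner_decomposition (lV _) (lJ _) (lV _) (lJ _) zXYV zYXV yXYV yYXV, hzYX,
      map_neg, H.metric_lift_lift]
    simp only [hy, sub_eq_add_neg]
  have i3 : g (f x) (nab f h Γ x X Y - nab f h Γ x Y X) (nab f h Γ x Y X) =
      - (2 * g (f x) zXY zXY) := by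
    have a := pYX _ zXYV
    rw [hzYX] at a
    rw [hd, map_smul, smul_apply, smul_eq_mul, HV.symm]
    simp only [map_sub, sub_apply, map_neg, neg_apply] at a
    linarith
  have main := H.curvLow_lift (ΓB := ΓB) hΓ HV.pos X Y
  rw [i1, i2, i3] at main
  have bz := hb X Y hX hY zXY zXYV pXY
  have bz0 := hnn zXY
  have bXY := fun i ↦ hbJ i X Y hX hY (yXY i) (yXYV i) (pXYJ i)
  have bXY0 := fun i ↦ hnn (yXY i)
  have bp : ∀ i, |g (f x) (yYY i) (yXX i)| ≤ C * (q (p x) X X * q (p x) Y Y) := fun i ↦ by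
    rw [mul_comm (q (p x) X X)]
    refine abs_bilin_le HV.symm HV.pos hC ?_ ?_ (hqpos Y hY).le (hqpos X hX).le
    · rw [sq]; exact hbJ i Y Y hY hY (yYY i) (yYYV i) (pYYJ i)
    · rw [sq]; exact hbJ i X X hX hX (yXX i) (yXXV i) (pXXJ i)
  -- The difference is `3 |zXY|² + ∑ i, (g(yYY i, yXX i) - |yXY i|²)`. Every scalar product is at
  -- most `C |X|² |Y|²` in absolute value, so the total weight `3 + 3 + 3` gives the constant 9.
  rw [main]
  simp only [Fin.sum_univ_three]
  have c0 := abs_le.1 (bp 0)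
  have c1 := abs_le.1 (bp 1)
  have c2 := abs_le.1 (bp 2)
  have d0 := bXY 0
  have d1 := bXY 1
  have d2 := bXY 2
  have f0 := bXY0 0
  have f1 := bXY0 1
  have f2 := bXY0 2
  rw [abs_le]
  constructor <;> linarith

end CurvatureEstimate

/-! ## Tensors and connections in a chart -/

section Chart

open scoped MultilinearInstances

variable {E : Type*} [NormedAddCommGroup E] [NormedSpace ℝ E]
  {M : Type*} [TopologicalSpace M] [ChartedSpace E M] [IsManifold 𝓘(ℝ, E) ∞ M]

variable (E) in
/-- The identification of a tangent space with the model space by the chart at `z`. -/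
noncomputable def toE (z x : M) : TangentSpace 𝓘(ℝ, E) x →L[ℝ] E :=
  (trivializationAt E (TangentSpace 𝓘(ℝ, E)) z).continuousLinearMapAt ℝ x

variable (E) in
/-- The identification of the model space with a tangent space by the chart at `z`. -/
noncomputable def ofE (z x : M) : E →L[ℝ] TangentSpace 𝓘(ℝ, E) x :=
  (trivializationAt E (TangentSpace 𝓘(ℝ, E)) z).symmL ℝ x

variable {z x : M}

theorem toE_ofE (hx : x ∈ (chartAt E z).source) (v : E) : toE E z x (ofE E z x v) = v :=
  (trivializationAt E (TangentSpace 𝓘(ℝ, E)) z).continuousLinearMapAt_symmL (R := ℝ)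
    (by simpa using hx) v

theorem ofE_toE (hx : x ∈ (chartAt E z).source) (v : TangentSpace 𝓘(ℝ, E) x) :
    ofE E z x (toE E z x v) = v :=
  (trivializationAt E (TangentSpace 𝓘(ℝ, E)) z).symmL_continuousLinearMapAt (R := ℝ)
    (by simpa using hx) v

theorem toE_eq_mfderiv (hx : x ∈ (chartAt E z).source) :
    toE E z x = mfderiv 𝓘(ℝ, E) 𝓘(ℝ, E) (extChartAt 𝓘(ℝ, E) z) x :=
  TangentBundle.continuousLinearMapAt_trivializationAt hx

theorem ofE_eq_mfderiv (hx : x ∈ (chartAt E z).source) :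
    ofE E z x = mfderiv 𝓘(ℝ, E) 𝓘(ℝ, E) (extChartAt 𝓘(ℝ, E) z).symm (extChartAt 𝓘(ℝ, E) z x) := by
  rw [← mfderivWithin_univ, ← ModelWithCorners.range_eq_univ 𝓘(ℝ, E)]
  exact TangentBundle.symmL_trivializationAt hx

/-- The preferred chart at `z` induces the identity on the tangent space at `z`; vectors there can
thus be read directly in `E`. -/
theorem toE_self (v : TangentSpace 𝓘(ℝ, E) z) : toE E z z v = v := by
  rw [toE, TangentBundle.continuousLinearMapAt_trivializationAt_eq_core (mem_chart_source E z)]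
  exact (tangentBundleCore 𝓘(ℝ, E) M).coordChange_self (achart E z) z (mem_chart_source E z) v

theorem ofE_self (v : TangentSpace 𝓘(ℝ, E) z) : ofE E z z v = v := by
  have h := ofE_toE (mem_chart_source E z) v
  rwa [toE_self] at h

/-- The extensions used to define `curvature` are the constant fields of the chart at `z`, which
commute. -/
theorem extend_eq_ofE (v : TangentSpace 𝓘(ℝ, E) z) (hx : x ∈ (chartAt E z).source) :
    FiberBundle.extend E v x = ofE E z x v := by
  have : (trivializationAt E (TangentSpace 𝓘(ℝ, E)) z ⟨z, v⟩).2 = toE E z z v := by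
    simp [toE, Trivialization.continuousLinearMapAt_apply, Trivialization.linearMapAt_apply]
  rw [FiberBundle.extend, this, toE_self]
  exact ((trivializationAt E (TangentSpace 𝓘(ℝ, E)) z).symmL_apply
    (R := ℝ) (by simpa using hx) v).symm

omit [IsManifold 𝓘(ℝ, E) ∞ M] in
theorem symm_mem_source {y : E} (hy : y ∈ (extChartAt 𝓘(ℝ, E) z).target) :
    (extChartAt 𝓘(ℝ, E) z).symm y ∈ (chartAt E z).source := by
  simpa using (extChartAt 𝓘(ℝ, E) z).map_target hy

omit [IsManifold 𝓘(ℝ, E) ∞ M] in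
theorem target_mem_nhds {y : E} (hy : y ∈ (extChartAt 𝓘(ℝ, E) z).target) :
    (extChartAt 𝓘(ℝ, E) z).target ∈ 𝓝 y :=
  (isOpen_extChartAt_target z).mem_nhds hy

theorem contMDiffAt_chart_symm {y : E} (hy : y ∈ (extChartAt 𝓘(ℝ, E) z).target) :
    ContMDiffAt 𝓘(ℝ, E) 𝓘(ℝ, E) ∞ (extChartAt 𝓘(ℝ, E) z).symm y :=
  (contMDiffOn_extChartAt_symm z).contMDiffAt (target_mem_nhds hy)

theorem contMDiffAt_chart (hx : x ∈ (chartAt E z).source) :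
    ContMDiffAt 𝓘(ℝ, E) 𝓘(ℝ, E) ∞ (extChartAt 𝓘(ℝ, E) z) x :=
  contMDiffAt_extChartAt' hx

section Function

variable {F : Type*} [NormedAddCommGroup F] [NormedSpace ℝ F]

theorem mvfderiv_ofE {k : M → F} {y : E} (hy : y ∈ (extChartAt 𝓘(ℝ, E) z).target)
    (hk : DifferentiableAt ℝ (k ∘ (extChartAt 𝓘(ℝ, E) z).symm) y) (v : E) :
    mvfderiv 𝓘(ℝ, E) k ((extChartAt 𝓘(ℝ, E) z).symm y) (ofE E z _ v) =
      fderiv ℝ (k ∘ (extChartAt 𝓘(ℝ, E) z).symm) y v := by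
  set x := (extChartAt 𝓘(ℝ, E) z).symm y with hx
  have hxs : x ∈ (chartAt E z).source := symm_mem_source hy
  have hyx : extChartAt 𝓘(ℝ, E) z x = y := (extChartAt 𝓘(ℝ, E) z).right_inv hy
  have hc := (contMDiffAt_chart hxs).mdifferentiableAt (by simp)
  have hk' : MDifferentiableAt 𝓘(ℝ, E) 𝓘(ℝ, F) k x := by
    have h1 : MDifferentiableAt 𝓘(ℝ, E) 𝓘(ℝ, F)
        ((k ∘ (extChartAt 𝓘(ℝ, E) z).symm) ∘ extChartAt 𝓘(ℝ, E) z) x :=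
      MDifferentiableAt.comp x (by rw [hyx]; exact hk.mdifferentiableAt) hc
    refine h1.congr_of_eventuallyEq ?_
    filter_upwards [(chartAt E z).open_source.mem_nhds hxs] with x' hx'
    simp [hx']
  have h2 := mfderiv_comp y hk' ((contMDiffAt_chart_symm hy).mdifferentiableAt (by simp))
  rw [mfderiv_eq_fderiv] at h2
  have h3 := DFunLike.congr_fun h2 v
  rw [mvfderiv, ofE_eq_mfderiv hxs, hyx]
  exact h3.symm

end Function

/-- The metric in the chart at `z`. -/
noncomputable def locMetric (g : BilinField E M) (z : M) (y : E) : E →L[ℝ] E →L[ℝ] ℝ :=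
  ContinuousLinearMap.inCoordinates E (fun x : M ↦ TangentSpace 𝓘(ℝ, E) x) (E →L[ℝ] ℝ)
    (fun x : M ↦ TangentSpace 𝓘(ℝ, E) x →L[ℝ] ℝ) z ((extChartAt 𝓘(ℝ, E) z).symm y) z
    ((extChartAt 𝓘(ℝ, E) z).symm y) (g ((extChartAt 𝓘(ℝ, E) z).symm y))

theorem locMetric_apply (g : BilinField E M) {y : E} (hy : y ∈ (extChartAt 𝓘(ℝ, E) z).target)
    (v w : E) : locMetric g z y v w =
      g ((extChartAt 𝓘(ℝ, E) z).symm y) (ofE E z _ v) (ofE E z _ w) := by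
  rw [locMetric, inCoordinates_apply_eq₂ (F₃ := ℝ) (E₃ := fun _ : M ↦ ℝ)
    (by simpa using symm_mem_source hy) (by simpa using symm_mem_source hy) (by simp)]
  rw [ofE, Trivialization.symmL_apply _ (by simpa using symm_mem_source hy),
    Trivialization.symmL_apply _ (by simpa using symm_mem_source hy)]
  simp

/-- A field of endomorphisms in the chart at `z`. -/
noncomputable def locEndo (J : EndoField E M) (z : M) (y : E) : E →L[ℝ] E :=
  ContinuousLinearMap.inCoordinates E (fun x : M ↦ TangentSpace 𝓘(ℝ, E) x) E
    (fun x : M ↦ TangentSpace 𝓘(ℝ, E) x) z ((extChartAt 𝓘(ℝ, E) z).symm y) z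
    ((extChartAt 𝓘(ℝ, E) z).symm y) (J ((extChartAt 𝓘(ℝ, E) z).symm y))

theorem locEndo_apply (J : EndoField E M) (y v : E) : locEndo J z y v =
      toE E z _ (J ((extChartAt 𝓘(ℝ, E) z).symm y) (ofE E z _ v)) := rfl

/-- The Christoffel symbols of `D` in the chart at `z`. -/
noncomputable def locChr (D : Connection E M) (z : M) (y v w : E) : E :=
  toE E z ((extChartAt 𝓘(ℝ, E) z).symm y) (D (fun x ↦ ofE E z x w) _ (ofE E z _ v))

theorem locMetric_self (g : BilinField E M) (v w : TangentSpace 𝓘(ℝ, E) z) :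
    locMetric g z (extChartAt 𝓘(ℝ, E) z z) v w = g z v w := by
  refine (locMetric_apply g (mem_extChartAt_target z) v w).trans ?_
  generalize hx : (extChartAt 𝓘(ℝ, E) z).symm (extChartAt 𝓘(ℝ, E) z z) = x
  rw [extChartAt_to_inv] at hx
  subst hx
  exact congrArg₂ (fun a b ↦ g z a b) (ofE_self v) (ofE_self w)

theorem locEndo_self (J : EndoField E M) (v : TangentSpace 𝓘(ℝ, E) z) :
    locEndo J z (extChartAt 𝓘(ℝ, E) z z) v = J z v := by
  change toE E z ((extChartAt 𝓘(ℝ, E) z).symm _) (J _ (ofE E z _ v)) = _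
  generalize hx : (extChartAt 𝓘(ℝ, E) z).symm (extChartAt 𝓘(ℝ, E) z z) = x
  rw [extChartAt_to_inv] at hx
  subst hx
  rw [ofE_self, toE_self]

theorem contDiffAt_locMetric {g : BilinField E M} (hg : IsWeakMetric g) {y : E}
    (hy : y ∈ (extChartAt 𝓘(ℝ, E) z).target) : ContDiffAt ℝ ∞ (locMetric g z) y := by
  have hx := symm_mem_source hy
  let _ (x : M) : ContinuousAdd (TangentSpace 𝓘(ℝ, E) x →L[ℝ] ℝ) :=
    inferInstanceAs (ContinuousAdd (E →L[ℝ] ℝ))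
  have h1 := ((trivializationAt (E →L[ℝ] E →L[ℝ] ℝ) (fun x : M ↦
    TangentSpace 𝓘(ℝ, E) x →L[ℝ] TangentSpace 𝓘(ℝ, E) x →L[ℝ] ℝ) z).contMDiffAt_section_iff
    (by simpa using hx)).1 (hg.smooth ((extChartAt 𝓘(ℝ, E) z).symm y))
  have h2 := h1.comp y (contMDiffAt_chart_symm hy)
  rw [contMDiffAt_iff_contDiffAt] at h2
  exact h2

theorem contDiffAt_locEndo {J : EndoField E M}
    (hJ : ContMDiff 𝓘(ℝ, E) (𝓘(ℝ, E).prod 𝓘(ℝ, E →L[ℝ] E)) ∞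
    (fun x : M ↦ TotalSpace.mk' (E →L[ℝ] E)
      (E := fun x : M ↦ TangentSpace 𝓘(ℝ, E) x →L[ℝ] TangentSpace 𝓘(ℝ, E) x) x (J x))) {y : E}
    (hy : y ∈ (extChartAt 𝓘(ℝ, E) z).target) : ContDiffAt ℝ ∞ (locEndo J z) y := by
  have hx := symm_mem_source hy
  have h1 := ((trivializationAt (E →L[ℝ] E) (fun x : M ↦
    TangentSpace 𝓘(ℝ, E) x →L[ℝ] TangentSpace 𝓘(ℝ, E) x) z).contMDiffAt_section_iff
    (by simpa using hx)).1 (hJ ((extChartAt 𝓘(ℝ, E) z).symm y))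
  have h2 := h1.comp y (contMDiffAt_chart_symm hy)
  rw [contMDiffAt_iff_contDiffAt] at h2
  exact h2

theorem diffFieldAt_iff {Y : (x : M) → TangentSpace 𝓘(ℝ, E) x} {y : E}
    (hy : y ∈ (extChartAt 𝓘(ℝ, E) z).target) :
    DiffFieldAt Y ((extChartAt 𝓘(ℝ, E) z).symm y) ↔
      DifferentiableAt ℝ (fun y ↦ toE E z _ (Y ((extChartAt 𝓘(ℝ, E) z).symm y))) y := by
  have hx := symm_mem_source hy
  have hyx : extChartAt 𝓘(ℝ, E) z ((extChartAt 𝓘(ℝ, E) z).symm y) = y :=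
    (extChartAt 𝓘(ℝ, E) z).right_inv hy
  have he : (fun x ↦ toE E z x (Y x)) =ᶠ[𝓝 ((extChartAt 𝓘(ℝ, E) z).symm y)]
      fun x ↦ (trivializationAt E (TangentSpace 𝓘(ℝ, E)) z ⟨x, Y x⟩).2 := by
    filter_upwards [(chartAt E z).open_source.mem_nhds hx] with x' hx'
    rw [toE, Trivialization.continuousLinearMapAt_apply,
      Trivialization.coe_linearMapAt_of_mem _ (by simpa using hx')]
  refine ((trivializationAt E (TangentSpace 𝓘(ℝ, E)) z).mdifferentiableAt_section_iff 𝓘(ℝ, E) Y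
    (by simpa using hx)).trans (he.mdifferentiableAt_iff.symm.trans ?_)
  rw [← mdifferentiableAt_iff_differentiableAt]
  constructor
  · intro h
    exact h.comp y ((contMDiffAt_chart_symm hy).mdifferentiableAt (by simp))
  · intro h
    have h1 : MDifferentiableAt 𝓘(ℝ, E) 𝓘(ℝ, E)
        ((fun y ↦ toE E z _ (Y ((extChartAt 𝓘(ℝ, E) z).symm y))) ∘ extChartAt 𝓘(ℝ, E) z)
        ((extChartAt 𝓘(ℝ, E) z).symm y) :=
      MDifferentiableAt.comp _ (by rwa [hyx])
        ((contMDiffAt_chart hx).mdifferentiableAt (by simp))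
    refine h1.congr_of_eventuallyEq ?_
    filter_upwards [(chartAt E z).open_source.mem_nhds hx] with x' hx'
    have : (extChartAt 𝓘(ℝ, E) z).symm (extChartAt 𝓘(ℝ, E) z x') = x' :=
      (extChartAt 𝓘(ℝ, E) z).left_inv (by simpa using hx')
    change _ = toE E z ((extChartAt 𝓘(ℝ, E) z).symm (extChartAt 𝓘(ℝ, E) z x')) (Y _)
    rw [this]

theorem smoothFieldAt_ofE {s : E → E} (hx : x ∈ (chartAt E z).source)
    (hs : ContDiffAt ℝ ∞ s (extChartAt 𝓘(ℝ, E) z x)) :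
    SmoothFieldAt (fun x ↦ ofE E z x (s (extChartAt 𝓘(ℝ, E) z x))) x := by
  refine (((trivializationAt E (TangentSpace 𝓘(ℝ, E)) z).contMDiffAt_section_iff
    (by simpa using hx))).2 ?_
  have h1 : ContMDiffAt 𝓘(ℝ, E) 𝓘(ℝ, E) ∞ (s ∘ extChartAt 𝓘(ℝ, E) z) x :=
    hs.contMDiffAt.comp x (contMDiffAt_chart hx)
  refine h1.congr_of_eventuallyEq ?_
  filter_upwards [(chartAt E z).open_source.mem_nhds hx] with x' hx'
  have := toE_ofE hx' (s (extChartAt 𝓘(ℝ, E) z x'))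
  rw [toE, Trivialization.continuousLinearMapAt_apply,
    Trivialization.coe_linearMapAt_of_mem _ (by simpa using hx')] at this
  exact this

theorem smoothFieldAt_const (hx : x ∈ (chartAt E z).source) (v : E) :
    SmoothFieldAt (fun x ↦ ofE E z x v) x :=
  smoothFieldAt_ofE (s := fun _ ↦ v) hx contDiffAt_const

theorem SmoothFieldAt.diffFieldAt {Y : (x : M) → TangentSpace 𝓘(ℝ, E) x}
    (hY : SmoothFieldAt Y x) : DiffFieldAt Y x :=
  ContMDiffAt.mdifferentiableAt hY (by simp)

/-- Constant fields of a chart are pullbacks of constant fields on `E`, and pullback preserves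
brackets. -/
theorem mlieBracket_const [CompleteSpace E] (hx : x ∈ (chartAt E z).source) (v w : E) :
    VectorField.mlieBracket 𝓘(ℝ, E) (fun x : M ↦ ofE E z x v) (fun x ↦ ofE E z x w) x = 0 := by
  have key (u : E) : (fun x : M ↦ ofE E z x u) =ᶠ[𝓝 x]
      VectorField.mpullback 𝓘(ℝ, E) 𝓘(ℝ, E) (extChartAt 𝓘(ℝ, E) z) (fun _ : E ↦ u) := by
    filter_upwards [(chartAt E z).open_source.mem_nhds hx] with x' hx'
    have h1 : (mfderiv 𝓘(ℝ, E) 𝓘(ℝ, E) (extChartAt 𝓘(ℝ, E) z) x').inverse = ofE E z x' := by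
      rw [← toE_eq_mfderiv hx']
      exact ContinuousLinearMap.inverse_eq (ContinuousLinearMap.ext fun v ↦ toE_ofE hx' v)
        (ContinuousLinearMap.ext fun v ↦ ofE_toE hx' v)
    exact congrFun (congrArg DFunLike.coe h1.symm) u
  have hc (u : E) : MDifferentiableAt 𝓘(ℝ, E) 𝓘(ℝ, E).tangent
      (fun y : E ↦ (⟨y, u⟩ : TangentBundle 𝓘(ℝ, E) E)) (extChartAt 𝓘(ℝ, E) z x) := by
    rw [mdifferentiableAt_totalSpace]
    exact ⟨mdifferentiableAt_id, by simpa using! mdifferentiableAt_const⟩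
  have : IsManifold 𝓘(ℝ, E) (minSmoothness ℝ 2) M := by
    rw [minSmoothness_of_isRCLikeNormedField]
    exact IsManifold.of_le (n := ∞) (WithTop.coe_le_coe.2 le_top)
  rw [(key v).mlieBracket_vectorField_eq (key w),
    ← VectorField.mpullback_mlieBracket (n := ∞) (hc v) (hc w) (contMDiffAt_chart hx)
      (by
        rw [minSmoothness_of_isRCLikeNormedField]
        exact WithTop.coe_le_coe.2 le_top),
    VectorField.mpullback_apply]
  have h0 : VectorField.mlieBracket 𝓘(ℝ, E) (fun _ : E ↦ v) (fun _ : E ↦ w) =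
      fun _ : E ↦ (0 : E) := by
    refine (VectorField.mlieBracketWithin_univ (I := 𝓘(ℝ, E)) (V := fun _ : E ↦ v)
      (W := fun _ : E ↦ w)).symm.trans ?_
    refine VectorField.mlieBracketWithin_eq_lieBracketWithin.trans ?_
    funext y
    simp [VectorField.lieBracketWithin]
  rw [h0]
  exact map_zero _

variable {g : BilinField E M} {D : Connection E M}

theorem ofE_locChr {y : E} (hy : y ∈ (extChartAt 𝓘(ℝ, E) z).target) (v w : E) :
    ofE E z _ (locChr D z y v w) =
      D (fun x ↦ ofE E z x w) ((extChartAt 𝓘(ℝ, E) z).symm y) (ofE E z _ v) :=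
  ofE_toE (symm_mem_source hy) _

theorem locMetric_symm (hg : IsWeakMetric g) {y : E}
    (hy : y ∈ (extChartAt 𝓘(ℝ, E) z).target) (v w : E) :
    locMetric g z y v w = locMetric g z y w v := by
  rw [locMetric_apply g hy, locMetric_apply g hy, hg.symm]

theorem locMetric_pos (hg : IsWeakMetric g) {y : E}
    (hy : y ∈ (extChartAt 𝓘(ℝ, E) z).target) {v : E} (hv : v ≠ 0) : 0 < locMetric g z y v v := by
  rw [locMetric_apply g hy]
  refine hg.pos _ _ fun h ↦ hv ?_
  rw [← toE_ofE (symm_mem_source hy) v, h, map_zero]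

/-- A weak metric need not represent all functionals, but it separates vectors; this is enough for
checking identities between vectors. -/
theorem eq_of_locMetric_eq (hg : IsWeakMetric g) {y : E}
    (hy : y ∈ (extChartAt 𝓘(ℝ, E) z).target) {v w : E}
    (h : ∀ u, locMetric g z y v u = locMetric g z y w u) : v = w := by
  by_contra hvw
  have := locMetric_pos hg hy (sub_ne_zero.2 hvw)
  rw [map_sub (locMetric g z y) v w, sub_apply, h, sub_self] at this
  exact this.false

theorem IsLeviCivita.fderiv_locMetric (hD : IsLeviCivita g D) (hg : IsWeakMetric g) {y : E}
    (hy : y ∈ (extChartAt 𝓘(ℝ, E) z).target) (a v w : E) :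
    fderiv ℝ (locMetric g z) y a v w =
      locMetric g z y (locChr D z y a v) w + locMetric g z y v (locChr D z y a w) := by
  have hd := (contDiffAt_locMetric hg hy).differentiableAt (by simp)
  have hs := symm_mem_source hy
  have h := hD.metric _ _ _ (ofE E z _ a) (smoothFieldAt_const hs v).diffFieldAt
    (smoothFieldAt_const hs w).diffFieldAt
  have he : (fun x ↦ g x (ofE E z x v) (ofE E z x w)) ∘ (extChartAt 𝓘(ℝ, E) z).symm =ᶠ[𝓝 y]
      fun y ↦ locMetric g z y v w := by
    filter_upwards [target_mem_nhds hy] with y' hy'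
    rw [locMetric_apply g hy']
    rfl
  have hd' : HasFDerivAt (fun y ↦ locMetric g z y v w)
      (((fderiv ℝ (locMetric g z) y).flip v).flip w) y := by
    refine ((hd.hasFDerivAt.clm_apply (hasFDerivAt_const v y)).clm_apply
      (hasFDerivAt_const w y)).congr_fderiv ?_
    ext a
    simp
  rw [mvfderiv_ofE hy (hd'.differentiableAt.congr_of_eventuallyEq he), he.fderiv_eq, hd'.fderiv,
    ← ofE_locChr hy, ← ofE_locChr hy, ← locMetric_apply g hy, ← locMetric_apply g hy] at h
  exact h

theorem IsLeviCivita.locChr_comm [CompleteSpace E] (hD : IsLeviCivita g D) {y : E}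
    (hy : y ∈ (extChartAt 𝓘(ℝ, E) z).target) (v w : E) :
    locChr D z y v w = locChr D z y w v := by
  have hs := symm_mem_source hy
  have h := hD.torsionFree _ _ _ (smoothFieldAt_const hs v).diffFieldAt
    (smoothFieldAt_const hs w).diffFieldAt
  rw [mlieBracket_const hs, sub_eq_zero] at h
  exact congrArg (toE E z _) h

/-- Koszul's computation on constant fields. It shows that `locChr` can serve as the `Γ` of the
local calculus. -/
theorem IsLeviCivita.locMetric_locChr [CompleteSpace E] (hD : IsLeviCivita g D)
    (hg : IsWeakMetric g) {y : E} (hy : y ∈ (extChartAt 𝓘(ℝ, E) z).target) (v w u : E) :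
    locMetric g z y (locChr D z y v w) u = chr (locMetric g z) y v w u := by
  rw [chr, hD.fderiv_locMetric hg hy, hD.fderiv_locMetric hg hy, hD.fderiv_locMetric hg hy,
    hD.locChr_comm hy w v, hD.locChr_comm hy u v, hD.locChr_comm hy u w,
    locMetric_symm hg hy v, locMetric_symm hg hy w (locChr D z y v u)]
  ring

/-- The covariant derivative of a vector field in a chart. -/
theorem IsLeviCivita.toE_apply (hD : IsLeviCivita g D) (hg : IsWeakMetric g) {y : E}
    (hy : y ∈ (extChartAt 𝓘(ℝ, E) z).target) {Y : (x : M) → TangentSpace 𝓘(ℝ, E) x}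
    (hY : DiffFieldAt Y ((extChartAt 𝓘(ℝ, E) z).symm y)) (a : E) :
    toE E z _ (D Y ((extChartAt 𝓘(ℝ, E) z).symm y) (ofE E z _ a)) =
      fderiv ℝ (fun y ↦ toE E z _ (Y ((extChartAt 𝓘(ℝ, E) z).symm y))) y a +
        locChr D z y a (toE E z _ (Y ((extChartAt 𝓘(ℝ, E) z).symm y))) := by
  set s : E → E := fun y ↦ toE E z _ (Y ((extChartAt 𝓘(ℝ, E) z).symm y)) with hsdef
  have hs := symm_mem_source hy
  have hds : DifferentiableAt ℝ s y := (diffFieldAt_iff hy).1 hY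
  have hd := (contDiffAt_locMetric hg hy).differentiableAt (by simp)
  -- Metric compatibility of `Y` with constant fields already determines `D Y`.
  refine eq_of_locMetric_eq hg hy fun u ↦ ?_
  have h := hD.metric _ _ _ (ofE E z _ a) hY (smoothFieldAt_const hs u).diffFieldAt
  have he : (fun x ↦ g x (Y x) (ofE E z x u)) ∘ (extChartAt 𝓘(ℝ, E) z).symm =ᶠ[𝓝 y]
      fun y ↦ locMetric g z y (s y) u := by
    filter_upwards [target_mem_nhds hy] with y' hy'
    rw [locMetric_apply g hy', hsdef, ofE_toE (symm_mem_source hy')]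
    rfl
  have hd' := (hd.hasFDerivAt.clm_apply hds.hasFDerivAt).clm_apply (hasFDerivAt_const u y)
  rw [mvfderiv_ofE hy (hd'.differentiableAt.congr_of_eventuallyEq he), he.fderiv_eq, hd'.fderiv,
    ← ofE_locChr hy, ← ofE_toE hs (D Y _ _), ← ofE_toE hs (Y _), ← locMetric_apply g hy,
    ← locMetric_apply g hy] at h
  have h2 := hD.fderiv_locMetric hg hy a (s y) u
  simp only [add_apply, ContinuousLinearMap.comp_apply, ContinuousLinearMap.flip_apply,
    zero_apply, map_zero, zero_add] at h
  rw [map_add, add_apply]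
  linarith

/-- The chart formula involves only the value and the first derivative of the field, whence
locality. -/
theorem IsLeviCivita.congr (hD : IsLeviCivita g D) (hg : IsWeakMetric g)
    {Y Y' : (x : M) → TangentSpace 𝓘(ℝ, E) x} {y : E} (hy : y ∈ (extChartAt 𝓘(ℝ, E) z).target)
    (hY : DiffFieldAt Y ((extChartAt 𝓘(ℝ, E) z).symm y))
    (hYY : ∀ᶠ x in 𝓝 ((extChartAt 𝓘(ℝ, E) z).symm y), Y x = Y' x) (a : E) :
    D Y ((extChartAt 𝓘(ℝ, E) z).symm y) (ofE E z _ a) =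
      D Y' ((extChartAt 𝓘(ℝ, E) z).symm y) (ofE E z _ a) := by
  have hY' : DiffFieldAt Y' ((extChartAt 𝓘(ℝ, E) z).symm y) := by
    refine MDifferentiableAt.congr_of_eventuallyEq hY ?_
    filter_upwards [hYY] with x hx
    rw [hx]
  have he : (fun y ↦ toE E z _ (Y ((extChartAt 𝓘(ℝ, E) z).symm y))) =ᶠ[𝓝 y]
      fun y ↦ toE E z _ (Y' ((extChartAt 𝓘(ℝ, E) z).symm y)) := by
    filter_upwards [(contMDiffAt_chart_symm hy).continuousAt.eventually hYY] with y hy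
    rw [hy]
  have hs := symm_mem_source hy
  rw [← ofE_toE hs (D Y _ _), ← ofE_toE hs (D Y' _ _), hD.toE_apply hg hy hY,
    hD.toE_apply hg hy hY', he.fderiv_eq, hYY.self_of_nhds]

theorem metric_eq_locMetric (g : BilinField E M) (v w : TangentSpace 𝓘(ℝ, E) z) :
    g z v w = locMetric g z (extChartAt 𝓘(ℝ, E) z z) v w := (locMetric_self g v w).symm

theorem IsLeviCivita.smoothFieldAt_const (hD : IsLeviCivita g D) (hx : x ∈ (chartAt E z).source)
    (b c : E) : SmoothFieldAt (fun x ↦ D (fun x ↦ ofE E z x c) x (ofE E z x b)) x := by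
  have h := (hD.smooth (chartAt E z).source (chartAt E z).open_source).contMDiff
    (σ := fun x ↦ ofE E z x c) fun x hx ↦ (HKQuot.smoothFieldAt_const hx c).contMDiffWithinAt
  exact ((h x hx).contMDiffAt ((chartAt E z).open_source.mem_nhds hx)).clm_bundle_apply
    (HKQuot.smoothFieldAt_const hx b)

/-- In the chart, `chr` at `b, c, d` is `g(∇_b c, d)` for constant fields; metric compatibility is
applied to this pairing. -/
theorem IsLeviCivita.fderiv_chr [CompleteSpace E] (hD : IsLeviCivita g D) (hg : IsWeakMetric g)
    {y : E} (hy : y ∈ (extChartAt 𝓘(ℝ, E) z).target) (a b c d : E) :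
    fderiv ℝ (fun y ↦ chr (locMetric g z) y b c d) y a =
      g ((extChartAt 𝓘(ℝ, E) z).symm y)
        (D (fun x ↦ D (fun x ↦ ofE E z x c) x (ofE E z x b)) _ (ofE E z _ a)) (ofE E z _ d) +
      locMetric g z y (locChr D z y b c) (locChr D z y a d) := by
  have hs := symm_mem_source hy
  have h := hD.metric _ _ _ (ofE E z _ a) (hD.smoothFieldAt_const hs b c).diffFieldAt
    (HKQuot.smoothFieldAt_const hs d).diffFieldAt
  have he : (fun x ↦ g x (D (fun x ↦ ofE E z x c) x (ofE E z x b)) (ofE E z x d)) ∘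
      (extChartAt 𝓘(ℝ, E) z).symm =ᶠ[𝓝 y] fun y ↦ chr (locMetric g z) y b c d := by
    filter_upwards [target_mem_nhds hy] with y' hy'
    rw [← hD.locMetric_locChr hg hy', locMetric_apply g hy', ofE_locChr hy']
    rfl
  have hd : DifferentiableAt ℝ (fun y ↦ chr (locMetric g z) y b c d) y :=
    (HKQuot.fderiv_chr (f := fun y ↦ y) ((contDiffAt_locMetric hg hy).of_le
      (WithTop.coe_le_coe.2 le_top)) differentiableAt_fun_id (differentiableAt_const b)
      (differentiableAt_const c) (differentiableAt_const d)).1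
  rw [mvfderiv_ofE hy (hd.congr_of_eventuallyEq he), he.fderiv_eq] at h
  rw [h, ← ofE_locChr hy, ← ofE_locChr hy, ← locMetric_apply g hy]

theorem IsLeviCivita.congr_self (hD : IsLeviCivita g D) (hg : IsWeakMetric g)
    {Y Y' : (x : M) → TangentSpace 𝓘(ℝ, E) x} (hY : DiffFieldAt Y z)
    (hYY : ∀ᶠ x in 𝓝 z, Y x = Y' x) (a : TangentSpace 𝓘(ℝ, E) z) : D Y z a = D Y' z a := by
  have h := hD.congr (z := z) (Y := Y) (Y' := Y') hg (mem_extChartAt_target z)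
    (by rwa [extChartAt_to_inv]) (by rwa [extChartAt_to_inv]) a
  rw [extChartAt_to_inv] at h
  rw [← ofE_self a]
  exact h

/-- The covariant derivative of a vector field at the centre of a chart. -/
theorem IsLeviCivita.apply_self (hD : IsLeviCivita g D) (hg : IsWeakMetric g)
    {Y : (x : M) → TangentSpace 𝓘(ℝ, E) x} (hY : DiffFieldAt Y z) (a : TangentSpace 𝓘(ℝ, E) z) :
    D Y z a = ofE E z z
      (fderiv ℝ (fun y ↦ toE E z _ (Y ((extChartAt 𝓘(ℝ, E) z).symm y))) (extChartAt 𝓘(ℝ, E) z z)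
        (toE E z z a) +
        locChr D z (extChartAt 𝓘(ℝ, E) z z) (toE E z z a) (toE E z z (Y z))) := by
  have h := hD.toE_apply (z := z) (Y := Y) hg (mem_extChartAt_target z)
    (by rwa [extChartAt_to_inv]) (toE E z z a)
  rw [extChartAt_to_inv, ofE_toE (mem_chart_source E z)] at h
  rw [← h, ofE_toE (mem_chart_source E z)]

theorem IsLeviCivita.fderiv_chr_self [CompleteSpace E] (hD : IsLeviCivita g D)
    (hg : IsWeakMetric g) (a d : TangentSpace 𝓘(ℝ, E) z) (b c : E) :
    fderiv ℝ (fun y ↦ chr (locMetric g z) y b c d) (extChartAt 𝓘(ℝ, E) z z) a =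
      g z (D (fun x ↦ D (fun x ↦ ofE E z x c) x (ofE E z x b)) z a) d +
      locMetric g z (extChartAt 𝓘(ℝ, E) z z) (locChr D z (extChartAt 𝓘(ℝ, E) z z) b c)
        (locChr D z (extChartAt 𝓘(ℝ, E) z z) a d) := by
  have h := hD.fderiv_chr (z := z) hg (mem_extChartAt_target z) a b c d
  rw [extChartAt_to_inv] at h
  refine h.trans (congrArg (· + _) ?_)
  exact congrArg₂ (fun a d ↦ g z (D (fun x ↦ D (fun x ↦ ofE E z x c) x (ofE E z x b)) z a) d)
    (ofE_self a) (ofE_self d)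

/-- The curvature of a Levi-Civita connection in a chart. -/
theorem IsLeviCivita.curvature_eq [CompleteSpace E] (hD : IsLeviCivita g D) (hg : IsWeakMetric g)
    (a b c d : TangentSpace 𝓘(ℝ, E) z) :
    g z (curvature D a b c) d = curvLow (locMetric g z) (extChartAt 𝓘(ℝ, E) z z)
      (locChr D z (extChartAt 𝓘(ℝ, E) z z)) a b c d := by
  have hz := mem_chart_source E z
  have hev (v : TangentSpace 𝓘(ℝ, E) z) {x : M} (hx : x ∈ (chartAt E z).source) :
      ∀ᶠ x in 𝓝 x, FiberBundle.extend E v x = ofE E z x v := by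
    filter_upwards [(chartAt E z).open_source.mem_nhds hx] with x' hx' using extend_eq_ofE v hx'
  -- The extensions agree with the constant fields only near `z`, so locality of `D` is used for the
  -- inner and for the outer derivative.
  have hP (a b : TangentSpace 𝓘(ℝ, E) z) :
      D (fun y ↦ D (FiberBundle.extend E c) y (FiberBundle.extend E b y)) z
        (FiberBundle.extend E a z) =
      D (fun x ↦ D (fun x ↦ ofE E z x c) x (ofE E z x b)) z a := by
    rw [FiberBundle.extend_apply_self]
    refine (hD.congr_self hg (hD.smoothFieldAt_const hz b c).diffFieldAt ?_ a).symm
    filter_upwards [(chartAt E z).open_source.mem_nhds hz] with x hx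
    have hy : extChartAt 𝓘(ℝ, E) z x ∈ (extChartAt 𝓘(ℝ, E) z).target :=
      (extChartAt 𝓘(ℝ, E) z).map_source (by simpa using hx)
    have hxy : (extChartAt 𝓘(ℝ, E) z).symm (extChartAt 𝓘(ℝ, E) z x) = x :=
      (extChartAt 𝓘(ℝ, E) z).left_inv (by simpa using hx)
    have h := hD.congr (Y := fun x ↦ ofE E z x c) (Y' := FiberBundle.extend E c) hg hy
      (by rw [hxy]; exact (HKQuot.smoothFieldAt_const hx _).diffFieldAt)
      (by rw [hxy]; exact (hev c hx).mono fun _ h ↦ h.symm) b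
    rw [hxy] at h
    rw [extend_eq_ofE b hx]
    exact h
  have hbr : VectorField.mlieBracket 𝓘(ℝ, E) (FiberBundle.extend E a : (x : M) → _)
      (FiberBundle.extend E b) z = 0 :=
    (Filter.EventuallyEq.mlieBracket_vectorField_eq (hev a hz) (hev b hz)).trans
      (mlieBracket_const hz _ _)
  rw [curvature, curvatureField, hP, hP, hbr, map_zero, sub_zero, map_sub, sub_apply]
  have e1 := hD.fderiv_chr_self hg a d b c
  have e2 := hD.fderiv_chr_self hg b d a c
  unfold curvLow
  linarith

end Chart

/-! ## Horizontal lifts -/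

section Lift

open scoped MultilinearInstances

variable {E : Type*} [NormedAddCommGroup E] [NormedSpace ℝ E]
  {W : Type*} [NormedAddCommGroup W] [NormedSpace ℝ W]
  {B : Type*} [NormedAddCommGroup B] [NormedSpace ℝ B]

/-- The vertical directions: the image under `F` of the kernel of `P`. -/
def vert (F : W →L[ℝ] E) (P : W →L[ℝ] B) : Submodule ℝ E :=
  (LinearMap.ker (P : W →ₗ[ℝ] B)).map (F : W →ₗ[ℝ] E)

theorem mem_vert {F : W →L[ℝ] E} {P : W →L[ℝ] B} {v : E} :
    v ∈ vert F P ↔ ∃ k, P k = 0 ∧ F k = v := by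
  simp [vert]

/-- The linear algebra of a hyperkähler quotient: `F` is the inclusion of the tangent space of a
level set and `P` is the projection to the tangent space of the quotient. -/
structure IsLinearQuotient (G : E →L[ℝ] E →L[ℝ] ℝ) (J : Fin 3 → E →L[ℝ] E) (q : B →L[ℝ] B →L[ℝ] ℝ)
    (F : W →L[ℝ] E) (P : W →L[ℝ] B) : Prop where
  split : IsQuatSplit G J (vert F P)
  tangent : ∀ v, (∀ i, ∀ w ∈ vert F P, G v (J i w) = 0) ↔ ∃ w, F w = v
  base : ∀ a, (∀ w ∈ vert F P, G (F a) w = 0) → ∀ w, q (P a) (P w) = G (F a) (F w)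

namespace IsLinearQuotient

variable {G : E →L[ℝ] E →L[ℝ] ℝ} {J : Fin 3 → E →L[ℝ] E} {q : B →L[ℝ] B →L[ℝ] ℝ}
  {F : W →L[ℝ] E} {P : W →L[ℝ] B} {K : Type*} [NormedAddCommGroup K] [NormedSpace ℝ K]

variable (J F) in
/-- The sum of the tangent space of the level set and of the images of the vertical space under
the complex structures. -/
noncomputable def sumMap (κ : K →L[ℝ] W) : W × (Fin 3 → K) →L[ℝ] E :=
  F ∘L ContinuousLinearMap.fst ℝ W (Fin 3 → K) +
    ∑ i, J i ∘L F ∘L κ ∘L ContinuousLinearMap.proj i ∘L ContinuousLinearMap.snd ℝ W (Fin 3 → K)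

theorem sumMap_apply (κ : K →L[ℝ] W) (w : W) (k : Fin 3 → K) :
    sumMap J F κ (w, k) = F w + ∑ i, J i (F (κ (k i))) := by
  simp [sumMap, sum_apply]

/-- Pairing with `J j` of the `j`-th component isolates its squared length, since all other summands
are orthogonal to it. -/
theorem injective_sumMap (H : IsLinearQuotient G J q F P) (hF : Function.Injective F)
    {κ : K →L[ℝ] W} (hκ : Function.Injective κ) (hPκ : ∀ k, P (κ k) = 0) :
    Function.Injective (sumMap J F κ) := by
  rw [injective_iff_map_eq_zero]
  rintro ⟨w, k⟩ h
  rw [sumMap_apply] at h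
  have hv (i : Fin 3) : F (κ (k i)) ∈ vert F P := mem_vert.2 ⟨_, hPκ _, rfl⟩
  have hk : k = 0 := by
    funext j
    have h1 : G (F w + ∑ i, J i (F (κ (k i)))) (J j (F (κ (k j)))) =
        G (F (κ (k j))) (F (κ (k j))) := by
      rw [map_add, add_apply, (H.tangent (F w)).2 ⟨w, rfl⟩ j _ (hv j), zero_add, map_sum,
        sum_apply, Finset.sum_eq_single j, H.split.isometry]
      · intro i _ hij
        exact H.split.orthogonal_of_ne hij (hv i) (hv j)
      · simp
    rw [h, map_zero, zero_apply] at h1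
    by_contra hne
    have h2 : F (κ (k j)) ≠ 0 := fun h0 ↦
      hne (hκ (hF (by rw [h0, Pi.zero_apply, map_zero, map_zero])))
    exact (H.split.pos _ h2).ne h1
  subst hk
  simp only [Pi.zero_apply, map_zero, Finset.sum_const_zero, add_zero] at h
  rw [(map_eq_zero_iff F hF).1 h]
  rfl

/-- The component of `v` in `J i V` is `J i` of the vertical part of `-J i v`. What is left is
orthogonal to every `J j V`, hence tangent. -/
theorem surjective_sumMap (H : IsLinearQuotient G J q F P)
    {κ : K →L[ℝ] W} (hPκ : ∀ w, P w = 0 → ∃ k, κ k = w) :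
    Function.Surjective (sumMap J F κ) := by
  intro v
  have h1 (i : Fin 3) : ∃ k : K, F (κ k) ∈ vert F P ∧
      ∀ w ∈ vert F P, G (-J i v - F (κ k)) w = 0 := by
    obtain ⟨z, hz, hzv⟩ := H.split.split (-J i v)
    obtain ⟨w, hw, rfl⟩ := mem_vert.1 hz
    obtain ⟨k, rfl⟩ := hPκ w hw
    exact ⟨k, hz, hzv⟩
  choose k hk hkv using h1
  have h2 : ∀ j, ∀ w ∈ vert F P, G (v - ∑ i, J i (F (κ (k i)))) (J j w) = 0 := by
    intro j w hw
    have h3 : G (∑ i, J i (F (κ (k i)))) (J j w) = G (F (κ (k j))) w := by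
      rw [map_sum, sum_apply, Finset.sum_eq_single j, H.split.isometry]
      · intro i _ hij
        exact H.split.orthogonal_of_ne hij (hk i) hw
      · simp
    have h4 := hkv j w hw
    rw [map_sub, sub_apply, map_neg, neg_apply, H.split.skew, neg_neg] at h4
    rw [map_sub, sub_apply, h3, h4]
  obtain ⟨w, hw⟩ := (H.tangent _).1 h2
  exact ⟨(w, k), by rw [sumMap_apply, hw, sub_add_cancel]⟩

/-- The key to smooth lifts. `J 0` sends the horizontal part of `F w` into the tangent space of the
level set and the vertical part into `J 0 V`. Hence the vertical part of `F w` is a coordinate of `J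
0 (F w)` under `sumMap`, and no projection defined by the weak metric has to be differentiated. -/
theorem exists_horizontal (H : IsLinearQuotient G J q F P) {κ : K →L[ℝ] W}
    (hPκ : ∀ w, P w = 0 → ∃ k, κ k = w) (w : W) :
    ∃ (k : K) (w' : W), (∀ u ∈ vert F P, G (F (w - κ k)) u = 0) ∧
      sumMap J F κ (w', Pi.single 0 k) = J 0 (F w) := by
  obtain ⟨z, hz, hzv⟩ := H.split.split (F w)
  obtain ⟨k', hk', rfl⟩ := mem_vert.1 hz
  obtain ⟨k, rfl⟩ := hPκ k' hk'
  have hor : ∀ u ∈ vert F P, G (F (w - κ k)) u = 0 := by simpa [map_sub] using hzv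
  have hJ : ∀ i, ∀ u ∈ vert F P, G (J 0 (F (w - κ k))) (J i u) = 0 := by
    intro i u hu
    rcases eq_or_ne 0 i with rfl | hi
    · rw [H.split.isometry, hor u hu]
    · obtain ⟨l, ε, hl⟩ := H.split.exists_mul hi
      rw [H.split.skew, hl, map_smul, (H.tangent _).2 ⟨_, rfl⟩ l u hu, smul_zero, neg_zero]
  obtain ⟨w', hw'⟩ := (H.tangent _).1 hJ
  refine ⟨k, w', hor, ?_⟩
  rw [sumMap_apply, hw', Finset.sum_eq_single 0, Pi.single_eq_same, map_sub, map_sub,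
    sub_add_cancel]
  · intro i _ hi
    rw [Pi.single_eq_of_ne hi, map_zero, map_zero, map_zero]
  · simp

end IsLinearQuotient

set_option synthInstance.maxHeartbeats 200000 in
/-- A smooth horizontal lift exists near `x`. -/
theorem exists_lift [CompleteSpace E] [CompleteSpace W] [CompleteSpace B]
    {g : E → E →L[ℝ] E →L[ℝ] ℝ} {J : Fin 3 → E → E →L[ℝ] E} {q : B → B →L[ℝ] B →L[ℝ] ℝ}
    {f : W → E} {p : W → B} {x : W} (hf : ContDiffAt ℝ ∞ f x) (hp : ContDiffAt ℝ ∞ p x)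
    (hJ : ∀ i, ContDiffAt ℝ ∞ (J i) (f x))
    (H : ∀ᶠ y in 𝓝 x, IsLinearQuotient (g (f y)) (fun i ↦ J i (f y)) (q (p y))
      (fderiv ℝ f y) (fderiv ℝ p y))
    (hinj : Function.Injective (fderiv ℝ f x)) {s₀ : B →L[ℝ] W}
    (hs₀ : ∀ b, fderiv ℝ p x (s₀ b) = b) :
    ∃ h : W → B →L[ℝ] W, ContDiffAt ℝ ∞ h x ∧ (∀ᶠ y in 𝓝 x, ∀ X, fderiv ℝ p y (h y X) = X) ∧
      ∀ᶠ y in 𝓝 x, ∀ X, ∀ w ∈ vert (fderiv ℝ f y) (fderiv ℝ p y),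
        g (f y) (fderiv ℝ f y (h y X)) w = 0 := by
  have hF : ContDiffAt ℝ ∞ (fderiv ℝ f) x := hf.fderiv_right (m := ∞) (by simp)
  have hP : ContDiffAt ℝ ∞ (fderiv ℝ p) x := hp.fderiv_right (m := ∞) (by simp)
  let K : Submodule ℝ W := LinearMap.ker (fderiv ℝ p x : W →ₗ[ℝ] B)
  have hKc : IsClosed (K : Set W) := (fderiv ℝ p x).isClosed_ker
  have : CompleteSpace K := hKc.completeSpace_coe
  let pr : W →L[ℝ] K := (ContinuousLinearMap.id ℝ W - s₀ ∘L fderiv ℝ p x).codRestrict K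
    fun w ↦ by simp [K, hs₀]
  have hpr (w : W) : (pr w : W) = w - s₀ (fderiv ℝ p x w) := rfl
  -- `T y` straightens the kernels of `dp`. Its inverse supplies a parametrization `κ y` of the
  -- kernel at `y` by the fixed space `K`, and a right inverse `s y` of `dp`, both smooth in `y`.
  let T (y : W) : W →L[ℝ] B × K := ContinuousLinearMap.inl ℝ B K ∘L fderiv ℝ p y +
    ContinuousLinearMap.inr ℝ B K ∘L pr
  have hT (y w : W) : T y w = (fderiv ℝ p y w, pr w) := by simp [T]
  let e : W ≃L[ℝ] B × K := ContinuousLinearEquiv.equivOfInverse (T x)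
    (s₀ ∘L ContinuousLinearMap.fst ℝ B K + K.subtypeL ∘L ContinuousLinearMap.snd ℝ B K)
    (fun w ↦ by simp [hT, hpr])
    (fun ⟨b, k⟩ ↦ by
      have hk : fderiv ℝ p x (k : W) = 0 := k.2
      rw [hT]
      ext <;> simp [hpr, hs₀, hk])
  have he : (e : W →L[ℝ] B × K) = T x := rfl
  have hTs : ContDiffAt ℝ ∞ T x :=
    (contDiffAt_const.clm_comp hP).add contDiffAt_const
  let S (y : W) : B × K →L[ℝ] W := (T y).inverse
  have hS : ContDiffAt ℝ ∞ S x := by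
    have h : ContDiffAt ℝ ∞ ContinuousLinearMap.inverse (T x) := contDiffAt_map_inverse e
    exact h.comp x hTs
  have hTi : ∀ᶠ y in 𝓝 x, ∃ e' : W ≃L[ℝ] B × K, (e' : W →L[ℝ] B × K) = T y :=
    hTs.continuousAt.eventually (he ▸ e.nhds)
  let κ (y : W) : K →L[ℝ] W := S y ∘L ContinuousLinearMap.inr ℝ B K
  let s (y : W) : B →L[ℝ] W := S y ∘L ContinuousLinearMap.inl ℝ B K
  have hκs : ContDiffAt ℝ ∞ κ x := hS.clm_comp contDiffAt_const
  have hss : ContDiffAt ℝ ∞ s x := hS.clm_comp contDiffAt_const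
  let A (y : W) : W × (Fin 3 → K) →L[ℝ] E :=
    IsLinearQuotient.sumMap (fun i ↦ J i (f y)) (fderiv ℝ f y) (κ y)
  have hJf (i : Fin 3) : ContDiffAt ℝ ∞ (fun y ↦ J i (f y)) x := (hJ i).comp x hf
  have hA : ContDiffAt ℝ ∞ A x := by
    refine (hF.clm_comp contDiffAt_const).add (ContDiffAt.sum fun i _ ↦ ?_)
    exact (hJf i).clm_comp (hF.clm_comp (hκs.clm_comp contDiffAt_const))
  have hκT {y : W} (hy : ∃ e' : W ≃L[ℝ] B × K, (e' : W →L[ℝ] B × K) = T y) :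
      (∀ b, fderiv ℝ p y (s y b) = b) ∧ (∀ k, fderiv ℝ p y (κ y k) = 0) ∧
        (∀ w, fderiv ℝ p y w = 0 → κ y (pr w) = w) ∧ Function.Injective (κ y) := by
    obtain ⟨e', he'⟩ := hy
    have hSy : S y = e'.symm := by
      simp only [S, ← he', ContinuousLinearMap.inverse_equiv]
    have hTS (v : B × K) : T y (S y v) = v := by
      rw [hSy, ← he']
      exact e'.apply_symm_apply v
    have hST (w : W) : S y (T y w) = w := by
      rw [hSy, ← he']
      exact e'.symm_apply_apply w
    refine ⟨fun b ↦ ?_, fun k ↦ ?_, fun w hw ↦ ?_, fun k k' hk ↦ ?_⟩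
    · have := congrArg Prod.fst (hTS (b, 0))
      rwa [hT] at this
    · have := congrArg Prod.fst (hTS (0, k))
      rwa [hT] at this
    · have := hST w
      rwa [hT, hw] at this
    · have h1 := hTS (0, k)
      have h2 := hTS (0, k')
      have h3 : S y (0, k) = S y (0, k') := hk
      rw [h3, h2] at h1
      exact (congrArg Prod.snd h1).symm
  obtain ⟨-, hx2, hx3, hx4⟩ := hκT hTi.self_of_nhds
  -- The open mapping theorem makes the bijection `A x` an isomorphism, so `A y` is invertible
  -- nearby with smoothly varying inverse.
  let a : (W × (Fin 3 → K)) ≃L[ℝ] E := ContinuousLinearEquiv.ofBijective (A x)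
    (LinearMap.ker_eq_bot.2 (H.self_of_nhds.injective_sumMap hinj hx4 hx2))
    (LinearMap.range_eq_top.2 (H.self_of_nhds.surjective_sumMap fun w hw ↦ ⟨_, hx3 w hw⟩))
  have ha : (a : W × (Fin 3 → K) →L[ℝ] E) = A x := rfl
  have hAi : ∀ᶠ y in 𝓝 x, ∃ a' : (W × (Fin 3 → K)) ≃L[ℝ] E,
      (a' : W × (Fin 3 → K) →L[ℝ] E) = A y := hA.continuousAt.eventually (ha ▸ a.nhds)
  have hAs : ContDiffAt ℝ ∞ (fun y ↦ (A y).inverse) x := by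
    have h : ContDiffAt ℝ ∞ ContinuousLinearMap.inverse (A x) := contDiffAt_map_inverse a
    exact h.comp x hA
  -- The vertical part of `s y X`, read off from `J 0` as in `exists_horizontal`; subtracting it
  -- makes `s y` horizontal.
  let c (y : W) : B →L[ℝ] K := ContinuousLinearMap.proj (0 : Fin 3) ∘L
    ContinuousLinearMap.snd ℝ W (Fin 3 → K) ∘L (A y).inverse ∘L J 0 (f y) ∘L fderiv ℝ f y ∘L s y
  have hcs : ContDiffAt ℝ ∞ c x := contDiffAt_const.clm_comp (contDiffAt_const.clm_comp
    (hAs.clm_comp ((hJf 0).clm_comp (hF.clm_comp hss))))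
  refine ⟨fun y ↦ s y - κ y ∘L c y, hss.sub (hκs.clm_comp hcs), ?_, ?_⟩
  · filter_upwards [hTi] with y hy X
    obtain ⟨h1, h2, -, -⟩ := hκT hy
    simp [h1, h2]
  · filter_upwards [hTi, hAi, H] with y hy ⟨a', ha'⟩ Hy X
    obtain ⟨h1, h2, h3, -⟩ := hκT hy
    obtain ⟨k, w', hk, hw'⟩ := Hy.exists_horizontal (fun w hw ↦ ⟨_, h3 w hw⟩) (s y X)
    have hc : c y X = k := by
      have : (A y).inverse (J 0 (f y) (fderiv ℝ f y (s y X))) = (w', Pi.single 0 k) := by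
        rw [← hw']
        change (A y).inverse (A y _) = _
        rw [← ha', ContinuousLinearMap.inverse_equiv]
        exact a'.symm_apply_apply _
      change ((A y).inverse (J 0 (f y) (fderiv ℝ f y (s y X)))).2 0 = k
      rw [this]
      simp
    simpa [hc] using hk

end Lift

/-! ## Local inverses of immersions and submersions -/

section Inverse

variable {E : Type*} [NormedAddCommGroup E] [NormedSpace ℝ E]
  {M : Type*} [TopologicalSpace M] [ChartedSpace E M]
  {E' : Type*} [NormedAddCommGroup E'] [NormedSpace ℝ E']
  {N : Type*} [TopologicalSpace N] [ChartedSpace E' N]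

/-- In adapted charts `f` is `v ↦ (v, 0)`, and `r` forgets the second coordinate. -/
theorem exists_leftInverse_of_isImmersionAt {f : N → M} {x : N}
    (h : Manifold.IsImmersionAt 𝓘(ℝ, E') 𝓘(ℝ, E) ∞ f x) :
    ∃ r : M → N, ContMDiffAt 𝓘(ℝ, E) 𝓘(ℝ, E') ∞ r (f x) ∧ ∀ᶠ y in 𝓝 x, r (f y) = y := by
  set a := h.domChart.extend 𝓘(ℝ, E') with ha
  set b := h.codChart.extend 𝓘(ℝ, E) with hb
  let fstr : E → E' := fun v ↦ (h.equiv.symm v).1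
  have hw {y : N} (hy : y ∈ h.domChart.source) : fstr (b (f y)) = a y := by
    have hy' : y ∈ a.source := by simpa [ha] using hy
    have h1 := h.writtenInCharts (a.map_source hy')
    simp only [Function.comp_apply, ← ha, ← hb, a.left_inv hy'] at h1
    simp [fstr, h1]
  have hx := h.mem_domChart_source
  refine ⟨fun z ↦ a.symm (fstr (b z)), ?_, ?_⟩
  · have h1 : ContMDiffAt 𝓘(ℝ, E) 𝓘(ℝ, E) ∞ b (f x) :=
      contMDiffAt_of_mem_maximalAtlas h.codChart_mem_maximalAtlas h.mem_codChart_source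
    have h2 : ContMDiffAt 𝓘(ℝ, E) 𝓘(ℝ, E') ∞ fstr (b (f x)) :=
      (contDiff_fst.comp h.equiv.symm.contDiff).contDiffAt.contMDiffAt
    have h3 : ContMDiffAt 𝓘(ℝ, E') 𝓘(ℝ, E') ∞ a.symm (fstr (b (f x))) := by
      rw [hw hx]
      exact contMDiffAt_symm_of_mem_maximalAtlas h.domChart_mem_maximalAtlas
        (h.domChart.map_source hx)
    exact h3.comp (f x) (h2.comp (f x) h1)
  · filter_upwards [h.domChart.open_source.mem_nhds hx] with y hy
    rw [hw hy]
    exact a.left_inv (by simpa [ha] using hy)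

/-- In adapted charts `f` is the first projection; `s` keeps the second coordinate of `x` fixed. -/
theorem exists_rightInverse_of_isSubmersionAt {f : N → M} {x : N}
    (h : Manifold.IsSubmersionAt 𝓘(ℝ, E') 𝓘(ℝ, E) ∞ f x) :
    ∃ s : M → N, ContMDiffAt 𝓘(ℝ, E) 𝓘(ℝ, E') ∞ s (f x) ∧ s (f x) = x ∧
      ∀ᶠ y in 𝓝 (f x), f (s y) = y := by
  set a := h.domChart.extend 𝓘(ℝ, E') with ha
  set b := h.codChart.extend 𝓘(ℝ, E) with hb
  let j : E → E' := fun v ↦ h.equiv.symm (v, (h.equiv (a x)).2)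
  have hx := h.mem_domChart_source
  have hx' : x ∈ a.source := by simpa [ha] using hx
  have hw {v : E'} (hv : v ∈ a.target) : b (f (a.symm v)) = (h.equiv v).1 := h.writtenInCharts hv
  have hjx : j (b (f x)) = a x := by
    have h1 := hw (a.map_source hx')
    rw [a.left_inv hx'] at h1
    simp [j, h1]
  have h1 : ContMDiffAt 𝓘(ℝ, E) 𝓘(ℝ, E) ∞ b (f x) :=
    contMDiffAt_of_mem_maximalAtlas h.codChart_mem_maximalAtlas h.mem_codChart_source
  have h2 : ContMDiffAt 𝓘(ℝ, E) 𝓘(ℝ, E') ∞ j (b (f x)) :=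
    (h.equiv.symm.contDiff.comp (contDiff_id.prodMk contDiff_const)).contDiffAt.contMDiffAt
  have ht : a.target ∈ 𝓝 (a x) := h.domChart.isOpen_extend_target.mem_nhds (a.map_source hx')
  have h3 : ContMDiffAt 𝓘(ℝ, E') 𝓘(ℝ, E') ∞ a.symm (j (b (f x))) := by
    rw [hjx]
    exact contMDiffAt_symm_of_mem_maximalAtlas h.domChart_mem_maximalAtlas
      (h.domChart.map_source hx)
  have h4 := h3.comp (f x) (h2.comp (f x) h1)
  refine ⟨fun z ↦ a.symm (j (b z)), h4, ?_, ?_⟩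
  · change a.symm (j (b (f x))) = x
    rw [hjx, a.left_inv hx']
  · have hc : ContinuousAt (fun z ↦ j (b z)) (f x) := (h2.comp (f x) h1).continuousAt
    have ht' : a.target ∈ 𝓝 (j (b (f x))) := by rwa [hjx]
    have hs : h.domChart.source ∈ 𝓝 (a.symm (j (b (f x)))) := by
      rw [hjx, a.left_inv hx']
      exact h.domChart.open_source.mem_nhds hx
    filter_upwards [hc.preimage_mem_nhds ht', h4.continuousAt.preimage_mem_nhds hs,
      h.codChart.open_source.mem_nhds h.mem_codChart_source] with z hz hz2 hz3
    have h5 : b (f (a.symm (j (b z)))) = b z := by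
      rw [hw hz]
      simp [j]
    exact b.injOn (by simpa [hb] using h.source_subset_preimage_source hz2)
      (by simpa [hb] using hz3) h5

end Inverse

/-! ## Level sets of hyperkähler moment maps -/

section Level

variable {L : Type*} [NormedAddCommGroup L] [NormedSpace ℝ L]
  {G : Type*} [TopologicalSpace G] [ChartedSpace L G] [Group G]
  {E : Type*} [NormedAddCommGroup E] [NormedSpace ℝ E]
  {M : Type*} [TopologicalSpace M] [ChartedSpace E M]
  [MulAction G M] [ContMDiffSMul 𝓘(ℝ, L) 𝓘(ℝ, E) ∞ G M]

omit [ContMDiffSMul 𝓘(ℝ, L) 𝓘(ℝ, E) ∞ G M] in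
-- Used to replace `1 • m` by `m`: both tangent spaces are the model space.
theorem hasMFDerivAt_of_eq {E' : Type*} [NormedAddCommGroup E'] [NormedSpace ℝ E']
    {N : Type*} [TopologicalSpace N] [ChartedSpace E' N] {f : M → N} {m m' : M} (h : m' = m)
    (hf : MDifferentiableAt 𝓘(ℝ, E) 𝓘(ℝ, E') f m) :
    HasMFDerivAt 𝓘(ℝ, E) 𝓘(ℝ, E') f m' (mfderiv 𝓘(ℝ, E) 𝓘(ℝ, E') f m : E →L[ℝ] E') := by
  subst h
  exact hf.hasMFDerivAt

theorem contMDiff_orbit (m : M) : ContMDiff 𝓘(ℝ, L) 𝓘(ℝ, E) ∞ (fun h : G ↦ h • m) :=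
  contMDiff_id.smul contMDiff_const

theorem mfderiv_comp_orbit {F : Type*} [NormedAddCommGroup F] [NormedSpace ℝ F] {f : M → F} {m : M}
    (hf : MDifferentiableAt 𝓘(ℝ, E) 𝓘(ℝ, F) f m) (ρ : L) :
    mvfderiv 𝓘(ℝ, E) f m (fund L G E m ρ) =
      mvfderiv 𝓘(ℝ, L) (fun h : G ↦ f (h • m)) 1 ρ := by
  have h1 := hasMFDerivAt_of_eq (m' := (fun h : G ↦ h • m) 1) (one_smul G m) hf
  have h2 := ((contMDiff_orbit (G := G) (L := L) (E := E) m).mdifferentiable (by simp) 1).hasMFDerivAt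
  have h3 := (h1.comp (1 : G) h2).mfderiv
  exact (DFunLike.congr_fun h3 ρ).symm

/-- Equivariance and invariance of `c` make `μ i` constant on the orbit of `m`; the pairing is a
derivative of `μ i` along that orbit. -/
theorem metric_fund_fund {g : BilinField E M} {J : Fin 3 → EndoField E M}
    {μ : Fin 3 → M → (L →L[ℝ] ℝ)} (hμ : IsHyperkahlerMomentMap G g J μ)
    {c : Fin 3 → (L →L[ℝ] ℝ)} (hc : ∀ (h : G) (i : Fin 3), coAd h (c i) = c i) {m : M}
    (hm : m ∈ levelSet μ c) (i : Fin 3) (ρ σ : L) :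
    g m (fund L G E m ρ) (J i m (fund L G E m σ)) = 0 := by
  rw [← hμ.deriv_eq, mfderiv_comp_orbit ((hμ.smooth i).mdifferentiable (by simp) m)]
  have : (fun h : G ↦ μ i (h • m)) = fun _ ↦ c i := by
    funext h
    rw [hμ.equivariant, hm i, hc]
  rw [this]
  simp only [mvfderiv, mfderiv_const]
  rfl

end Level

/-! ### Tangent spaces of the level set, the orbits and the quotient -/

section Quotient

variable {L : Type*} [NormedAddCommGroup L] [NormedSpace ℝ L]
  {G : Type*} [TopologicalSpace G] [ChartedSpace L G] [Group G]
  {E : Type*} [NormedAddCommGroup E] [NormedSpace ℝ E]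
  {M : Type*} [TopologicalSpace M] [ChartedSpace E M] [IsManifold 𝓘(ℝ, E) ∞ M]
  [MulAction G M]
  {Ec : Type*} [NormedAddCommGroup Ec] [NormedSpace ℝ Ec]
  {EQ : Type*} [NormedAddCommGroup EQ] [NormedSpace ℝ EQ]
  {g : BilinField E M} {D : Connection E M} {J : Fin 3 → EndoField E M}
  {μ : Fin 3 → M → (L →L[ℝ] ℝ)} {c : Fin 3 → (L →L[ℝ] ℝ)}
  [ChartedSpace Ec (levelSet μ c)] [ChartedSpace EQ (Quo G μ c)]
  [IsManifold 𝓘(ℝ, EQ) ∞ (Quo G μ c)]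
  {gQ : BilinField EQ (Quo G μ c)}

variable (E Ec) in
/-- The derivative of the inclusion of the level set. -/
noncomputable abbrev dInc (x : levelSet μ c) :
    TangentSpace 𝓘(ℝ, Ec) x →L[ℝ] TangentSpace 𝓘(ℝ, E) (x : M) :=
  mfderiv 𝓘(ℝ, Ec) 𝓘(ℝ, E) (Subtype.val : levelSet μ c → M) x

variable (G Ec EQ) in
/-- The derivative of the projection to the quotient. -/
noncomputable abbrev dProj (x : levelSet μ c) :
    TangentSpace 𝓘(ℝ, Ec) x →L[ℝ] TangentSpace 𝓘(ℝ, EQ) (proj G μ c x) :=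
  mfderiv 𝓘(ℝ, Ec) 𝓘(ℝ, EQ) (proj G μ c) x

variable (Ec) in
/-- `(Quo G μ c, gQ)` is the hyperkähler quotient of `(M, g, D, J)` at the level `c`. -/
structure IsHyperkahlerQuotient (g : BilinField E M) (D : Connection E M)
    (J : Fin 3 → EndoField E M) (μ : Fin 3 → M → (L →L[ℝ] ℝ)) (c : Fin 3 → (L →L[ℝ] ℝ))
    [ChartedSpace Ec (levelSet μ c)] [ChartedSpace EQ (Quo G μ c)]
    [IsManifold 𝓘(ℝ, EQ) ∞ (Quo G μ c)] (gQ : BilinField EQ (Quo G μ c)) : Prop where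
  hyperkahler : IsWeakHyperkahler g D J
  moment : IsHyperkahlerMomentMap G g J μ
  fixed : ∀ (h : G) (i : Fin 3), coAd h (c i) = c i
  good : IsGoodOnLevel G g μ c
  level : IsLevelSubmanifold (E := E) (Ec := Ec) μ c
  quotient : IsQuotientStructure (Ec := Ec) G g μ c gQ

namespace IsHyperkahlerQuotient

variable (H : IsHyperkahlerQuotient (G := G) Ec g D J μ c gQ) (x : levelSet μ c)

include H

theorem mdifferentiableAt_val :
    MDifferentiableAt 𝓘(ℝ, Ec) 𝓘(ℝ, E) (Subtype.val : levelSet μ c → M) x :=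
  H.level.embedding.contMDiff.mdifferentiable (by simp) x

theorem mdifferentiableAt_proj : MDifferentiableAt 𝓘(ℝ, Ec) 𝓘(ℝ, EQ) (proj G μ c) x :=
  H.quotient.submersion.contMDiff.mdifferentiable (by simp) x

theorem smul_mem (h : G) : h • (x : M) ∈ levelSet μ c := fun i ↦ by
  rw [H.moment.equivariant, x.2 i, H.fixed]

/-- The orbit map takes values in the level set, is smooth into it because the inclusion is an
embedding, and has constant projection. Its derivative at `1` supplies `u`. -/
theorem exists_vertical [ContMDiffSMul 𝓘(ℝ, L) 𝓘(ℝ, E) ∞ G M] (ρ : L) :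
    ∃ u : TangentSpace 𝓘(ℝ, Ec) x, dProj G Ec EQ x u = 0 ∧ dInc E Ec x u = fund L G E (x : M) ρ := by
  let o : G → levelSet μ c := fun h ↦ ⟨h • (x : M), H.smul_mem x h⟩
  have ho1 : o 1 = x := Subtype.ext (one_smul G (x : M))
  have ho : ContMDiffAt 𝓘(ℝ, L) 𝓘(ℝ, Ec) ∞ o 1 :=
    (ContMDiffAt.iff_comp_isImmersionAt (φ := (Subtype.val : levelSet μ c → M))
      (H.level.embedding.isImmersion.isImmersionAt (o 1))).2
      ⟨((contMDiff_orbit (L := L) (E := E) (x : M)).continuous.subtype_mk _).continuousAt,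
        contMDiff_orbit (L := L) (E := E) (x : M) 1⟩
  have hd := (ho.mdifferentiableAt (by simp)).hasMFDerivAt
  have h1 := ((hasMFDerivAt_of_eq ho1 (H.mdifferentiableAt_val x)).comp (1 : G) hd).mfderiv
  have h2 := ((hasMFDerivAt_of_eq ho1 (H.mdifferentiableAt_proj x)).comp (1 : G) hd).mfderiv
  refine ⟨mfderiv 𝓘(ℝ, L) 𝓘(ℝ, Ec) o 1 ρ, ?_, (DFunLike.congr_fun h1 ρ).symm⟩
  have h3 : proj G μ c ∘ o = fun _ ↦ proj G μ c x :=
    funext fun h ↦ Quotient.sound (s := (MulAction.orbitRel G M).comap Subtype.val) ⟨h, rfl⟩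
  rw [h3, mfderiv_const] at h2
  exact (DFunLike.congr_fun h2 ρ).symm

theorem metric_inc_endo (u : TangentSpace 𝓘(ℝ, Ec) x) (i : Fin 3) (ρ : L) :
    g x (dInc E Ec x u) (J i x (fund L G E (x : M) ρ)) = 0 := by
  rw [← H.moment.deriv_eq, (H.level.tangent x _).1 ⟨u, rfl⟩ i]
  rfl

theorem mem_range_dInc (v : TangentSpace 𝓘(ℝ, E) (x : M)) :
    (∃ u, dInc E Ec x u = v) ↔ ∀ i ρ, g x v (J i x (fund L G E (x : M) ρ)) = 0 := by
  refine (H.level.tangent x v).trans (forall_congr' fun i ↦ ?_)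
  simp only [← H.moment.deriv_eq]
  exact ⟨fun h ρ ↦ by rw [h]; rfl, fun h ↦ ContinuousLinearMap.ext h⟩

/-- Ellipticity says exactly that every vector has an orthogonal projection to the orbit directions.
-/
theorem split (v : TangentSpace 𝓘(ℝ, E) (x : M)) :
    ∃ ρ : L, IsHorizontal L G g (v - fund L G E (x : M) ρ) := by
  have h1 : Lam L G g (x : M) v ∈ Set.range (Lam L G g (x : M)) := ⟨v, rfl⟩
  rw [H.good.elliptic x x.2] at h1
  obtain ⟨_, ⟨ρ, rfl⟩, hρ⟩ := h1
  refine ⟨ρ, fun σ ↦ ?_⟩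
  have := DFunLike.congr_fun hρ σ
  rw [map_sub, sub_apply]
  exact sub_eq_zero.2 this.symm

/-- A horizontal vector has the length of its projection, here zero. -/
theorem dInc_eq_zero {u : TangentSpace 𝓘(ℝ, Ec) x} (hu : dProj G Ec EQ x u = 0)
    (h : IsHorizontal L G g (dInc E Ec x u)) : dInc E Ec x u = 0 := by
  by_contra hne
  have h1 := H.quotient.riemannian x u u h h
  have h2 := H.hyperkahler.isWeakMetric.pos _ _ hne
  rw [← h1] at h2
  change 0 < gQ _ (dProj G Ec EQ x u) (dProj G Ec EQ x u) at h2
  rw [hu] at h2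
  simp at h2

/-- Removing the orbit part of a vector killed by the projection leaves a vector that is both
vertical and horizontal, hence zero. -/
theorem mem_range_fund [ContMDiffSMul 𝓘(ℝ, L) 𝓘(ℝ, E) ∞ G M] (v : TangentSpace 𝓘(ℝ, E) (x : M)) :
    (∃ u, dProj G Ec EQ x u = 0 ∧ dInc E Ec x u = v) ↔ ∃ ρ, fund L G E (x : M) ρ = v := by
  constructor
  · rintro ⟨u, hu, rfl⟩
    obtain ⟨ρ, hρ⟩ := H.split x (dInc E Ec x u)
    obtain ⟨u', hu', hρ'⟩ := H.exists_vertical x ρ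
    rw [← hρ', ← map_sub] at hρ
    have := H.dInc_eq_zero x (by rw [map_sub, hu, hu', sub_zero]) hρ
    rw [map_sub, sub_eq_zero, hρ'] at this
    exact ⟨ρ, this.symm⟩
  · rintro ⟨ρ, rfl⟩
    exact H.exists_vertical x ρ

/-- The orbit part of `w` is killed by the projection and orthogonal to `u`, so only one of the two
vectors needs to be horizontal. -/
theorem riemannian [ContMDiffSMul 𝓘(ℝ, L) 𝓘(ℝ, E) ∞ G M] {u : TangentSpace 𝓘(ℝ, Ec) x}
    (hu : IsHorizontal L G g (dInc E Ec x u)) (w : TangentSpace 𝓘(ℝ, Ec) x) :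
    gQ (proj G μ c x) (dProj G Ec EQ x u) (dProj G Ec EQ x w) =
      g x (dInc E Ec x u) (dInc E Ec x w) := by
  obtain ⟨ρ, hρ⟩ := H.split x (dInc E Ec x w)
  obtain ⟨u', hu', hρ'⟩ := H.exists_vertical x ρ
  have h1 := H.quotient.riemannian x u (w - u') hu (by
    have : dInc E Ec x (w - u') = dInc E Ec x w - fund L G E (x : M) ρ := by rw [map_sub, hρ']
    change IsHorizontal L G g (dInc E Ec x (w - u'))
    rwa [this])
  change gQ _ (dProj G Ec EQ x u) (dProj G Ec EQ x (w - u')) =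
    g x (dInc E Ec x u) (dInc E Ec x (w - u')) at h1
  rw [map_sub, hu', sub_zero, map_sub (dInc E Ec x), hρ', map_sub, hu, sub_zero] at h1
  exact h1

end IsHyperkahlerQuotient

end Quotient

/-! ## The hyperkähler quotient in charts -/

section Written

open scoped MultilinearInstances

variable {E : Type*} [NormedAddCommGroup E] [NormedSpace ℝ E]
  {M : Type*} [TopologicalSpace M] [ChartedSpace E M] [IsManifold 𝓘(ℝ, E) ∞ M]
  {E' : Type*} [NormedAddCommGroup E'] [NormedSpace ℝ E']
  {N : Type*} [TopologicalSpace N] [ChartedSpace E' N] [IsManifold 𝓘(ℝ, E') ∞ N]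

theorem locMetric_chart (g : BilinField E M) {z x : M} (hx : x ∈ (chartAt E z).source)
    (v w : TangentSpace 𝓘(ℝ, E) x) :
    locMetric g z (extChartAt 𝓘(ℝ, E) z x) (toE E z x v) (toE E z x w) = g x v w := by
  have hy : extChartAt 𝓘(ℝ, E) z x ∈ (extChartAt 𝓘(ℝ, E) z).target :=
    (extChartAt 𝓘(ℝ, E) z).map_source (by simpa using hx)
  have hxy : (extChartAt 𝓘(ℝ, E) z).symm (extChartAt 𝓘(ℝ, E) z x) = x :=
    (extChartAt 𝓘(ℝ, E) z).left_inv (by simpa using hx)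
  rw [locMetric_apply g hy, hxy, ofE_toE hx, ofE_toE hx]

theorem locEndo_chart (J : EndoField E M) {z x : M} (hx : x ∈ (chartAt E z).source)
    (v : TangentSpace 𝓘(ℝ, E) x) :
    locEndo J z (extChartAt 𝓘(ℝ, E) z x) (toE E z x v) = toE E z x (J x v) := by
  have hxy : (extChartAt 𝓘(ℝ, E) z).symm (extChartAt 𝓘(ℝ, E) z x) = x :=
    (extChartAt 𝓘(ℝ, E) z).left_inv (by simpa using hx)
  rw [locEndo_apply, hxy, ofE_toE hx]

/-- The map `F` in the charts at `z` and `z'`. -/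
noncomputable def written (E E' : Type*) [NormedAddCommGroup E] [NormedSpace ℝ E]
    [NormedAddCommGroup E'] [NormedSpace ℝ E'] [ChartedSpace E M] [ChartedSpace E' N]
    (F : N → M) (z : N) (z' : M) (y : E') : E :=
  extChartAt 𝓘(ℝ, E) z' (F ((extChartAt 𝓘(ℝ, E') z).symm y))

variable {F : N → M} {z : N} {z' : M} {y : E'}

theorem contDiffAt_written (hy : y ∈ (extChartAt 𝓘(ℝ, E') z).target)
    (hF : ContMDiffAt 𝓘(ℝ, E') 𝓘(ℝ, E) ∞ F ((extChartAt 𝓘(ℝ, E') z).symm y))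
    (hs : F ((extChartAt 𝓘(ℝ, E') z).symm y) ∈ (chartAt E z').source) :
    ContDiffAt ℝ ∞ (written E E' F z z') y := by
  rw [← contMDiffAt_iff_contDiffAt]
  exact (contMDiffAt_chart hs).comp y (hF.comp y (contMDiffAt_chart_symm hy))

theorem fderiv_written (hy : y ∈ (extChartAt 𝓘(ℝ, E') z).target)
    (hF : MDifferentiableAt 𝓘(ℝ, E') 𝓘(ℝ, E) F ((extChartAt 𝓘(ℝ, E') z).symm y))
    (hs : F ((extChartAt 𝓘(ℝ, E') z).symm y) ∈ (chartAt E z').source) :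
    fderiv ℝ (written E E' F z z') y = toE E z' (F ((extChartAt 𝓘(ℝ, E') z).symm y)) ∘L
      mfderiv 𝓘(ℝ, E') 𝓘(ℝ, E) F ((extChartAt 𝓘(ℝ, E') z).symm y) ∘L
        ofE E' z ((extChartAt 𝓘(ℝ, E') z).symm y) := by
  have hyx : extChartAt 𝓘(ℝ, E') z ((extChartAt 𝓘(ℝ, E') z).symm y) = y :=
    (extChartAt 𝓘(ℝ, E') z).right_inv hy
  rw [toE_eq_mfderiv hs, ofE_eq_mfderiv (symm_mem_source hy), hyx, ← mfderiv_eq_fderiv]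
  have h1 := ((contMDiffAt_chart hs).mdifferentiableAt (by simp)).hasMFDerivAt
  have h2 := ((contMDiffAt_chart_symm hy).mdifferentiableAt (by simp)).hasMFDerivAt
  exact (h1.comp y (hF.hasMFDerivAt.comp y h2)).mfderiv

end Written

/-! ### The linear algebra of the quotient at each point of a chart -/

section Quotient

open scoped MultilinearInstances

variable {L : Type*} [NormedAddCommGroup L] [NormedSpace ℝ L]
  {G : Type*} [TopologicalSpace G] [ChartedSpace L G] [Group G]
  {E : Type*} [NormedAddCommGroup E] [NormedSpace ℝ E]
  {M : Type*} [TopologicalSpace M] [ChartedSpace E M] [IsManifold 𝓘(ℝ, E) ∞ M]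
  [MulAction G M] [ContMDiffSMul 𝓘(ℝ, L) 𝓘(ℝ, E) ∞ G M]
  {Ec : Type*} [NormedAddCommGroup Ec] [NormedSpace ℝ Ec]
  {EQ : Type*} [NormedAddCommGroup EQ] [NormedSpace ℝ EQ]
  {g : BilinField E M} {D : Connection E M} {J : Fin 3 → EndoField E M}
  {μ : Fin 3 → M → (L →L[ℝ] ℝ)} {c : Fin 3 → (L →L[ℝ] ℝ)}
  [ChartedSpace Ec (levelSet μ c)] [IsManifold 𝓘(ℝ, Ec) ∞ (levelSet μ c)]
  [ChartedSpace EQ (Quo G μ c)] [IsManifold 𝓘(ℝ, EQ) ∞ (Quo G μ c)]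
  {gQ : BilinField EQ (Quo G μ c)}

namespace IsHyperkahlerQuotient

variable (H : IsHyperkahlerQuotient (G := G) Ec g D J μ c gQ) {m x : levelSet μ c}

include H

theorem mem_vert_iff (hx : x ∈ (chartAt Ec m).source)
    (h2 : proj G μ c x ∈ (chartAt EQ (proj G μ c m)).source) (v : E) :
    v ∈ vert (toE E (m : M) (x : M) ∘L dInc E Ec x ∘L ofE Ec m x)
      (toE EQ (proj G μ c m) (proj G μ c x) ∘L dProj G Ec EQ x ∘L ofE Ec m x) ↔
    ∃ ρ : L, toE E (m : M) (x : M) (fund L G E (x : M) ρ) = v := by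
  rw [mem_vert]
  constructor
  · rintro ⟨k, hk, rfl⟩
    obtain ⟨ρ, hρ⟩ := (H.mem_range_fund x _).1 ⟨ofE Ec m x k, by
      rw [← ofE_toE h2 (dProj G Ec EQ x (ofE Ec m x k))]
      exact (congrArg _ hk).trans (map_zero _), rfl⟩
    exact ⟨ρ, by rw [hρ]; rfl⟩
  · rintro ⟨ρ, rfl⟩
    obtain ⟨u, hu, hu'⟩ := (H.mem_range_fund x _).2 ⟨ρ, rfl⟩
    refine ⟨toE Ec m x u, ?_, ?_⟩
    · simp [ofE_toE hx, hu]
    · simp [ofE_toE hx, hu']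

theorem isLinearQuotient (hx : x ∈ (chartAt Ec m).source)
    (h1 : (x : M) ∈ (chartAt E (m : M)).source)
    (h2 : proj G μ c x ∈ (chartAt EQ (proj G μ c m)).source) :
    IsLinearQuotient (locMetric g (m : M) (extChartAt 𝓘(ℝ, E) (m : M) (x : M)))
      (fun i ↦ locEndo (J i) (m : M) (extChartAt 𝓘(ℝ, E) (m : M) (x : M)))
      (locMetric gQ (proj G μ c m) (extChartAt 𝓘(ℝ, EQ) (proj G μ c m) (proj G μ c x)))
      (toE E (m : M) (x : M) ∘L dInc E Ec x ∘L ofE Ec m x)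
      (toE EQ (proj G μ c m) (proj G μ c x) ∘L dProj G Ec EQ x ∘L ofE Ec m x) := by
  have hsurj (v : E) : ∃ v', toE E (m : M) (x : M) v' = v := ⟨_, toE_ofE h1 v⟩
  have hV := H.mem_vert_iff hx h2
  have hg := H.hyperkahler
  refine ⟨⟨?_, ?_, ?_, ?_, ?_, ?_, ?_, ?_⟩, ?_, ?_⟩
  · intro v w
    obtain ⟨v, rfl⟩ := hsurj v
    obtain ⟨w, rfl⟩ := hsurj w
    rw [locMetric_chart g h1, locMetric_chart g h1, hg.isWeakMetric.symm]
  · intro v hv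
    obtain ⟨v, rfl⟩ := hsurj v
    rw [locMetric_chart g h1]
    exact hg.isWeakMetric.pos _ _ fun h ↦ hv (by rw [h, map_zero])
  · intro i v
    obtain ⟨v, rfl⟩ := hsurj v
    rw [locEndo_chart _ h1, locEndo_chart _ h1, hg.square, map_neg]
  · intro i j hij v
    obtain ⟨v, rfl⟩ := hsurj v
    rw [locEndo_chart _ h1, locEndo_chart _ h1, locEndo_chart _ h1, locEndo_chart _ h1,
      hg.anticomm i j hij, map_neg]
  · intro v
    obtain ⟨v, rfl⟩ := hsurj v
    rw [locEndo_chart _ h1, locEndo_chart _ h1, locEndo_chart _ h1, hg.triple, map_neg]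
  · intro i v w
    obtain ⟨v, rfl⟩ := hsurj v
    obtain ⟨w, rfl⟩ := hsurj w
    rw [locEndo_chart _ h1, locEndo_chart _ h1, locMetric_chart g h1, locMetric_chart g h1,
      hg.isometry]
  · intro i v hv w hw
    obtain ⟨ρ, rfl⟩ := (hV v).1 hv
    obtain ⟨σ, rfl⟩ := (hV w).1 hw
    rw [locEndo_chart _ h1, locMetric_chart g h1, metric_fund_fund H.moment H.fixed x.2]
  · intro v
    obtain ⟨v, rfl⟩ := hsurj v
    obtain ⟨ρ, hρ⟩ := H.split x v
    refine ⟨_, (hV _).2 ⟨ρ, rfl⟩, fun w hw ↦ ?_⟩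
    obtain ⟨σ, rfl⟩ := (hV w).1 hw
    rw [← map_sub, locMetric_chart g h1, hρ]
  · intro v
    obtain ⟨v, rfl⟩ := hsurj v
    constructor
    · intro h
      obtain ⟨u, rfl⟩ := (H.mem_range_dInc x v).2 fun i ρ ↦ by
        have := h i _ ((hV _).2 ⟨ρ, rfl⟩)
        rwa [locEndo_chart _ h1, locMetric_chart g h1] at this
      exact ⟨toE Ec m x u, by simp [ofE_toE hx]⟩
    · rintro ⟨w, hw⟩ i k hk
      obtain ⟨ρ, rfl⟩ := (hV k).1 hk
      rw [← hw, locEndo_chart _ h1]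
      exact (locMetric_chart g h1 _ _).trans (H.metric_inc_endo x _ i ρ)
  · intro a ha w
    refine (locMetric_chart gQ h2 _ _).trans ((H.riemannian x ?_ _).trans
      (locMetric_chart g h1 _ _).symm)
    intro ρ
    exact (locMetric_chart g h1 _ _).symm.trans (ha _ ((hV _).2 ⟨ρ, rfl⟩))

end IsHyperkahlerQuotient

end Quotient

/-! ### Immersions and submersions in the preferred charts -/

section WrittenInverse

variable {E : Type*} [NormedAddCommGroup E] [NormedSpace ℝ E]
  {M : Type*} [TopologicalSpace M] [ChartedSpace E M] [IsManifold 𝓘(ℝ, E) ∞ M]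
  {E' : Type*} [NormedAddCommGroup E'] [NormedSpace ℝ E']
  {N : Type*} [TopologicalSpace N] [ChartedSpace E' N] [IsManifold 𝓘(ℝ, E') ∞ N]
  {F : N → M} {z : N}

omit [IsManifold 𝓘(ℝ, E) ∞ M] [IsManifold 𝓘(ℝ, E') ∞ N] in
theorem written_self : written E E' F z (F z) (extChartAt 𝓘(ℝ, E') z z) =
    extChartAt 𝓘(ℝ, E) (F z) (F z) := by
  rw [written, extChartAt_to_inv]

omit [IsManifold 𝓘(ℝ, E) ∞ M] [NormedSpace ℝ E] [IsManifold 𝓘(ℝ, E') ∞ N] in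
theorem eventually_mem_source (hF : ContinuousAt F z) :
    ∀ᶠ y in 𝓝 (extChartAt 𝓘(ℝ, E') z z), y ∈ (extChartAt 𝓘(ℝ, E') z).target ∧
      F ((extChartAt 𝓘(ℝ, E') z).symm y) ∈ (chartAt E (F z)).source := by
  have h1 : ContinuousAt (fun y ↦ F ((extChartAt 𝓘(ℝ, E') z).symm y))
      (extChartAt 𝓘(ℝ, E') z z) := by
    refine ContinuousAt.comp ?_ (continuousAt_extChartAt_symm z)
    rwa [extChartAt_to_inv]
  have h2 : (chartAt E (F z)).source ∈
      𝓝 (F ((extChartAt 𝓘(ℝ, E') z).symm (extChartAt 𝓘(ℝ, E') z z))) := by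
    rw [extChartAt_to_inv]
    exact (chartAt E (F z)).open_source.mem_nhds (mem_chart_source E (F z))
  filter_upwards [target_mem_nhds (mem_extChartAt_target z), h1.preimage_mem_nhds h2] with y h3 h4
    using ⟨h3, h4⟩

theorem exists_leftInverse_written (h : Manifold.IsImmersionAt 𝓘(ℝ, E') 𝓘(ℝ, E) ∞ F z) :
    ∃ r : E → E', ContDiffAt ℝ ∞ r (extChartAt 𝓘(ℝ, E) (F z) (F z)) ∧
      ∀ᶠ y in 𝓝 (extChartAt 𝓘(ℝ, E') z z), r (written E E' F z (F z) y) = y := by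
  obtain ⟨r, hr, hrF⟩ := exists_leftInverse_of_isImmersionAt h
  have hrz : r (F z) = z := hrF.self_of_nhds
  refine ⟨written E' E r (F z) z, contDiffAt_written (mem_extChartAt_target _)
    (by rwa [extChartAt_to_inv]) (by
      rw [extChartAt_to_inv, hrz]
      exact mem_chart_source E' z), ?_⟩
  have hc : Tendsto (extChartAt 𝓘(ℝ, E') z).symm (𝓝 (extChartAt 𝓘(ℝ, E') z z)) (𝓝 z) := by
    simpa using! (continuousAt_extChartAt_symm (I := 𝓘(ℝ, E')) z).tendsto
  filter_upwards [eventually_mem_source (E := E) (E' := E') h.continuousAt,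
    hc.eventually hrF] with y hy hy'
  rw [written, written, (extChartAt 𝓘(ℝ, E) (F z)).left_inv (by simpa using hy.2), hy']
  exact (extChartAt 𝓘(ℝ, E') z).right_inv hy.1

theorem fderiv_written_self (hF : MDifferentiableAt 𝓘(ℝ, E') 𝓘(ℝ, E) F z)
    (v : TangentSpace 𝓘(ℝ, E') z) :
    fderiv ℝ (written E E' F z (F z)) (extChartAt 𝓘(ℝ, E') z z) v =
      mfderiv 𝓘(ℝ, E') 𝓘(ℝ, E) F z v := by
  rw [fderiv_written (mem_extChartAt_target z) (by rwa [extChartAt_to_inv])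
    (by rw [extChartAt_to_inv]; exact mem_chart_source E (F z)), extChartAt_to_inv]
  exact (toE_self (E := E) _).trans (congrArg (mfderiv 𝓘(ℝ, E') 𝓘(ℝ, E) F z)
    (ofE_self (E := E') v))

theorem exists_rightInverse_fderiv_written
    (h : Manifold.IsSubmersionAt 𝓘(ℝ, E') 𝓘(ℝ, E) ∞ F z) :
    ∃ s : E →L[ℝ] E', ∀ b,
      fderiv ℝ (written E E' F z (F z)) (extChartAt 𝓘(ℝ, E') z z) (s b) = b := by
  obtain ⟨s, hs, hsz, hFs⟩ := exists_rightInverse_of_isSubmersionAt h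
  have h1 := (h.contMDiffAt.mdifferentiableAt (by simp)).hasMFDerivAt
  have h2 := (hs.mdifferentiableAt (by simp)).hasMFDerivAt
  have h3 := ((hasMFDerivAt_of_eq hsz (h.contMDiffAt.mdifferentiableAt (by simp))).comp (F z)
    h2).congr_of_eventuallyEq (f₁ := id) (hFs.mono fun y hy ↦ hy.symm)
  have h4 := h3.mfderiv.symm.trans mfderiv_id
  refine ⟨mfderiv 𝓘(ℝ, E) 𝓘(ℝ, E') s (F z), fun b ↦ ?_⟩
  exact (fderiv_written_self (h.contMDiffAt.mdifferentiableAt (by simp)) _).trans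
    (DFunLike.congr_fun h4 b)

end WrittenInverse

/-! ### Existence of a smooth local horizontal lift -/

section Quotient

open scoped MultilinearInstances

variable {L : Type*} [NormedAddCommGroup L] [NormedSpace ℝ L]
  {G : Type*} [TopologicalSpace G] [ChartedSpace L G] [Group G]
  {E : Type*} [NormedAddCommGroup E] [NormedSpace ℝ E]
  {M : Type*} [TopologicalSpace M] [ChartedSpace E M] [IsManifold 𝓘(ℝ, E) ∞ M]
  [MulAction G M] [ContMDiffSMul 𝓘(ℝ, L) 𝓘(ℝ, E) ∞ G M]
  {Ec : Type*} [NormedAddCommGroup Ec] [NormedSpace ℝ Ec]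
  {EQ : Type*} [NormedAddCommGroup EQ] [NormedSpace ℝ EQ]
  {g : BilinField E M} {D : Connection E M} {J : Fin 3 → EndoField E M}
  {μ : Fin 3 → M → (L →L[ℝ] ℝ)} {c : Fin 3 → (L →L[ℝ] ℝ)}
  [ChartedSpace Ec (levelSet μ c)] [IsManifold 𝓘(ℝ, Ec) ∞ (levelSet μ c)]
  [ChartedSpace EQ (Quo G μ c)] [IsManifold 𝓘(ℝ, EQ) ∞ (Quo G μ c)]
  {gQ : BilinField EQ (Quo G μ c)}

variable (E Ec) in
/-- The inclusion of the level set in the preferred charts at `m`. -/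
noncomputable abbrev locInc (m : levelSet μ c) : Ec → E :=
  written E Ec (Subtype.val : levelSet μ c → M) m (m : M)

variable (G Ec EQ) in
/-- The projection to the quotient in the preferred charts at `m`. -/
noncomputable abbrev locProj (m : levelSet μ c) : Ec → EQ :=
  written EQ Ec (proj G μ c) m (proj G μ c m)

namespace IsHyperkahlerQuotient

variable (H : IsHyperkahlerQuotient (G := G) Ec g D J μ c gQ) (m : levelSet μ c)

include H

omit [ContMDiffSMul 𝓘(ℝ, L) 𝓘(ℝ, E) ∞ G M] [IsManifold 𝓘(ℝ, Ec) ∞ (levelSet μ c)] in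
theorem eventually_mem_charts : ∀ᶠ y in 𝓝 (extChartAt 𝓘(ℝ, Ec) m m),
    y ∈ (extChartAt 𝓘(ℝ, Ec) m).target ∧
      (((extChartAt 𝓘(ℝ, Ec) m).symm y : levelSet μ c) : M) ∈ (chartAt E (m : M)).source ∧
      proj G μ c ((extChartAt 𝓘(ℝ, Ec) m).symm y) ∈ (chartAt EQ (proj G μ c m)).source := by
  filter_upwards [eventually_mem_source (E := E) (E' := Ec)
      (H.mdifferentiableAt_val m).continuousAt,
    eventually_mem_source (E := EQ) (E' := Ec) (H.mdifferentiableAt_proj m).continuousAt]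
    with y h1 h2 using ⟨h1.1, h1.2, h2.2⟩

theorem eventually_isLinearQuotient : ∀ᶠ y in 𝓝 (extChartAt 𝓘(ℝ, Ec) m m),
    IsLinearQuotient (locMetric g (m : M) (locInc E Ec m y))
      (fun i ↦ locEndo (J i) (m : M) (locInc E Ec m y))
      (locMetric gQ (proj G μ c m) (locProj G Ec EQ m y))
      (fderiv ℝ (locInc E Ec m) y) (fderiv ℝ (locProj G Ec EQ m) y) := by
  filter_upwards [H.eventually_mem_charts m] with y ⟨h1, h2, h3⟩
  rw [locInc, locProj, fderiv_written h1 (H.mdifferentiableAt_val _) h2,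
    fderiv_written h1 (H.mdifferentiableAt_proj _) h3]
  exact H.isLinearQuotient (symm_mem_source h1) h2 h3

omit [ContMDiffSMul 𝓘(ℝ, L) 𝓘(ℝ, E) ∞ G M] in
theorem contDiffAt_locInc :
    ContDiffAt ℝ ∞ (locInc E Ec m) (extChartAt 𝓘(ℝ, Ec) m m) :=
  have h := (H.eventually_mem_charts m).self_of_nhds
  contDiffAt_written h.1 H.level.embedding.contMDiff.contMDiffAt h.2.1

omit [ContMDiffSMul 𝓘(ℝ, L) 𝓘(ℝ, E) ∞ G M] in
theorem contDiffAt_locProj :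
    ContDiffAt ℝ ∞ (locProj G Ec EQ m) (extChartAt 𝓘(ℝ, Ec) m m) :=
  have h := (H.eventually_mem_charts m).self_of_nhds
  contDiffAt_written h.1 H.quotient.submersion.contMDiff.contMDiffAt h.2.2

theorem exists_isLocalQuotient [CompleteSpace E] [CompleteSpace Ec] [CompleteSpace EQ] :
    ∃ h : Ec → EQ →L[ℝ] Ec, ContDiffAt ℝ ∞ h (extChartAt 𝓘(ℝ, Ec) m m) ∧
      IsLocalQuotient (locMetric g (m : M)) (locMetric gQ (proj G μ c m)) (locInc E Ec m)
        (locProj G Ec EQ m) h (extChartAt 𝓘(ℝ, Ec) m m) := by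
  have hm : locInc E Ec m (extChartAt 𝓘(ℝ, Ec) m m) ∈ (extChartAt 𝓘(ℝ, E) (m : M)).target := by
    rw [locInc, written_self]
    exact mem_extChartAt_target _
  have hp : locProj G Ec EQ m (extChartAt 𝓘(ℝ, Ec) m m) ∈
      (extChartAt 𝓘(ℝ, EQ) (proj G μ c m)).target := by
    rw [locProj, written_self]
    exact mem_extChartAt_target _
  have hle : (3 : ℕ∞ω) ≤ (∞ : ℕ∞ω) := WithTop.coe_le_coe.2 le_top
  have cf := H.contDiffAt_locInc m
  have cp := H.contDiffAt_locProj m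
  obtain ⟨r, hr, hrf⟩ := exists_leftInverse_written
    (H.level.embedding.isImmersion.isImmersionAt m)
  obtain ⟨s, hs⟩ := exists_rightInverse_fderiv_written
    (H.quotient.submersion.isSubmersionAt m)
  have hinj : Function.Injective (fderiv ℝ (locInc E Ec m) (extChartAt 𝓘(ℝ, Ec) m m)) := by
    have h1 : DifferentiableAt ℝ r (locInc E Ec m (extChartAt 𝓘(ℝ, Ec) m m)) := by
      rw [locInc, written_self]
      exact hr.differentiableAt (by simp)
    have h2 := (h1.hasFDerivAt.comp _ (cf.differentiableAt (by simp)).hasFDerivAt)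
    have h3 := (h2.congr_of_eventuallyEq (hrf.mono fun y hy ↦ hy.symm)).unique (hasFDerivAt_id _)
    exact Function.LeftInverse.injective fun w ↦ DFunLike.congr_fun h3 w
  obtain ⟨h, h1, h2, h3⟩ := exists_lift (J := fun i ↦ locEndo (J i) (m : M)) cf cp
    (fun i ↦ contDiffAt_locEndo (H.hyperkahler.smooth i) hm) (H.eventually_isLinearQuotient m)
    hinj hs
  refine ⟨h, h1, (contDiffAt_locMetric H.hyperkahler.isWeakMetric hm).of_le hle,
    (contDiffAt_locMetric H.quotient.isWeakMetric hp).of_le hle, cf.of_le hle, cp.of_le hle,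
    h1.of_le hle, ?_, ?_, h2, ?_⟩
  · filter_upwards [target_mem_nhds hm] with y hy
      using locMetric_symm H.hyperkahler.isWeakMetric hy
  · filter_upwards [target_mem_nhds hp] with y hy
      using locMetric_symm H.quotient.isWeakMetric hy
  · filter_upwards [h2, h3, H.eventually_isLinearQuotient m] with y hy2 hy3 hy X w
    rw [← hy.base _ (hy3 X), hy2]

end IsHyperkahlerQuotient

end Quotient

/-! ## The O'Neill tensor of a hyperkähler quotient -/

section Quotient

open scoped MultilinearInstances

variable {L : Type*} [NormedAddCommGroup L] [NormedSpace ℝ L]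
  {G : Type*} [TopologicalSpace G] [ChartedSpace L G] [Group G]
  {E : Type*} [NormedAddCommGroup E] [NormedSpace ℝ E]
  {M : Type*} [TopologicalSpace M] [ChartedSpace E M] [IsManifold 𝓘(ℝ, E) ∞ M]
  [MulAction G M] [ContMDiffSMul 𝓘(ℝ, L) 𝓘(ℝ, E) ∞ G M]
  {Ec : Type*} [NormedAddCommGroup Ec] [NormedSpace ℝ Ec]
  {EQ : Type*} [NormedAddCommGroup EQ] [NormedSpace ℝ EQ]
  {g : BilinField E M} {D : Connection E M} {J : Fin 3 → EndoField E M}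
  {μ : Fin 3 → M → (L →L[ℝ] ℝ)} {c : Fin 3 → (L →L[ℝ] ℝ)}
  [ChartedSpace Ec (levelSet μ c)] [IsManifold 𝓘(ℝ, Ec) ∞ (levelSet μ c)]
  [ChartedSpace EQ (Quo G μ c)] [IsManifold 𝓘(ℝ, EQ) ∞ (Quo G μ c)]
  {gQ : BilinField EQ (Quo G μ c)}

/-- The extension of a horizontal vector by a horizontal vector field, in the chart at `m`, in terms
of a left inverse `r` of the inclusion of the level set. -/
noncomputable def horField (h : Ec → EQ →L[ℝ] Ec) (r : E → Ec) (m : levelSet μ c) (X : EQ)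
    (x : M) : TangentSpace 𝓘(ℝ, E) x :=
  ofE E (m : M) x (lift (locInc E Ec m) h X (r (extChartAt 𝓘(ℝ, E) (m : M) x)))

omit [IsManifold 𝓘(ℝ, Ec) ∞ (levelSet μ c)] in
theorem horField_self {m : levelSet μ c} {h : Ec → EQ →L[ℝ] Ec} {r : E → Ec}
    (hrf : ∀ᶠ y in 𝓝 (extChartAt 𝓘(ℝ, Ec) m m), r (locInc E Ec m y) = y) (X : EQ) :
    horField h r m X (m : M) = lift (locInc E Ec m) h X (extChartAt 𝓘(ℝ, Ec) m m) := by
  have h1 := hrf.self_of_nhds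
  rw [locInc, written_self] at h1
  exact (ofE_self (E := E) _).trans (congrArg (lift (locInc E Ec m) h X) h1)

namespace IsHyperkahlerQuotient

variable (H : IsHyperkahlerQuotient (G := G) Ec g D J μ c gQ) {m : levelSet μ c}
  {h : Ec → EQ →L[ℝ] Ec} {r : E → Ec}

include H

omit [ContMDiffSMul 𝓘(ℝ, L) 𝓘(ℝ, E) ∞ G M] in
theorem contDiffAt_lift (hh : ContDiffAt ℝ ∞ h (extChartAt 𝓘(ℝ, Ec) m m)) (X : EQ) :
    ContDiffAt ℝ ∞ (lift (locInc E Ec m) h X) (extChartAt 𝓘(ℝ, Ec) m m) :=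
  ((H.contDiffAt_locInc m).fderiv_right (m := ∞) (by simp)).clm_apply
    (hh.clm_apply contDiffAt_const)

omit [ContMDiffSMul 𝓘(ℝ, L) 𝓘(ℝ, E) ∞ G M] in
theorem smoothFieldAt_horField (hh : ContDiffAt ℝ ∞ h (extChartAt 𝓘(ℝ, Ec) m m))
    (hr : ContDiffAt ℝ ∞ r (extChartAt 𝓘(ℝ, E) (m : M) (m : M)))
    (hrf : ∀ᶠ y in 𝓝 (extChartAt 𝓘(ℝ, Ec) m m), r (locInc E Ec m y) = y) (X : EQ) :
    SmoothFieldAt (horField h r m X) (m : M) := by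
  have h1 := hrf.self_of_nhds
  rw [locInc, written_self] at h1
  refine smoothFieldAt_ofE (s := fun y ↦ lift (locInc E Ec m) h X (r y)) (mem_chart_source E _) ?_
  have h2 : ContDiffAt ℝ ∞ (lift (locInc E Ec m) h X)
      (r (extChartAt 𝓘(ℝ, E) (m : M) (m : M))) := by
    rw [h1]
    exact H.contDiffAt_lift hh X
  exact h2.comp _ hr

/-- On the level set `r` inverts the inclusion, so the field is the lift itself there: tangency
gives orthogonality to the `J i` directions, horizontality to the orbit. -/
theorem eventually_horField
    (HL : IsLocalQuotient (locMetric g (m : M)) (locMetric gQ (proj G μ c m)) (locInc E Ec m)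
        (locProj G Ec EQ m) h (extChartAt 𝓘(ℝ, Ec) m m))
    (hrf : ∀ᶠ y in 𝓝 (extChartAt 𝓘(ℝ, Ec) m m), r (locInc E Ec m y) = y) (X : EQ) :
    ∀ᶠ x in 𝓝[levelSet μ c] (m : M), IsQuatHorizontal L G g J (horField h r m X x) := by
  have key : ∀ᶠ y in 𝓝 (extChartAt 𝓘(ℝ, Ec) m m), IsQuatHorizontal L G g J
      (horField h r m X (((extChartAt 𝓘(ℝ, Ec) m).symm y : levelSet μ c) : M)) := by
    filter_upwards [H.eventually_mem_charts m, hrf, HL.metric_lift] with y ⟨h1, h2, h3⟩ hy hl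
    have hx := symm_mem_source h1
    have e1 := fderiv_written (F := (Subtype.val : levelSet μ c → M)) h1
      (H.mdifferentiableAt_val _) h2
    have e2 := fderiv_written (F := proj G μ c) h1 (H.mdifferentiableAt_proj _) h3
    have e3 : horField h r m X (((extChartAt 𝓘(ℝ, Ec) m).symm y : levelSet μ c) : M) =
        dInc E Ec _ (ofE Ec m _ (h y X)) := by
      change ofE E (m : M) _ (lift (locInc E Ec m) h X (r (locInc E Ec m y))) = _
      rw [hy, lift, locInc, e1]
      exact ofE_toE h2 _
    rw [e3]
    refine ⟨fun ρ ↦ ?_, fun i ρ ↦ H.metric_inc_endo _ _ i ρ⟩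
    obtain ⟨u, hu, hu'⟩ := H.exists_vertical ((extChartAt 𝓘(ℝ, Ec) m).symm y) ρ
    have h4 := hl X (toE Ec m _ u)
    rw [locInc, locProj, e1, e2] at h4
    simp only [ContinuousLinearMap.comp_apply, ofE_toE hx, hu', hu, map_zero] at h4
    exact (locMetric_chart g h2 _ _).symm.trans h4
  have h1 : ∀ᶠ x : levelSet μ c in 𝓝 m, IsQuatHorizontal L G g J (horField h r m X (x : M)) := by
    filter_upwards [(continuousAt_extChartAt (I := 𝓘(ℝ, Ec)) m).eventually key,
      extChartAt_source_mem_nhds (I := 𝓘(ℝ, Ec)) m] with x hx hx'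
    rwa [(extChartAt 𝓘(ℝ, Ec) m).left_inv hx'] at hx
  rw [nhdsWithin_eq_map_subtype_coe m.2]
  exact h1

omit [ContMDiffSMul 𝓘(ℝ, L) 𝓘(ℝ, E) ∞ G M] in
-- Since `r` is a left inverse of the inclusion, the chain rule turns the derivative of the
-- extension into the derivative of the lift along the level set.
theorem connection_horField (hh : ContDiffAt ℝ ∞ h (extChartAt 𝓘(ℝ, Ec) m m))
    (hr : ContDiffAt ℝ ∞ r (extChartAt 𝓘(ℝ, E) (m : M) (m : M)))
    (hrf : ∀ᶠ y in 𝓝 (extChartAt 𝓘(ℝ, Ec) m m), r (locInc E Ec m y) = y) (X Y : EQ) :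
    D (horField h r m Y) (m : M) (lift (E := E) (locInc E Ec m) h X (extChartAt 𝓘(ℝ, Ec) m m)) =
      nab (locInc E Ec m) h (locChr D (m : M) (extChartAt 𝓘(ℝ, E) (m : M) (m : M)))
        (extChartAt 𝓘(ℝ, Ec) m m) X Y := by
  have h1 := hrf.self_of_nhds
  have hm : locInc E Ec m (extChartAt 𝓘(ℝ, Ec) m m) = extChartAt 𝓘(ℝ, E) (m : M) (m : M) :=
    written_self
  refine (H.hyperkahler.isLeviCivita.apply_self H.hyperkahler.isWeakMetric
    (H.smoothFieldAt_horField hh hr hrf Y).diffFieldAt _).trans ?_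
  refine (ofE_self (E := E) _).trans ?_
  have e1 : (fun y ↦ toE E (m : M) _
      (horField h r m Y ((extChartAt 𝓘(ℝ, E) (m : M)).symm y))) =ᶠ[
        𝓝 (extChartAt 𝓘(ℝ, E) (m : M) (m : M))] fun y ↦ lift (locInc E Ec m) h Y (r y) := by
    filter_upwards [target_mem_nhds (mem_extChartAt_target (I := 𝓘(ℝ, E)) (m : M))] with y hy
    rw [horField, toE_ofE (symm_mem_source hy), (extChartAt 𝓘(ℝ, E) (m : M)).right_inv hy]
  rw [e1.fderiv_eq, nab]
  have e2 : toE E (m : M) (m : M) (lift (E := E) (locInc E Ec m) h X (extChartAt 𝓘(ℝ, Ec) m m)) =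
      lift (locInc E Ec m) h X (extChartAt 𝓘(ℝ, Ec) m m) := toE_self (E := E) _
  have e3 : toE E (m : M) (m : M) (horField h r m Y (m : M)) =
      lift (locInc E Ec m) h Y (extChartAt 𝓘(ℝ, Ec) m m) :=
    (toE_self (E := E) _).trans (horField_self hrf Y)
  rw [e2, e3]
  congr 1
  have d1 : DifferentiableAt ℝ (fun y ↦ lift (locInc E Ec m) h Y (r y))
      (locInc E Ec m (extChartAt 𝓘(ℝ, Ec) m m)) := by
    have d0 : DifferentiableAt ℝ (lift (locInc E Ec m) h Y)
        (r (locInc E Ec m (extChartAt 𝓘(ℝ, Ec) m m))) := by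
      rw [h1]
      exact (H.contDiffAt_lift hh Y).differentiableAt (by simp)
    have dr : DifferentiableAt ℝ r (locInc E Ec m (extChartAt 𝓘(ℝ, Ec) m m)) := by
      rw [hm]
      exact hr.differentiableAt (by simp)
    exact d0.comp _ dr
  have d2 := d1.hasFDerivAt.comp _
    ((H.contDiffAt_locInc m).differentiableAt (by simp)).hasFDerivAt
  have e4 : (fun y ↦ lift (locInc E Ec m) h Y (r y)) ∘ locInc E Ec m =ᶠ[
      𝓝 (extChartAt 𝓘(ℝ, Ec) m m)] lift (locInc E Ec m) h Y :=
    hrf.mono fun y hy ↦ by simp only [Function.comp_apply, hy]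
  rw [← e4.fderiv_eq, d2.fderiv, hm]
  rfl

omit [ContMDiffSMul 𝓘(ℝ, L) 𝓘(ℝ, E) ∞ G M] [IsManifold 𝓘(ℝ, Ec) ∞ (levelSet μ c)] in
theorem isHorizontal_endo {x : M} {v : TangentSpace 𝓘(ℝ, E) x}
    (hv : IsQuatHorizontal L G g J v) (i : Fin 3) : IsHorizontal L G g (J i x v) := fun ρ ↦ by
  have h1 := H.hyperkahler.isometry i x v (J i x (fund L G E x ρ))
  rw [hv.2 i ρ, H.hyperkahler.square, map_neg, neg_eq_zero] at h1
  exact h1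

omit [ContMDiffSMul 𝓘(ℝ, L) 𝓘(ℝ, E) ∞ G M] [IsManifold 𝓘(ℝ, Ec) ∞ (levelSet μ c)] in
theorem isQuatHorizontal_endo {x : M} {v : TangentSpace 𝓘(ℝ, E) x}
    (hv : IsQuatHorizontal L G g J v) (i : Fin 3) : IsQuatHorizontal L G g J (J i x v) := by
  refine ⟨H.isHorizontal_endo hv i, fun j ρ ↦ ?_⟩
  rcases eq_or_ne i j with rfl | hij
  · rw [H.hyperkahler.isometry, hv.1]
  · obtain ⟨k, ε, hk⟩ := exists_mul_eq_smul (J := fun i ↦ J i x) (fun i v ↦ map_neg (J i x) v)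
      (fun i ↦ H.hyperkahler.square i x) (fun i j h ↦ H.hyperkahler.anticomm i j h x)
      (H.hyperkahler.triple x) hij
    have h1 := H.hyperkahler.isometry i x v (J i x (J j x (fund L G E x ρ)))
    rw [H.hyperkahler.square, map_neg, hk, map_smul, hv.2 k ρ, smul_zero, neg_eq_zero] at h1
    exact h1

omit [ContMDiffSMul 𝓘(ℝ, L) 𝓘(ℝ, E) ∞ G M] [IsManifold 𝓘(ℝ, Ec) ∞ (levelSet μ c)] in
theorem smoothFieldAt_endo {Y : (x : M) → TangentSpace 𝓘(ℝ, E) x} {x : M}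
    (hY : SmoothFieldAt Y x) (i : Fin 3) : SmoothFieldAt (fun x ↦ J i x (Y x)) x :=
  ((H.hyperkahler.smooth i) x).clm_bundle_apply hY

/-- Here the parallel complex structures enter: `J i` applied to a horizontal extension of `Y` is
again horizontal along the level set and extends `J i Y`. The orbit part of `J i (∇_X Y)` is
therefore `A(X, J i Y)`. -/
theorem isONeill_lift (hh : ContDiffAt ℝ ∞ h (extChartAt 𝓘(ℝ, Ec) m m))
    (HL : IsLocalQuotient (locMetric g (m : M)) (locMetric gQ (proj G μ c m)) (locInc E Ec m)
        (locProj G Ec EQ m) h (extChartAt 𝓘(ℝ, Ec) m m))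
    {X Y : EQ} {N Z : TangentSpace 𝓘(ℝ, E) (m : M)}
    (hN : N = nab (locInc E Ec m) h (locChr D (m : M) (extChartAt 𝓘(ℝ, E) (m : M) (m : M)))
        (extChartAt 𝓘(ℝ, Ec) m m) X Y) (hZ : ∃ ρ, fund L G E (m : M) ρ = Z) :
    (IsHorizontal L G g (N - Z) → IsONeill L G g D (levelSet μ c) (m : M)
      (lift (E := E) (locInc E Ec m) h X (extChartAt 𝓘(ℝ, Ec) m m))
      (lift (E := E) (locInc E Ec m) h Y (extChartAt 𝓘(ℝ, Ec) m m)) Z) ∧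
    ∀ i, IsHorizontal L G g (J i m N - Z) → IsONeill L G g D (levelSet μ c) (m : M)
      (lift (E := E) (locInc E Ec m) h X (extChartAt 𝓘(ℝ, Ec) m m))
      (J i m (lift (E := E) (locInc E Ec m) h Y (extChartAt 𝓘(ℝ, Ec) m m))) Z := by
  obtain ⟨r, hr, hrf⟩ := exists_leftInverse_written
    (H.level.embedding.isImmersion.isImmersionAt m)
  have hs := H.smoothFieldAt_horField hh hr hrf Y
  have hc := (H.connection_horField hh hr hrf X Y).trans hN.symm
  have he := H.eventually_horField HL hrf Y
  have h0 := horField_self (h := h) hrf Y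
  refine ⟨fun hz ↦ ⟨_, hs, h0, he.mono fun x hx ↦ hx.1, hZ, ?_⟩, fun i hz ↦
    ⟨fun x ↦ J i x (horField h r m Y x), H.smoothFieldAt_endo hs i, congrArg (J i m) h0,
      he.mono fun x hx ↦ H.isHorizontal_endo hx i, hZ, ?_⟩⟩
  · rw [hc]
    exact hz
  · have hp := (H.hyperkahler.parallel i _ _ _ hs.diffFieldAt).trans (congrArg (J i m) hc)
    exact (congrArg (fun w : TangentSpace 𝓘(ℝ, E) (m : M) ↦ IsHorizontal L G g (w - Z)) hp).mpr hz

omit [ContMDiffSMul 𝓘(ℝ, L) 𝓘(ℝ, E) ∞ G M] [IsManifold 𝓘(ℝ, Ec) ∞ (levelSet μ c)] in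
theorem metric_le_of_isONeill (hV : oneillNorm L G g D J (levelSet μ c) (m : M) ≠ ⊤)
    {X Y Z : TangentSpace 𝓘(ℝ, E) (m : M)} (hX : IsQuatHorizontal L G g J X) (hX0 : X ≠ 0)
    (hY : IsQuatHorizontal L G g J Y) (hY0 : Y ≠ 0)
    (hZ : IsONeill L G g D (levelSet μ c) (m : M) X Y Z) :
    g m Z Z ≤ (oneillNorm L G g D J (levelSet μ c) (m : M)).toReal ^ 2 * (g m X X * g m Y Y) := by
  have hpos := H.hyperkahler.isWeakMetric.pos (m : M)
  have h1 : ENNReal.ofReal (len g Z / (len g X * len g Y)) ≤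
      oneillNorm L G g D J (levelSet μ c) (m : M) :=
    le_iSup_of_le X (le_iSup_of_le Y (le_iSup_of_le Z (le_iSup_of_le ⟨hX, hX0⟩
      (le_iSup_of_le ⟨hY, hY0⟩ (le_iSup_of_le hZ le_rfl)))))
  have hl : 0 < len g X * len g Y :=
    mul_pos (Real.sqrt_pos.2 (hpos _ hX0)) (Real.sqrt_pos.2 (hpos _ hY0))
  rw [ENNReal.ofReal_le_iff_le_toReal hV, div_le_iff₀ hl] at h1
  have hZ0 : 0 ≤ g m Z Z := by
    rcases eq_or_ne Z 0 with rfl | h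
    · simp
    · exact (hpos _ h).le
  calc g m Z Z = len g Z ^ 2 := (Real.sq_sqrt hZ0).symm
    _ ≤ ((oneillNorm L G g D J (levelSet μ c) (m : M)).toReal * (len g X * len g Y)) ^ 2 :=
      pow_le_pow_left₀ (Real.sqrt_nonneg _) h1 2
    _ = _ := by
      rw [mul_pow, mul_pow, len, len, Real.sq_sqrt (hpos _ hX0).le, Real.sq_sqrt (hpos _ hY0).le]

end IsHyperkahlerQuotient

end Quotient

/-! ## Sectional curvature -/

section Sectional

open scoped MultilinearInstances

variable {E : Type*} [NormedAddCommGroup E] [NormedSpace ℝ E]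

/-- The expression of the sectional curvature in terms of Christoffel symbols. -/
noncomputable def secCurv (g : E → E →L[ℝ] E →L[ℝ] ℝ) (y : E) (Γ : E → E → E) (a b : E) : ℝ :=
  curvLow g y Γ a b b a / (g y a a * g y b b - g y a b ^ 2)

theorem IsLeviCivita.sectionalCurvature_eq [CompleteSpace E] {M : Type*} [TopologicalSpace M]
    [ChartedSpace E M] [IsManifold 𝓘(ℝ, E) ∞ M] {g : BilinField E M} {D : Connection E M}
    (hD : IsLeviCivita g D) (hg : IsWeakMetric g) {z : M} (a b : TangentSpace 𝓘(ℝ, E) z) :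
    sectionalCurvature g D a b = secCurv (locMetric g z) (extChartAt 𝓘(ℝ, E) z z)
      (locChr D z (extChartAt 𝓘(ℝ, E) z z)) a b := by
  rw [sectionalCurvature, hD.curvature_eq hg, metric_eq_locMetric, metric_eq_locMetric,
    metric_eq_locMetric]
  rfl

/-- For this `t`, `b - t • a` is orthogonal to `a` and the Gram determinant becomes a product. -/
theorem secCurv_eq_div {g : E → E →L[ℝ] E →L[ℝ] ℝ} {y : E} {Γ : E → E → E}
    (hg : ContDiffAt ℝ 2 g y) (hs : ∀ v w, g y v w = g y w v)
    (hΓ : ∀ v w z, g y (Γ v w) z = chr g y v w z) {a b : E} {t : ℝ}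
    (ha : g y a a ≠ 0) (ht : t = g y a b / g y a a) :
    secCurv g y Γ a b = curvLow g y Γ a (b - t • a) (b - t • a) a /
      (g y a a * g y (b - t • a) (b - t • a)) := by
  rw [secCurv, curvLow_sub_smul hg hs hΓ]
  congr 1
  simp only [map_sub, map_smul, sub_apply, smul_apply, smul_eq_mul, hs b a, ht]
  field_simp
  ring

end Sectional

/-! ### The sectional curvature estimate on the quotient -/

section Quotient

open scoped MultilinearInstances

section Local

variable {E : Type*} [NormedAddCommGroup E] [NormedSpace ℝ E]
  {W : Type*} [NormedAddCommGroup W] [NormedSpace ℝ W]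
  {B : Type*} [NormedAddCommGroup B] [NormedSpace ℝ B]
  {g : E → E →L[ℝ] E →L[ℝ] ℝ} {q : B → B →L[ℝ] B →L[ℝ] ℝ}
  {f : W → E} {p : W → B} {h : W → B →L[ℝ] W} {x : W} {Γ : E → E → E} {ΓB : B → B → B}

/-- Lifting is linear and preserves scalar products, so the same `t` orthogonalizes the plane in the
base and its lift, with equal denominators. -/
theorem IsLocalQuotient.abs_secCurv_sub_le (H : IsLocalQuotient g q f p h x)
    (hΓ : ∀ v w z, g (f x) (Γ v w) z = chr g (f x) v w z)
    (hΓB : ∀ v w z, q (p x) (ΓB v w) z = chr q (p x) v w z)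
    (hqpos : ∀ v, v ≠ 0 → 0 < q (p x) v v) {C : ℝ}
    (hC : ∀ X Y : B, X ≠ 0 → Y ≠ 0 → |curvLow q (p x) ΓB X Y Y X -
      curvLow g (f x) Γ (lift f h X x) (lift f h Y x) (lift f h Y x) (lift f h X x)| ≤
      9 * (C * (q (p x) X X * q (p x) Y Y))) {u v : B} (huv : LinearIndependent ℝ ![u, v]) :
    |secCurv q (p x) ΓB u v - secCurv g (f x) Γ (lift f h u x) (lift f h v x)| ≤ 9 * C := by
  have hu : u ≠ 0 := huv.ne_zero 0
  have hquu := hqpos u hu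
  set t := q (p x) u v / q (p x) u u with ht
  have hw : v - t • u ≠ 0 := fun h0 ↦ by
    have := LinearIndependent.pair_iff.1 huv (-t) 1 (by rw [← h0]; module)
    exact one_ne_zero this.2
  have hqww := hqpos _ hw
  have hl : lift f h v x - t • lift f h u x = lift f h (v - t • u) x := by
    simp only [lift, map_sub, map_smul]
  rw [secCurv_eq_div (H.contDiff_base.of_le (by norm_num)) H.symm_base.self_of_nhds hΓB hquu.ne' ht,
    secCurv_eq_div (H.contDiff_metric.of_le (by norm_num)) H.symm_metric.self_of_nhds hΓ
      (t := t) (by rw [H.metric_lift_lift]; exact hquu.ne')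
      (by rw [H.metric_lift_lift, H.metric_lift_lift]), hl, H.metric_lift_lift, H.metric_lift_lift,
    ← sub_div, abs_div, abs_of_pos (mul_pos hquu hqww), div_le_iff₀ (mul_pos hquu hqww), mul_assoc]
  exact hC u _ hu hw

end Local

variable {L : Type*} [NormedAddCommGroup L] [NormedSpace ℝ L]
  {G : Type*} [TopologicalSpace G] [ChartedSpace L G] [Group G]
  {E : Type*} [NormedAddCommGroup E] [NormedSpace ℝ E]
  {M : Type*} [TopologicalSpace M] [ChartedSpace E M] [IsManifold 𝓘(ℝ, E) ∞ M]
  [MulAction G M] [ContMDiffSMul 𝓘(ℝ, L) 𝓘(ℝ, E) ∞ G M]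
  {Ec : Type*} [NormedAddCommGroup Ec] [NormedSpace ℝ Ec]
  {EQ : Type*} [NormedAddCommGroup EQ] [NormedSpace ℝ EQ]
  {g : BilinField E M} {D : Connection E M} {J : Fin 3 → EndoField E M}
  {μ : Fin 3 → M → (L →L[ℝ] ℝ)} {c : Fin 3 → (L →L[ℝ] ℝ)}
  [ChartedSpace Ec (levelSet μ c)] [IsManifold 𝓘(ℝ, Ec) ∞ (levelSet μ c)]
  [ChartedSpace EQ (Quo G μ c)] [IsManifold 𝓘(ℝ, EQ) ∞ (Quo G μ c)]
  {gQ : BilinField EQ (Quo G μ c)} {DQ : Connection EQ (Quo G μ c)}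

namespace IsHyperkahlerQuotient

variable (H : IsHyperkahlerQuotient (G := G) Ec g D J μ c gQ) {m : levelSet μ c}
  {h : Ec → EQ →L[ℝ] Ec}

include H

theorem mem_vert_self {v : TangentSpace 𝓘(ℝ, E) (m : M)} :
    (v : E) ∈ vert (fderiv ℝ (locInc E Ec m) (extChartAt 𝓘(ℝ, Ec) m m))
      (fderiv ℝ (locProj G Ec EQ m) (extChartAt 𝓘(ℝ, Ec) m m)) ↔
      ∃ ρ, fund L G E (m : M) ρ = v := by
  rw [← H.mem_range_fund]
  refine (mem_vert (E := E)).trans (exists_congr fun k ↦ ?_)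
  have e1 := fderiv_written_self (H.mdifferentiableAt_val m) k
  have e2 := fderiv_written_self (H.mdifferentiableAt_proj m) k
  exact and_congr (Eq.congr_left e2) (Eq.congr_left e1)

omit [ContMDiffSMul 𝓘(ℝ, L) 𝓘(ℝ, E) ∞ G M] in
theorem lift_eq (X : EQ) : lift (E := E) (locInc E Ec m) h X (extChartAt 𝓘(ℝ, Ec) m m) =
    dInc E Ec m (h (extChartAt 𝓘(ℝ, Ec) m m) X) :=
  fderiv_written_self (H.mdifferentiableAt_val m) _

theorem isHorizontal_of_vert {v : TangentSpace 𝓘(ℝ, E) (m : M)}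
    (hv : ∀ w ∈ vert (fderiv ℝ (locInc E Ec m) (extChartAt 𝓘(ℝ, Ec) m m))
      (fderiv ℝ (locProj G Ec EQ m) (extChartAt 𝓘(ℝ, Ec) m m)),
      locMetric g (m : M) (locInc E Ec m (extChartAt 𝓘(ℝ, Ec) m m)) v w = 0) :
    IsHorizontal L G g v := fun ρ ↦ by
  have h1 := hv _ (H.mem_vert_self.2 ⟨ρ, rfl⟩)
  rw [locInc, written_self] at h1
  exact (metric_eq_locMetric g _ _).trans h1

theorem isQuatHorizontal_lift
    (HL : IsLocalQuotient (locMetric g (m : M)) (locMetric gQ (proj G μ c m)) (locInc E Ec m)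
        (locProj G Ec EQ m) h (extChartAt 𝓘(ℝ, Ec) m m)) (X : EQ) :
    IsQuatHorizontal L G g J (m := (m : M))
      (lift (E := E) (locInc E Ec m) h X (extChartAt 𝓘(ℝ, Ec) m m)) := by
  refine ⟨H.isHorizontal_of_vert fun w hw ↦ ?_, fun i ρ ↦ ?_⟩
  · obtain ⟨k, hk, rfl⟩ := mem_vert.1 hw
    exact HL.metric_lift_vertical X hk
  · exact (congrArg (fun w : TangentSpace 𝓘(ℝ, E) (m : M) ↦ g m w _) (H.lift_eq X)).trans
      (H.metric_inc_endo m _ i ρ)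

/-- Two horizontal vectors with the same projection differ by a vector that is horizontal and
vertical. -/
theorem lift_eq_of_proj_eq
    (HL : IsLocalQuotient (locMetric g (m : M)) (locMetric gQ (proj G μ c m)) (locInc E Ec m)
        (locProj G Ec EQ m) h (extChartAt 𝓘(ℝ, Ec) m m)) {X : EQ} {u : TangentSpace 𝓘(ℝ, Ec) m}
    (hX : dProj G Ec EQ m u = X) (hu : IsHorizontal L G g (dInc E Ec m u)) :
    dInc E Ec m u = lift (E := E) (locInc E Ec m) h X (extChartAt 𝓘(ℝ, Ec) m m) := by
  have h1 : dProj G Ec EQ m (h (extChartAt 𝓘(ℝ, Ec) m m) X) = X :=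
    (fderiv_written_self (H.mdifferentiableAt_proj m) _).symm.trans (HL.proj_lift.self_of_nhds X)
  let k : TangentSpace 𝓘(ℝ, Ec) m := h (extChartAt 𝓘(ℝ, Ec) m m) X
  have h2 : dInc E Ec m (u - k) = 0 := by
    refine H.dInc_eq_zero m ?_ fun ρ ↦ ?_
    · rw [map_sub]
      exact sub_eq_zero.2 (hX.trans h1.symm)
    · have h3 := (H.isQuatHorizontal_lift HL X).1 ρ
      have h4 : g m (dInc E Ec m k) (fund L G E (m : M) ρ) = 0 :=
        (congrArg (fun w : TangentSpace 𝓘(ℝ, E) (m : M) ↦ g m w _) (H.lift_eq X)).symm.trans h3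
      rw [map_sub, map_sub, sub_apply, hu ρ, h4, sub_zero]
  rw [map_sub, sub_eq_zero] at h2
  exact h2.trans (H.lift_eq X).symm

variable [CompleteSpace E] [CompleteSpace EQ]

theorem abs_secCurv_sub_le (hDQ : IsLeviCivita gQ DQ)
    (hh : ContDiffAt ℝ ∞ h (extChartAt 𝓘(ℝ, Ec) m m))
    (HL : IsLocalQuotient (locMetric g (m : M)) (locMetric gQ (proj G μ c m)) (locInc E Ec m)
        (locProj G Ec EQ m) h (extChartAt 𝓘(ℝ, Ec) m m))
    (hV : oneillNorm L G g D J (levelSet μ c) (m : M) ≠ ⊤) {u v : EQ}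
    (huv : LinearIndependent ℝ ![u, v]) :
    |secCurv (locMetric gQ (proj G μ c m)) (locProj G Ec EQ m (extChartAt 𝓘(ℝ, Ec) m m))
        (locChr DQ (proj G μ c m) (extChartAt 𝓘(ℝ, EQ) (proj G μ c m) (proj G μ c m))) u v -
      secCurv (locMetric g (m : M)) (locInc E Ec m (extChartAt 𝓘(ℝ, Ec) m m))
        (locChr D (m : M) (extChartAt 𝓘(ℝ, E) (m : M) (m : M)))
        (lift (locInc E Ec m) h u (extChartAt 𝓘(ℝ, Ec) m m))
        (lift (locInc E Ec m) h v (extChartAt 𝓘(ℝ, Ec) m m))| ≤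
      9 * (oneillNorm L G g D J (levelSet μ c) (m : M)).toReal ^ 2 := by
  have e1 : locInc E Ec m (extChartAt 𝓘(ℝ, Ec) m m) = extChartAt 𝓘(ℝ, E) (m : M) (m : M) :=
    written_self
  have e2 : locProj G Ec EQ m (extChartAt 𝓘(ℝ, Ec) m m) =
      extChartAt 𝓘(ℝ, EQ) (proj G μ c m) (proj G μ c m) := written_self
  have hΓ : ∀ v w z, locMetric g (m : M) (locInc E Ec m (extChartAt 𝓘(ℝ, Ec) m m))
      (locChr D (m : M) (extChartAt 𝓘(ℝ, E) (m : M) (m : M)) v w) z =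
      chr (locMetric g (m : M)) (locInc E Ec m (extChartAt 𝓘(ℝ, Ec) m m)) v w z := by
    rw [e1]
    exact H.hyperkahler.isLeviCivita.locMetric_locChr H.hyperkahler.isWeakMetric
      (mem_extChartAt_target _)
  have hΓB : ∀ v w z, locMetric gQ (proj G μ c m) (locProj G Ec EQ m (extChartAt 𝓘(ℝ, Ec) m m))
      (locChr DQ (proj G μ c m) (extChartAt 𝓘(ℝ, EQ) (proj G μ c m) (proj G μ c m)) v w) z =
      chr (locMetric gQ (proj G μ c m)) (locProj G Ec EQ m (extChartAt 𝓘(ℝ, Ec) m m)) v w z := by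
    rw [e2]
    exact hDQ.locMetric_locChr H.quotient.isWeakMetric (mem_extChartAt_target _)
  have hpos : ∀ X : EQ, X ≠ 0 → 0 <
      locMetric gQ (proj G μ c m) (locProj G Ec EQ m (extChartAt 𝓘(ℝ, Ec) m m)) X X := by
    rw [e2]
    exact fun X hX ↦ locMetric_pos H.quotient.isWeakMetric (mem_extChartAt_target _) hX
  have HQ := (H.eventually_isLinearQuotient m).self_of_nhds
  let l (X : EQ) : TangentSpace 𝓘(ℝ, E) (m : M) :=
    lift (E := E) (locInc E Ec m) h X (extChartAt 𝓘(ℝ, Ec) m m)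
  have hl (X : EQ) : g m (l X) (l X) =
      locMetric gQ (proj G μ c m) (locProj G Ec EQ m (extChartAt 𝓘(ℝ, Ec) m m)) X X := by
    refine (metric_eq_locMetric g _ _).trans ?_
    rw [← e1]
    exact HL.metric_lift_lift X X
  have hl0 {X : EQ} (hX : X ≠ 0) : l X ≠ 0 := fun h0 ↦ by
    have h1 := hpos X hX
    rw [← hl, h0, map_zero] at h1
    exact h1.false
  have hlq (X : EQ) : IsQuatHorizontal L G g J (l X) := H.isQuatHorizontal_lift HL X
  have hJ0 {v : TangentSpace 𝓘(ℝ, E) (m : M)} (hv : v ≠ 0) (i : Fin 3) : J i m v ≠ 0 := fun h0 ↦ by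
    have h1 := H.hyperkahler.square i m v
    rw [h0, map_zero, zero_eq_neg] at h1
    exact hv h1
  have hz {z : TangentSpace 𝓘(ℝ, E) (m : M)} :
      locMetric g (m : M) (locInc E Ec m (extChartAt 𝓘(ℝ, Ec) m m)) z z = g m z z := by
    rw [e1]
    exact locMetric_self g z z
  refine HL.abs_secCurv_sub_le hΓ hΓB hpos (fun X Y hX hY ↦ HL.abs_curvLow_sub_le hΓ hΓB hpos
    HQ.split (fun _ ↦ mem_vert) HQ.tangent (sq_nonneg _) (fun X Y hX hY z hzV hzN ↦ ?_)
    (fun i X Y hX hY (z : TangentSpace 𝓘(ℝ, E) (m : M)) hzV hzN ↦ ?_) hX hY) huv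
  · have h1 := (H.isONeill_lift (X := X) (Y := Y) (Z := z) hh HL rfl (H.mem_vert_self.1 hzV)).1
      (H.isHorizontal_of_vert hzN)
    have h2 := H.metric_le_of_isONeill hV (hlq X) (hl0 hX) (hlq Y) (hl0 hY) h1
    rw [hl, hl] at h2
    exact hz.trans_le h2
  · have h0 : IsHorizontal L G g (m := (m : M)) (J i m (nab (E := E) (locInc E Ec m) h
        (locChr D (m : M) (extChartAt 𝓘(ℝ, E) (m : M) (m : M)))
        (extChartAt 𝓘(ℝ, Ec) m m) X Y) - z) := by
      refine H.isHorizontal_of_vert fun w hw ↦ ?_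
      refine Eq.trans ?_ (hzN w hw)
      rw [e1]
      exact congrArg (fun a : TangentSpace 𝓘(ℝ, E) (m : M) ↦ locMetric g (m : M) _ (a - z) w) (locEndo_self (J i) _).symm
    have h1 := (H.isONeill_lift (X := X) (Y := Y) (Z := z) hh HL rfl (H.mem_vert_self.1 hzV)).2 i h0
    -- `J i` preserves quaternionic horizontality and length, so `A(X, J i Y)` obeys the same bound
    -- as `A(X, Y)`.
    have h2 := H.metric_le_of_isONeill hV (hlq X) (hl0 hX) (H.isQuatHorizontal_endo (hlq Y) i)
      (hJ0 (hl0 hY) i) h1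
    rw [H.hyperkahler.isometry, hl, hl] at h2
    exact hz.trans_le h2

theorem ofReal_abs_sectionalCurvature_sub_le [CompleteSpace Ec] (hDQ : IsLeviCivita gQ DQ)
    {u v : TangentSpace 𝓘(ℝ, EQ) (proj G μ c m)} (huv : LinearIndependent ℝ ![u, v])
    {u' v' : TangentSpace 𝓘(ℝ, Ec) m} (hu : dProj G Ec EQ m u' = u) (hv : dProj G Ec EQ m v' = v)
    (hu' : IsHorizontal L G g (dInc E Ec m u')) (hv' : IsHorizontal L G g (dInc E Ec m v')) :
    ENNReal.ofReal |sectionalCurvature gQ DQ u v -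
        sectionalCurvature g D (dInc E Ec m u') (dInc E Ec m v')| ≤
      9 * oneillNorm L G g D J (levelSet μ c) (m : M) ^ 2 := by
  -- For an infinite norm the right-hand side is infinite; otherwise the estimate is one between
  -- real numbers.
  by_cases hV : oneillNorm L G g D J (levelSet μ c) (m : M) = ⊤
  · simp [hV]
  obtain ⟨h, hh, HL⟩ := H.exists_isLocalQuotient m
  have h1 := H.abs_secCurv_sub_le hDQ hh HL hV (u := u) (v := v) huv
  rw [locInc, locProj, written_self, written_self] at h1
  rw [hDQ.sectionalCurvature_eq H.quotient.isWeakMetric,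
    H.hyperkahler.isLeviCivita.sectionalCurvature_eq H.hyperkahler.isWeakMetric,
    H.lift_eq_of_proj_eq HL hu hu', H.lift_eq_of_proj_eq HL hv hv']
  refine (ENNReal.ofReal_le_ofReal h1).trans_eq ?_
  rw [ENNReal.ofReal_mul (by norm_num), ENNReal.ofReal_pow ENNReal.toReal_nonneg,
    ENNReal.ofReal_toReal hV]
  norm_num

end IsHyperkahlerQuotient

end Quotient

end HKQuot

theorem mainTheorem1
    -- the Banach Lie group `G`, with Lie algebra `L`
    {L : Type*} [NormedAddCommGroup L] [NormedSpace ℝ L] [CompleteSpace L]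
    {G : Type*} [TopologicalSpace G] [ChartedSpace L G] [Group G] [LieGroup 𝓘(ℝ, L) ∞ G]
    -- the Banach manifold `M`
    {E : Type*} [NormedAddCommGroup E] [NormedSpace ℝ E] [CompleteSpace E]
    {M : Type*} [TopologicalSpace M] [T2Space M] [ChartedSpace E M]
    [IsManifold 𝓘(ℝ, E) ∞ M]
    -- the weak hyperkähler structure and the smooth tri-Hamiltonian action
    (g : HKQuot.BilinField E M) (D : HKQuot.Connection E M) (J : Fin 3 → HKQuot.EndoField E M)
    (hHK : HKQuot.IsWeakHyperkahler g D J)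
    [MulAction G M] [ContMDiffSMul 𝓘(ℝ, L) 𝓘(ℝ, E) ∞ G M]
    (μ : Fin 3 → M → (L →L[ℝ] ℝ)) (hμ : HKQuot.IsHyperkahlerMomentMap G g J μ)
    -- the level `c`, fixed by the coadjoint action
    (c : Fin 3 → (L →L[ℝ] ℝ)) (hc : ∀ (h : G) (i : Fin 3), HKQuot.coAd h (c i) = c i)
    (hG : HKQuot.IsGoodOnLevel G g μ c)
    -- the level set is a submanifold
    {Ec : Type*} [NormedAddCommGroup Ec] [NormedSpace ℝ Ec] [CompleteSpace Ec]
    [ChartedSpace Ec (HKQuot.levelSet μ c)] [IsManifold 𝓘(ℝ, Ec) ∞ (HKQuot.levelSet μ c)]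
    (hMc : HKQuot.IsLevelSubmanifold (E := E) (Ec := Ec) μ c)
    -- the hyperkähler quotient `Q`, with its metric and its Levi-Civita connection
    {EQ : Type*} [NormedAddCommGroup EQ] [NormedSpace ℝ EQ] [CompleteSpace EQ]
    [ChartedSpace EQ (HKQuot.Quo G μ c)]
    [IsManifold 𝓘(ℝ, EQ) ∞ (HKQuot.Quo G μ c)]
    (gQ : HKQuot.BilinField EQ (HKQuot.Quo G μ c))
    (hQ : HKQuot.IsQuotientStructure (Ec := Ec) G g μ c gQ)
    (DQ : HKQuot.Connection EQ (HKQuot.Quo G μ c)) (hDQ : HKQuot.IsLeviCivita gQ DQ)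
    -- a point `m` of the level set, a plane in `T_p Q`, `p = proj m`, and its horizontal lift
    (m : HKQuot.levelSet μ c)
    (u v : TangentSpace 𝓘(ℝ, EQ) (HKQuot.proj G μ c m)) (huv : LinearIndependent ℝ ![u, v])
    (u' v' : TangentSpace 𝓘(ℝ, Ec) m)
    (hu : mfderiv 𝓘(ℝ, Ec) 𝓘(ℝ, EQ) (HKQuot.proj G μ c) m u' = u)
    (hv : mfderiv 𝓘(ℝ, Ec) 𝓘(ℝ, EQ) (HKQuot.proj G μ c) m v' = v)
    (hu' : HKQuot.IsHorizontal L G g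
      (mfderiv 𝓘(ℝ, Ec) 𝓘(ℝ, E) (Subtype.val : HKQuot.levelSet μ c → M) m u'))
    (hv' : HKQuot.IsHorizontal L G g
      (mfderiv 𝓘(ℝ, Ec) 𝓘(ℝ, E) (Subtype.val : HKQuot.levelSet μ c → M) m v')) :
    ENNReal.ofReal |HKQuot.sectionalCurvature gQ DQ u v -
        HKQuot.sectionalCurvature g D
          (mfderiv 𝓘(ℝ, Ec) 𝓘(ℝ, E) (Subtype.val : HKQuot.levelSet μ c → M) m u')
          (mfderiv 𝓘(ℝ, Ec) 𝓘(ℝ, E) (Subtype.val : HKQuot.levelSet μ c → M) m v')| ≤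
      9 * HKQuot.oneillNorm L G g D J (HKQuot.levelSet μ c) (m : M) ^ 2 :=
  have H : HKQuot.IsHyperkahlerQuotient (G := G) Ec g D J μ c gQ := ⟨hHK, hμ, hc, hG, hMc, hQ⟩
  H.ofReal_abs_sectionalCurvature_sub_le hDQ huv hu hv hu' hv'
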